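/- Let $(\Gamma,d_0)$ be a compact metric space with $d_0\le 1$, and let $\mathcal H$ be the set of finite nonnegative-integer-valued Borel measures (configurations) on $\Gamma$, with the smallest $\sigma$-algebra $\mathcal B(\mathcal H)$ making all maps $\xi\mapsto\xi(C)$, $C\subset\Gamma$ Borel, measurable. Write $|\xi|$ for the total mass of $\xi$ and $\xi|_C(\cdot)=\xi(\cdot\cap C)$. **Distances.** For $\xi,\eta\in\mathcal H$ let $d_1(\xi,\eta)=1$ if $|\xi|\ne|\eta|$, $d_1(\xi,\eta)=0$ if $|\xi|=|\eta|=0$, and otherwise $d_1(\xi,\eta)=\frac1{|\xi|}\sup_f|\int f\,d\xi-\int f\,d\eta|$, the supremum being over the $f:\Gamma\to\mathbb R$ with $|f(x)-f(y)|\le d_0(x,y)$ for all $x,y$. For probability measures $\mathbf P,\mathbf Q$ on $\mathcal H$ let $d_2(\mathbf P,\mathbf Q)=\sup_f|\int f\,d\mathbf P-\int f\,d\mathbf Q|$, the supremum being over the $f:\mathcal H\to\mathbb R$ with $|f(\xi)-f(\eta)|\le d_1(\xi,\eta)$ for all $\xi,\eta$. **Approximating law.** For $a>0$, $0\le b<1$,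 $\beta\ge0$ let $\pi_{a,b;\beta}$ be the invariant distribution of the birth-death process on $\{0,1,2,\dots\}$ with birth rates $a+bk$ and death rates $k+\beta k(k-1)$. For a probability measure $\nu$ on $\Gamma$ let $\boldsymbol\pi_{a,b;\beta;\nu}$ be the law of $\sum_{i=1}^Z\delta_{U_i}$, where $Z\sim\pi_{a,b;\beta}$ and $U_1,U_2,\dots$ are i.i.d. with law $\nu$ and independent of $Z$ (the polynomial birth-death point process, PBDP). **Local dependence.** Let $\Xi$ be a point process on $\Gamma$, i.e. a random element of $\mathcal H$, whose mean measure $\lambda=\mathbb E\,\Xi$ is finite and nonzero. Point processes $\Xi_x$, $x\in\Gamma$, are reduced Palm processes of $\Xi$ if $\mathbb E\int f(x,\Xi-\delta_x)\,\Xi(dx)=\int\mathbb E f(x,\Xi_x)\,\lambda(dx)$ for all measurable $f\ge0$ on $\Gamma\times\mathcal H$ (their laws forming a probability kernel from $\Gamma$ to $\mathcal H$). A type-I neighbourhood is a family of Borel sets $A_x\ni x$, $x\in\Gamma$, for which $(x,\xi)\mapsto(x,\xi|_{A_x^c})$ is measurable. Assume that $\Xi$ satisfies type-I local dependence: there are such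 $\Xi_x$ and type-I neighbourhoods $\{A_x\}$, $\{B_x\}$ such that for all $x\in\Gamma$: $A_x\subset B_x$; $\Xi_x|_{A_x^c}$ and $\Xi|_{A_x^c}$ have the same law; $\Xi|_{B_x^c}$ is independent of $\Xi|_{A_x}$; and $\Xi_x|_{B_x^c}$ is independent of $\Xi_x|_{A_x}$. Fix such $\Xi_x$, $A_x$, $B_x$. Assume also that $|\Xi|$ has finite variance and $\mathrm{Var}|\Xi|\ge\mathbb E|\Xi|$, and put $$b=\frac{\mathrm{Var}|\Xi|-\mathbb E|\Xi|}{\mathrm{Var}|\Xi|},\qquad a=(1-b)|\lambda|,\qquad \nu=\lambda/|\lambda|.$$ **Error terms.** Let $u>0$, let $\mathcal G=\{G_1,\dots,G_k\}$ be a finite Borel partition of $\Gamma$, let $t_i\in\Gamma$ minimise $t\mapsto\sup_{s\in G_i}d_0(s,t)$, put $d_0(\mathcal G)=\max_i\sup_{s\in G_i}d_0(s,t_i)$ and $\mathscr M\eta=\sum_{i=1}^k\eta(G_i)\delta_{t_i}$ for $\eta\in\mathcal H$. For $\Psi=\Xi$ or $\Psi=\Xi_x$ let $$r_x(\Psi)=4\,\mathbb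 P\Big(\Psi(B_x^c)+1\le\tfrac au\,\Big|\,\Psi|_{B_x}\Big)+\frac{4u+10}a\max_{1\le j\le k}\ \sup_{S\in\mathcal B(\mathcal H)}\Big|\mathbb P\big(\mathscr M(\Psi|_{B_x^c})\in S\,\big|\,\Psi|_{B_x}\big)-\mathbb P\big(\mathscr M(\Psi|_{B_x^c})+\delta_{t_j}\in S\,\big|\,\Psi|_{B_x}\big)\Big|$$ (with regular conditional probabilities), let $\bar r_x(\Psi)$ be the constant obtained by replacing the conditional probabilities with unconditional ones, and let $$\epsilon_{1,x}(\Psi)=r_x(\Psi)\Psi(A_x)\Psi(B_x\setminus A_x)+\bar r_x(\Psi)\tfrac12[\Psi(A_x)+1]\Psi(A_x)+\Psi(A_x)\,\mathbb E[r_x(\Xi)\Xi(B_x)],$$ $$\epsilon_{2,x}(\Psi)=r_x(\Psi)\Psi(B_x\setminus A_x)+\bar r_x(\Psi)+\mathbb E[r_x(\Xi)\Xi(B_x)].$$ **Theorem.** Under these assumptions, $$d_2\big(\mathcal L(\Xi),\boldsymbol\pi_{a,b;0;\nu}\big)\le 2d_0(\mathcal G)+\int_\Gamma\mathbb E\big[(1+b)\big(\epsilon_{1,y}(\Xi_y)+\epsilon_{1,y}(\Xi)\big)+b\,\bar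 r_y(\Xi)\,\Xi_y(A_y)+b\,\epsilon_{2,y}(\Xi_y)\big]\,\lambda(dy).$$ -/

import Mathlib

open MeasureTheory ProbabilityTheory
open scoped ENNReal

noncomputable section

/-! ### Configurations -/

/-- Configurations: the (automatically finite) nonnegative-integer-valued measures on `Γ`.
The σ-algebra is the one of the subtype of `Measure Γ`, i.e. the smallest one that makes
`ξ ↦ ξ S` measurable for every measurable `S`. -/
abbrev Config (Γ : Type*) [MeasurableSpace Γ] : Type _ :=
  {ξ : Measure Γ // ∀ S : Set Γ, MeasurableSet S → ∃ n : ℕ, ξ S = n}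

section Config

variable {Γ : Type*} [MeasurableSpace Γ]

theorem Config.exists_nat (ξ : Config Γ) (S : Set Γ) : ∃ n : ℕ, ξ.1 S = n := by
  obtain ⟨n, hn⟩ := ξ.2 (toMeasurable ξ.1 S) (measurableSet_toMeasurable _ _)
  exact ⟨n, by rw [← hn, measure_toMeasurable]⟩

/-- The number `ξ(S)` of points of `ξ` in `S`, as a natural number. -/
def Config.count (ξ : Config Γ) (S : Set Γ) : ℕ := ⌊(ξ.1 S).toReal⌋₊

theorem Config.coe_count (ξ : Config Γ) (S : Set Γ) : (Config.count ξ S : ℝ≥0∞) = ξ.1 S := by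
  obtain ⟨n, hn⟩ := Config.exists_nat ξ S
  simp [Config.count, hn]

/-- The restriction `ξ|_S`. -/
def Config.restrict (ξ : Config Γ) (S : Set Γ) : Config Γ :=
  ⟨ξ.1.restrict S, fun T hT => by
    rw [Measure.restrict_apply hT]; exact Config.exists_nat ξ _⟩

/-- `ξ + δ_x`. -/
def Config.addPoint (ξ : Config Γ) (x : Γ) : Config Γ :=
  ⟨ξ.1 + Measure.dirac x, fun S hS => by
    obtain ⟨n, hn⟩ := ξ.2 S hS
    by_cases hx : x ∈ S
    · exact ⟨n + 1, by simp [hn, hx, hS]⟩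
    · exact ⟨n, by simp [hn, hx, hS]⟩⟩

/-- `ξ - δ_x` (only used at points `x` of `ξ`). -/
def Config.removePoint [MeasurableSingletonClass Γ] (ξ : Config Γ) (x : Γ) : Config Γ :=
  ⟨ξ.1 - Measure.dirac x, fun S hS => by
    obtain ⟨m, hm⟩ := ξ.2 {x} (measurableSet_singleton x)
    rcases Nat.eq_zero_or_pos m with h0 | hpos
    · have hxi : ξ.1 - Measure.dirac x = ξ.1 := by
        refine le_antisymm Measure.sub_le (le_sInf fun d hd => ?_)
        refine Measure.le_iff.2 fun T hT => ?_
        have h1 : ξ.1 T = ξ.1 (T \ {x}) :=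
          (measure_sdiff_null (by rw [hm, h0]; simp)).symm
        have h2 := Measure.le_iff.1 hd (T \ {x}) (hT.diff (measurableSet_singleton x))
        rw [h1]
        refine h2.trans ?_
        simpa [hT.diff (measurableSet_singleton x)] using measure_mono Set.sdiff_subset
      rw [hxi]; exact ξ.2 S hS
    · have hle : Measure.dirac x ≤ ξ.1 := by
        refine Measure.le_iff.2 fun T hT => ?_
        by_cases hx : x ∈ T
        · rw [Measure.dirac_apply_of_mem hx]
          calc (1 : ℝ≥0∞) ≤ (m : ℝ≥0∞) := by exact_mod_cast hpos
            _ = ξ.1 {x} := hm.symm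
            _ ≤ ξ.1 T := measure_mono (Set.singleton_subset_iff.2 hx)
        · simp [hx, hT]
      rw [Measure.sub_apply hS hle]
      obtain ⟨n, hn⟩ := ξ.2 S hS
      by_cases hx : x ∈ S
      · exact ⟨n - 1, by simp [hn, hx, hS]⟩
      · exact ⟨n, by simp [hn, hx, hS]⟩⟩

/-- The configuration `∑ i, v i • δ_{t i}`. -/
def Config.ofCounts {k : ℕ} (t : Fin k → Γ) (v : Fin k → ℕ) : Config Γ :=
  ⟨∑ i, v i • Measure.dirac (t i), fun S hS => by
    classical
    refine ⟨∑ i, v i * (if t i ∈ S then 1 else 0), ?_⟩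
    simp [Set.indicator_apply, hS]⟩

/-- The configuration `∑ i, δ_{x i}` of `n` points. -/
def Config.ofPoints {n : ℕ} (x : Fin n → Γ) : Config Γ := Config.ofCounts x fun _ => 1

/-- Moves all the points of `η` in `G i` to `t i`, for every `i`:
the configuration `∑ i, η(G i) δ_{t i}`. -/
def Config.assemble {k : ℕ} (G : Fin k → Set Γ) (t : Fin k → Γ) (η : Config Γ) : Config Γ :=
  Config.ofCounts t fun i => Config.count η (G i)

/-- The mean measure `λ(S) = E Ξ(S)` of a point process with law `P`. -/
def meanMeasure (P : Measure (Config Γ)) : Measure Γ := P.bind fun ξ => ξ.1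

end Config

/-! ### The distances -/

section Distances

variable {Γ : Type*} [MetricSpace Γ] [MeasurableSpace Γ]

open scoped Classical in
/-- The normalised Wasserstein distance `d₁` between configurations. -/
def d1 (ξ η : Config Γ) : ℝ :=
  if ξ.1 Set.univ = η.1 Set.univ then
    if ξ.1 Set.univ = 0 then 0
    else (ξ.1 Set.univ).toReal⁻¹ *
      ⨆ f : {f : Γ → ℝ // ∀ x y, |f x - f y| ≤ dist x y}, |∫ x, f.1 x ∂ξ.1 - ∫ x, f.1 x ∂η.1|
  else 1

/-- The Barbour-Brown distance between two laws of point processes: the supremum of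
`|P(f) - Q(f)|` over the functions `f` that are 1-Lipschitz for `d₁`. -/
def d2 (P Q : Measure (Config Γ)) : ℝ≥0∞ :=
  ⨆ f : {f : Config Γ → ℝ // ∀ ξ η, |f ξ - f η| ≤ d1 ξ η},
    ENNReal.ofReal |∫ ξ, f.1 ξ ∂P - ∫ ξ, f.1 ξ ∂Q|

end Distances

/-! ### Polynomial birth-death distributions and point processes -/

/-- Birth rate `a + b k` in state `k`. -/
def birthRate (a b : ℝ) (k : ℕ) : ℝ := a + b * k

/-- Death rate `k + β k (k - 1)` in state `k`. -/
def deathRate (β : ℝ) (k : ℕ) : ℝ := k + β * k * (k - 1)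

/-- `ρ` is an invariant distribution of the birth-death process with birth rates `a + b k` and
death rates `k + β k (k - 1)`: in every state the flow out equals the flow in. -/
def IsInvariantBD (a b β : ℝ) (ρ : Measure ℕ) : Prop :=
  ∀ k : ℕ, (birthRate a b k + deathRate β k) * ρ.real {k} =
    (if k = 0 then 0 else birthRate a b (k - 1) * ρ.real {k - 1}) +
      deathRate β (k + 1) * ρ.real {k + 1}

/-- Unnormalised weights of the invariant distribution. -/
def pbdWeight (a b β : ℝ) (n : ℕ) : ℝ :=
  ∏ i ∈ Finset.range n, birthRate a b i / deathRate β (i + 1)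

/-- The polynomial birth-death distribution `π_{a,b;β}`, the invariant distribution of the
birth-death process with these rates (see `isInvariantBD_iff`). -/
def pbd (a b β : ℝ) : Measure ℕ :=
  Measure.sum fun n => ENNReal.ofReal (pbdWeight a b β n / ∑' m, pbdWeight a b β m) •
    Measure.dirac n

theorem deathRate_succ_pos {β : ℝ} (hβ : 0 ≤ β) (k : ℕ) : 0 < deathRate β (k + 1) := by
  unfold deathRate
  push_cast
  have : 0 ≤ β * ((k : ℝ) + 1) * ((k : ℝ) + 1 - 1) := by
    have : (k : ℝ) + 1 - 1 = k := by ring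
    rw [this]; positivity
  positivity

theorem birthRate_pos {a b : ℝ} (ha : 0 < a) (hb : 0 ≤ b) (k : ℕ) : 0 < birthRate a b k := by
  unfold birthRate; positivity

theorem pbdWeight_pos {a b β : ℝ} (ha : 0 < a) (hb : 0 ≤ b) (hβ : 0 ≤ β) (n : ℕ) :
    0 < pbdWeight a b β n :=
  Finset.prod_pos fun i _ => div_pos (birthRate_pos ha hb i) (deathRate_succ_pos hβ i)

theorem pbdWeight_succ (a b β : ℝ) (n : ℕ) :
    pbdWeight a b β (n + 1) = pbdWeight a b β n * (birthRate a b n / deathRate β (n + 1)) := by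
  rw [pbdWeight, Finset.prod_range_succ, ← pbdWeight]

theorem summable_pbdWeight {a b β : ℝ} (ha : 0 < a) (hb : 0 ≤ b) (hb1 : b < 1) (hβ : 0 ≤ β) :
    Summable (pbdWeight a b β) := by
  refine summable_of_ratio_norm_eventually_le (r := (1 + b) / 2) (by linarith) ?_
  obtain ⟨N, hN⟩ := exists_nat_ge (2 * a / (1 - b))
  filter_upwards [Filter.eventually_ge_atTop N] with n hn
  have hw := pbdWeight_pos ha hb hβ n
  have hd := deathRate_succ_pos hβ n
  rw [pbdWeight_succ, Real.norm_of_nonneg hw.le,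
    Real.norm_of_nonneg (mul_nonneg hw.le (div_nonneg (birthRate_pos ha hb n).le hd.le)), mul_comm]
  refine mul_le_mul_of_nonneg_right ?_ hw.le
  rw [div_le_iff₀ hd]
  have h1 : (n : ℝ) + 1 ≤ deathRate β (n + 1) := by
    unfold deathRate; push_cast
    have : 0 ≤ β * ((n : ℝ) + 1) * ((n : ℝ) + 1 - 1) := by
      have : (n : ℝ) + 1 - 1 = n := by ring
      rw [this]; positivity
    linarith
  have h2 : 2 * a / (1 - b) ≤ n := hN.trans (by exact_mod_cast hn)
  rw [div_le_iff₀ (by linarith)] at h2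
  unfold birthRate
  nlinarith

theorem pbd_real_singleton {a b β : ℝ} (n : ℕ) (h : 0 ≤ pbdWeight a b β n / ∑' m, pbdWeight a b β m) :
    (pbd a b β).real {n} = pbdWeight a b β n / ∑' m, pbdWeight a b β m := by
  have : (pbd a b β) {n} = ENNReal.ofReal (pbdWeight a b β n / ∑' m, pbdWeight a b β m) := by
    unfold pbd
    rw [Measure.sum_apply _ (measurableSet_singleton n), tsum_eq_single n]
    · simp
    · intro m hm
      simp [hm]
  rw [measureReal_def, this, ENNReal.toReal_ofReal h]

theorem isProbabilityMeasure_pbd {a b β : ℝ} (ha : 0 < a) (hb : 0 ≤ b) (hb1 : b < 1)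
    (hβ : 0 ≤ β) : IsProbabilityMeasure (pbd a b β) := by
  constructor
  have hs := summable_pbdWeight ha hb hb1 hβ
  have hpos : 0 < ∑' m, pbdWeight a b β m :=
    hs.tsum_pos (fun n => (pbdWeight_pos ha hb hβ n).le) 0 (pbdWeight_pos ha hb hβ 0)
  unfold pbd
  rw [Measure.sum_apply _ MeasurableSet.univ]
  simp only [Measure.smul_apply, measure_univ, smul_eq_mul, mul_one]
  rw [← ENNReal.ofReal_tsum_of_nonneg (fun n => div_nonneg (pbdWeight_pos ha hb hβ n).le hpos.le)
    (hs.div_const _), tsum_div_const, div_self hpos.ne', ENNReal.ofReal_one]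

/-- `π_{a,b;β}` is the unique invariant distribution of the birth-death process. -/
theorem isInvariantBD_iff {a b β : ℝ} (ha : 0 < a) (hb : 0 ≤ b) (hb1 : b < 1) (hβ : 0 ≤ β)
    (ρ : Measure ℕ) [IsProbabilityMeasure ρ] : IsInvariantBD a b β ρ ↔ ρ = pbd a b β := by
  have hs := summable_pbdWeight ha hb hb1 hβ
  have hpos : 0 < ∑' m, pbdWeight a b β m :=
    hs.tsum_pos (fun n => (pbdWeight_pos ha hb hβ n).le) 0 (pbdWeight_pos ha hb hβ 0)
  have hpbd : ∀ n, (pbd a b β).real {n} = pbdWeight a b β n / ∑' m, pbdWeight a b β m :=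
    fun n => pbd_real_singleton n (div_nonneg (pbdWeight_pos ha hb hβ n).le hpos.le)
  have hdet : ∀ n, birthRate a b n * pbdWeight a b β n =
      deathRate β (n + 1) * pbdWeight a b β (n + 1) := by
    intro n
    have := (deathRate_succ_pos hβ n).ne'
    rw [pbdWeight_succ]; field_simp
  constructor
  · intro h
    have hflow : ∀ n, birthRate a b n * ρ.real {n} = deathRate β (n + 1) * ρ.real {n + 1} := by
      intro n
      induction n with
      | zero => simpa [deathRate] using h 0
      | succ n ih =>
        have := h (n + 1)
        simp only [Nat.add_eq_zero_iff, one_ne_zero, and_false, if_false,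
          Nat.add_sub_cancel] at this
        linarith
    have hprop : ∀ n, ρ.real {n} = ρ.real {0} * pbdWeight a b β n := by
      intro n
      induction n with
      | zero => simp [pbdWeight]
      | succ n ih =>
        have hd := (deathRate_succ_pos hβ n).ne'
        have := hflow n
        rw [ih] at this
        apply mul_left_cancel₀ hd
        rw [← this]
        have := hdet n
        linear_combination (ρ.real {0}) * this
    have htot : ∑' n, ρ.real {n} = 1 := by
      have h1 : ∑' n, ρ {n} = 1 := by
        have hd : Pairwise (Function.onFun Disjoint fun n : ℕ => ({n} : Set ℕ)) :=
          fun i j hij => by simpa [Function.onFun] using hij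
        rw [← measure_iUnion hd fun i => measurableSet_singleton i, Set.iUnion_of_singleton,
          measure_univ]
      have h2 := congrArg ENNReal.toReal h1
      rw [ENNReal.tsum_toReal_eq (fun n => measure_ne_top _ _)] at h2
      simpa [measureReal_def] using h2
    have h0 : ρ.real {0} * ∑' m, pbdWeight a b β m = 1 := by
      rw [← tsum_mul_left, ← htot]
      exact tsum_congr fun n => (hprop n).symm
    have := isProbabilityMeasure_pbd ha hb hb1 hβ
    refine Measure.ext_of_singleton fun n => ?_
    have : ρ.real {n} = (pbd a b β).real {n} := by
      rw [hpbd, hprop, eq_div_iff hpos.ne']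
      linear_combination (pbdWeight a b β n) * h0
    exact (measureReal_eq_measureReal_iff).1 this
  · rintro rfl k
    simp only [hpbd]
    rcases k with _ | k
    · have := hdet 0
      simp only [deathRate, Nat.cast_zero, if_true, zero_add] at this ⊢
      field_simp
      linear_combination this
    · have h1 := hdet k
      have h2 := hdet (k + 1)
      simp only [Nat.add_eq_zero_iff, one_ne_zero, and_false, if_false, Nat.add_sub_cancel]
      field_simp
      linear_combination h2 - h1

section PointProc

variable {Γ : Type*} [MeasurableSpace Γ]

/-- The law of the polynomial birth-death point process `∑_{i ≤ Z} δ_{U_i}`, with `Z` of law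
`π_{a,b;β}` and independent of the independent points `U_i` of law `ν`: given `Z = n`, it is
the law of `n` independent points of law `ν`. -/
def pbdp (a b β : ℝ) (ν : Measure Γ) : Measure (Config Γ) :=
  (pbd a b β).bind fun n => (Measure.pi fun _ : Fin n => ν).map Config.ofPoints

/-! ### Reduced Palm processes and local dependence

The laws of the reduced Palm processes `Ξ_x` are given by a kernel `Q`, where `Q x` is the
law of `Ξ_x`. -/

/-- `Q` is a family of laws of reduced Palm processes for the point process law `P`. -/
def IsReducedPalm [MeasurableSingletonClass Γ] (P : Measure (Config Γ))
    (Q : Kernel Γ (Config Γ)) : Prop :=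
  ∀ f : Γ × Config Γ → ℝ≥0∞, Measurable f →
    ∫⁻ ξ, ∫⁻ x, f (x, Config.removePoint ξ x) ∂ξ.1 ∂P =
      ∫⁻ x, ∫⁻ ζ, f (x, ζ) ∂(Q x) ∂(meanMeasure P)

/-- Type-I neighbourhoods. -/
structure IsTypeINeighbourhood (A : Γ → Set Γ) : Prop where
  mem : ∀ x, x ∈ A x
  measurableSet : ∀ x, MeasurableSet (A x)
  measurable_restrict_compl :
    Measurable fun p : Γ × Config Γ => (p.1, Config.restrict p.2 (A p.1)ᶜ)

/-- Type-I local dependence of the point process law `P` with reduced Palm laws `Q`, as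
witnessed by the neighbourhoods `A x ⊆ B x`. -/
structure TypeILocalDependence (P : Measure (Config Γ)) (Q : Kernel Γ (Config Γ))
    (A B : Γ → Set Γ) : Prop where
  left : IsTypeINeighbourhood A
  right : IsTypeINeighbourhood B
  subset : ∀ x, A x ⊆ B x
  law_eq : ∀ x, (Q x).map (fun ξ => Config.restrict ξ (A x)ᶜ) =
    P.map (fun ξ => Config.restrict ξ (A x)ᶜ)
  indep : ∀ x, IndepFun (fun ξ => Config.restrict ξ (B x)ᶜ)
    (fun ξ => Config.restrict ξ (A x)) P
  indep_palm : ∀ x, IndepFun (fun ξ => Config.restrict ξ (B x)ᶜ)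
    (fun ξ => Config.restrict ξ (A x)) (Q x)

/-! ### The error terms

Below, `μ` is the law of a point process `Ψ` (either `Ξ` or `Ξ_x`), `P` is the law of `Ξ`, and
random variables that are functions of `Ψ` are written as functions of the configuration. -/

/-- `sup_S |P(η ∈ S) - P(η + δ_s ∈ S)|` for a random configuration `η` of law `ρ`. -/
def shiftTV (ρ : Measure (Config Γ)) (s : Γ) : ℝ≥0∞ :=
  ⨆ S : {S : Set (Config Γ) // MeasurableSet S},
    ENNReal.ofReal |ρ.real S.1 - ρ.real {η | Config.addPoint η s ∈ S.1}|

/-- A regular version of the conditional law of `Ψ(Bᶜ)` given `Ψ|_B`, at the value `ξ|_B`. -/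
def condCountLaw (μ : Measure (Config Γ)) [IsFiniteMeasure μ] (B : Set Γ) (ξ : Config Γ) :
    Measure ℕ :=
  condDistrib (fun ψ : Config Γ => Config.count ψ Bᶜ) (fun ψ => Config.restrict ψ B) μ
    (Config.restrict ξ B)

/-- A regular version of the conditional law of the assembled configuration
`∑ i, Ψ|_{Bᶜ}(G i) δ_{t i}` given `Ψ|_B`, at the value `ξ|_B`. It is the image under
`v ↦ ∑ i, v i • δ_{t i}` of the conditional law of the numbers `Ψ|_{Bᶜ}(G i)`. -/
def condAssembledLaw {k : ℕ} (G : Fin k → Set Γ) (t : Fin k → Γ) (μ : Measure (Config Γ))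
    [IsFiniteMeasure μ] (B : Set Γ) (ξ : Config Γ) : Measure (Config Γ) :=
  (condDistrib (fun (ψ : Config Γ) (i : Fin k) => Config.count (Config.restrict ψ Bᶜ) (G i))
    (fun ψ => Config.restrict ψ B) μ (Config.restrict ξ B)).map (Config.ofCounts t)

/-- The random variable `r_x(Ψ)`, where `B = B_x`. -/
def rCond (a u : ℝ) {k : ℕ} (G : Fin k → Set Γ) (t : Fin k → Γ) (μ : Measure (Config Γ))
    [IsFiniteMeasure μ] (B : Set Γ) (ξ : Config Γ) : ℝ≥0∞ :=
  4 * condCountLaw μ B ξ {n : ℕ | (n : ℝ) + 1 ≤ a / u} +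
    ENNReal.ofReal ((4 * u + 10) / a) * ⨆ j, shiftTV (condAssembledLaw G t μ B ξ) (t j)

/-- The constant `r̄_x(Ψ)`, where `B = B_x`. -/
def rMean (a u : ℝ) {k : ℕ} (G : Fin k → Set Γ) (t : Fin k → Γ) (μ : Measure (Config Γ))
    (B : Set Γ) : ℝ≥0∞ :=
  4 * μ {ψ | (Config.count ψ Bᶜ : ℝ) + 1 ≤ a / u} +
    ENNReal.ofReal ((4 * u + 10) / a) *
      ⨆ j, shiftTV (μ.map fun ψ => Config.assemble G t (Config.restrict ψ Bᶜ)) (t j)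

/-- The random variable `ε_{1,x}(Ψ)`, where `A = A_x` and `B = B_x`. -/
def eps1 (a u : ℝ) {k : ℕ} (G : Fin k → Set Γ) (t : Fin k → Γ) (P μ : Measure (Config Γ))
    [IsFiniteMeasure P] [IsFiniteMeasure μ] (A B : Set Γ) (ξ : Config Γ) : ℝ≥0∞ :=
  rCond a u G t μ B ξ * ξ.1 A * ξ.1 (B \ A) +
    rMean a u G t μ B * ((ξ.1 A + 1) * ξ.1 A / 2) +
    ξ.1 A * ∫⁻ ψ, rCond a u G t P B ψ * ψ.1 B ∂P

/-- The random variable `ε_{2,x}(Ψ)`, where `A = A_x` and `B = B_x`. -/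
def eps2 (a u : ℝ) {k : ℕ} (G : Fin k → Set Γ) (t : Fin k → Γ) (P μ : Measure (Config Γ))
    [IsFiniteMeasure P] [IsFiniteMeasure μ] (A B : Set Γ) (ξ : Config Γ) : ℝ≥0∞ :=
  rCond a u G t μ B ξ * ξ.1 (B \ A) + rMean a u G t μ B +
    ∫⁻ ψ, rCond a u G t P B ψ * ψ.1 B ∂P

end PointProc

/-- `G` is a finite measurable partition, and every centre `t i` minimises
`sup_{s ∈ G i} d₀(s, t i)` over all points of the space. -/
structure IsCentredPartition {Γ : Type*} [MetricSpace Γ] [MeasurableSpace Γ] {k : ℕ}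
    (G : Fin k → Set Γ) (t : Fin k → Γ) : Prop where
  measurableSet : ∀ i, MeasurableSet (G i)
  disjoint : Pairwise fun i j => Disjoint (G i) (G j)
  cover : ⋃ i, G i = Set.univ
  minimal : ∀ i t', ⨆ s ∈ G i, edist s (t i) ≤ ⨆ s ∈ G i, edist s t'

/-- The mesh `d₀(𝒢) = max_i sup_{s ∈ G i} d₀(s, t i)`. -/
def mesh {Γ : Type*} [MetricSpace Γ] {k : ℕ} (G : Fin k → Set Γ) (t : Fin k → Γ) : ℝ≥0∞ :=
  ⨆ i, ⨆ s ∈ G i, edist s (t i)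

end

noncomputable section

set_option linter.unusedSectionVars false

/-! The proof is Stein's method for a birth-death process on vectors of cell counts. Moving each
point to the centre of its cell costs at most the mesh under each of the two laws, whence the term
`2 * mesh G t`. What remains concerns functions `F` of the count vector `v`. Points are born at
total rate `a + b * tot v`, in a random cell of law `p`, and each point dies at unit rate. The
approximating process is invariant for the generator `gen` (`integral_pbdp_eq`), so a solution of
`gen h = F - c` turns the distance into the mean of `gen h` under the law of Ξ.

The analytic part is `exists_stein_solution`. With births switched off at level `N` the equation is
a finite linear system, solvable by the maximum principle. The effect on `h` of moving one point
solves an equation killed at unit rate, so an explicit supersolution bounds it. Two barriers bound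
the cost of climbing or descending one level where the drift helps. Together with the equation
itself they bound second differences by `5 / a + 2 / (n + 1)` at level `n`, unless this exceeds 2.
All bounds are free of `N`, which tends to infinity. The complementary bound 2 comes from the affine
rates: two added points found independent families, a mixed difference is driven only while both
families are alive, and `pairBound` dominates that time.

Smoothing turns these bounds into small mean third differences. Shifting a random vector by one
point changes the mean of a bounded function by twice its bound times a total variation distance.
Where many points are present the bound is `(2 * u + 5) / a`; elsewhere it is 2. This produces
`smoothBound`, the prototype of $r_x$ and $\bar r_x$.

For local dependence, the Palm identity writes the mean of `gen h` as an integral over the mean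
measure of first differences of `h` at $\Xi_y$ and at Ξ. The counts are split into those in $A_y$,
in $B_y\setminus A_y$ and in $B_y^c$. Expanding first differences to second order, and replacing
every second difference by one reference mean `R`, costs only mean third differences, which are the
$\epsilon$ terms. The main terms that remain are `(m y - b * (m y + 1)) * R`, where `m y` is the
mean total of $\Xi_y$ minus that of Ξ. Since `m` integrates to $\mathrm{Var}|\Xi|-\mathbb E|\Xi|$
and `m + 1` to $\mathrm{Var}|\Xi|$, the choice of `b` annihilates their integral, as the choice of
`a` matches the first differences at Ξ. -/

namespace BirthDeath

variable {ι : Type*} [Fintype ι]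

/-! ### Count vectors -/

/-- The total of a count vector. -/
def tot (v : ι → ℕ) : ℕ := ∑ i, v i

theorem tot_zero : tot (0 : ι → ℕ) = 0 := by simp [tot]

theorem tot_add (v w : ι → ℕ) : tot (v + w) = tot v + tot w := by
  simp [tot, Finset.sum_add_distrib]

theorem tot_eq_zero {v : ι → ℕ} : tot v = 0 ↔ v = 0 := by
  simp [tot, funext_iff]

theorem le_tot (v : ι → ℕ) (i : ι) : v i ≤ tot v :=
  Finset.single_le_sum (f := v) (fun _ _ => Nat.zero_le _) (Finset.mem_univ i)

theorem tot_cast (v : ι → ℕ) : (tot v : ℝ) = ∑ i, (v i : ℝ) := by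
  simp [tot]

theorem finite_tot_le (N : ℕ) : {v : ι → ℕ | tot v ≤ N}.Finite := by
  refine (Set.Finite.pi' (t := fun _ : ι => Set.Iic N) fun _ => Set.finite_Iic N).subset ?_
  intro v hv i
  exact (le_tot v i).trans hv

theorem exists_pos_of_tot_pos {v : ι → ℕ} (h : 0 < tot v) : ∃ i, 0 < v i := by
  by_contra hc
  push Not at hc
  have : v = 0 := funext fun i => Nat.le_zero.1 (hc i)
  rw [this, tot_zero] at h
  exact h.false

theorem exists_max_tot_le (h : (ι → ℕ) → ℝ) (N : ℕ) :
    ∃ v, tot v ≤ N ∧ ∀ w, tot w ≤ N → h w ≤ h v := by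
  obtain ⟨v, hv, hmax⟩ := Set.exists_max_image {v : ι → ℕ | tot v ≤ N} h (finite_tot_le N)
    ⟨0, by simp [tot_zero]⟩
  exact ⟨v, hv, hmax⟩

variable [DecidableEq ι]

theorem tot_single (i : ι) : tot (Pi.single i 1 : ι → ℕ) = 1 := by
  simp [tot]

theorem tot_add_single (v : ι → ℕ) (i : ι) : tot (v + Pi.single i 1) = tot v + 1 := by
  rw [tot_add, tot_single]

theorem single_le {v : ι → ℕ} {i : ι} (h : 0 < v i) : (Pi.single i 1 : ι → ℕ) ≤ v := by
  intro j
  by_cases hj : j = i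
  · subst hj; simpa using Nat.succ_le_of_lt h
  · simp [hj]

theorem sub_single_add {v : ι → ℕ} {i : ι} (h : 0 < v i) :
    v - Pi.single i 1 + Pi.single i 1 = v := tsub_add_cancel_of_le (single_le h)

theorem tot_sub_single {v : ι → ℕ} {i : ι} (h : 0 < v i) :
    tot (v - Pi.single i 1) + 1 = tot v := by
  rw [← tot_add_single, sub_single_add h]

theorem sub_single_add_comm {v w : ι → ℕ} {i : ι} (h : 0 < v i) :
    v + w - Pi.single i 1 = v - Pi.single i 1 + w :=
  tsub_add_eq_add_tsub (single_le h) |>.symm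

/-- Induction on count vectors by adding one point at a time. -/
theorem vec_induction {motive : (ι → ℕ) → Prop} (zero : motive 0)
    (add : ∀ v i, motive v → motive (v + Pi.single i 1)) (v : ι → ℕ) : motive v := by
  obtain ⟨n, hn⟩ : ∃ n, tot v = n := ⟨_, rfl⟩
  induction n generalizing v with
  | zero => rw [tot_eq_zero.1 hn]; exact zero
  | succ n ih =>
    obtain ⟨i, hi⟩ := exists_pos_of_tot_pos (v := v) (by omega)
    have := tot_sub_single hi
    rw [← sub_single_add hi]
    exact add _ _ (ih _ (by omega))

/-! ### The generator -/

/-- Mean increment of `h` when a point with law `p` is added. -/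
def birth (p : ι → ℝ) (h : (ι → ℕ) → ℝ) (v : ι → ℕ) : ℝ :=
  ∑ i, p i * (h (v + Pi.single i 1) - h v)

/-- Sum of the increments of `h` when a point is removed. -/
def death (h : (ι → ℕ) → ℝ) (v : ι → ℕ) : ℝ :=
  ∑ i, (v i : ℝ) * (h (v - Pi.single i 1) - h v)

/-- The generator of the birth-death process with birth rates `β` and unit death rates. -/
def gen (p : ι → ℝ) (β : ℕ → ℝ) (h : (ι → ℕ) → ℝ) (v : ι → ℕ) : ℝ :=
  β (tot v) * birth p h v + death h v

theorem gen_add (p : ι → ℝ) (β : ℕ → ℝ) (h g : (ι → ℕ) → ℝ) (v : ι → ℕ) :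
    gen p β (h + g) v = gen p β h v + gen p β g v := by
  have h1 : birth p (h + g) v = birth p h v + birth p g v := by
    simp only [birth, ← Finset.sum_add_distrib, Pi.add_apply]
    exact Finset.sum_congr rfl fun i _ => by ring
  have h2 : death (h + g) v = death h v + death g v := by
    simp only [death, ← Finset.sum_add_distrib, Pi.add_apply]
    exact Finset.sum_congr rfl fun i _ => by ring
  rw [gen, gen, gen, h1, h2]; ring

theorem gen_smul (p : ι → ℝ) (β : ℕ → ℝ) (c : ℝ) (h : (ι → ℕ) → ℝ) (v : ι → ℕ) :
    gen p β (c • h) v = c * gen p β h v := by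
  have h1 : birth p (c • h) v = c * birth p h v := by
    simp only [birth, Finset.mul_sum, Pi.smul_apply, smul_eq_mul]
    exact Finset.sum_congr rfl fun i _ => by ring
  have h2 : death (c • h) v = c * death h v := by
    simp only [death, Finset.mul_sum, Pi.smul_apply, smul_eq_mul]
    exact Finset.sum_congr rfl fun i _ => by ring
  rw [gen, gen, h1, h2]; ring

theorem gen_neg (p : ι → ℝ) (β : ℕ → ℝ) (h : (ι → ℕ) → ℝ) (v : ι → ℕ) :
    gen p β (fun w => -h w) v = -gen p β h v := by
  have := gen_smul p β (-1) h v
  rw [neg_one_mul] at this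
  rw [← this]
  congr 1
  funext w
  simp

/-- Truncated subtraction is harmless here: where `v i = 0` the coefficient vanishes, and otherwise
the dying point can be taken from `v` itself; likewise for `w`. -/
theorem death_add (h : (ι → ℕ) → ℝ) (v w : ι → ℕ) :
    death h (v + w) = ∑ i, (v i : ℝ) * (h (v - Pi.single i 1 + w) - h (v + w)) +
      ∑ i, (w i : ℝ) * (h (v + (w - Pi.single i 1)) - h (v + w)) := by
  rw [death, ← Finset.sum_add_distrib]
  refine Finset.sum_congr rfl fun i _ => ?_
  have h1 : (v i : ℝ) * (h (v + w - Pi.single i 1) - h (v + w)) =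
      (v i : ℝ) * (h (v - Pi.single i 1 + w) - h (v + w)) := by
    rcases Nat.eq_zero_or_pos (v i) with h0 | h0
    · simp [h0]
    · rw [sub_single_add_comm h0]
  have h2 : (w i : ℝ) * (h (v + w - Pi.single i 1) - h (v + w)) =
      (w i : ℝ) * (h (v + (w - Pi.single i 1)) - h (v + w)) := by
    rcases Nat.eq_zero_or_pos (w i) with h0 | h0
    · simp [h0]
    · rw [add_comm v w, sub_single_add_comm h0, add_comm v]
  rw [← h1, ← h2, Pi.add_apply]
  push_cast
  ring

theorem death_add_single (h : (ι → ℕ) → ℝ) (v : ι → ℕ) (j : ι) :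
    death h (v + Pi.single j 1) =
      ∑ i, (v i : ℝ) * (h (v - Pi.single i 1 + Pi.single j 1) - h (v + Pi.single j 1)) +
      (h v - h (v + Pi.single j 1)) := by
  rw [death_add]
  congr 1
  rw [Finset.sum_eq_single j]
  · simp
  · intro i _ hi; simp [hi]
  · simp

/-! ### The truncated Stein equation -/

section Truncated

variable {p : ι → ℝ} {β : ℕ → ℝ} {N : ℕ}

theorem birth_nonpos (hp : ∀ i, 0 ≤ p i) {h : (ι → ℕ) → ℝ} {v : ι → ℕ}
    (hmax : ∀ i, h (v + Pi.single i 1) ≤ h v) : birth p h v ≤ 0 :=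
  Finset.sum_nonpos fun i _ => mul_nonpos_of_nonneg_of_nonpos (hp i) (sub_nonpos.2 (hmax i))

theorem mul_birth_nonpos_of_max (hp : ∀ i, 0 ≤ p i) (hβ : ∀ k, 0 ≤ β k) (hN : β N = 0)
    {h : (ι → ℕ) → ℝ} {v : ι → ℕ} (hv : tot v ≤ N) (hmax : ∀ w, tot w ≤ N → h w ≤ h v) :
    β (tot v) * birth p h v ≤ 0 := by
  rcases hv.eq_or_lt with h0 | h0
  · rw [h0, hN, zero_mul]
  · exact mul_nonpos_of_nonneg_of_nonpos (hβ _)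
      (birth_nonpos hp fun i => hmax _ (by rw [tot_add_single]; omega))

theorem death_term_nonpos_of_max {h : (ι → ℕ) → ℝ} {v : ι → ℕ} (hv : tot v ≤ N)
    (hmax : ∀ w, tot w ≤ N → h w ≤ h v) (i : ι) :
    (v i : ℝ) * (h (v - Pi.single i 1) - h v) ≤ 0 := by
  rcases Nat.eq_zero_or_pos (v i) with h0 | h0
  · simp [h0]
  · have := tot_sub_single h0
    exact mul_nonpos_of_nonneg_of_nonpos (Nat.cast_nonneg _)
      (sub_nonpos.2 (hmax _ (by omega)))

/-- Since `β N = 0`, no jump of positive rate leaves the finite set `tot v ≤ N`, so a maximum over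
that set is a maximum over everything the generator sees. -/
theorem gen_nonpos_of_max (hp : ∀ i, 0 ≤ p i) (hβ : ∀ k, 0 ≤ β k) (hN : β N = 0)
    {h : (ι → ℕ) → ℝ} {v : ι → ℕ} (hv : tot v ≤ N) (hmax : ∀ w, tot w ≤ N → h w ≤ h v) :
    gen p β h v ≤ 0 :=
  add_nonpos (mul_birth_nonpos_of_max hp hβ hN hv hmax)
    (Finset.sum_nonpos fun i _ => death_term_nonpos_of_max hv hmax i)

/-- If the generator vanishes at a maximum, every possible death must preserve the maximal value;
removing points one by one carries it down to the empty vector. -/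
theorem le_apply_zero_of_gen_eq_zero (hp : ∀ i, 0 ≤ p i) (hβ : ∀ k, 0 ≤ β k) (hN : β N = 0)
    {h : (ι → ℕ) → ℝ} (hh : ∀ v, tot v ≤ N → gen p β h v = 0) {w : ι → ℕ} (hw : tot w ≤ N) :
    h w ≤ h 0 := by
  have key : ∀ n, ∀ v : ι → ℕ, tot v = n → n ≤ N → (∀ w, tot w ≤ N → h w ≤ h v) →
      ∀ w, tot w ≤ N → h w ≤ h 0 := by
    intro n
    induction n with
    | zero =>
      intro v hv _ hmax
      rwa [tot_eq_zero.1 hv] at hmax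
    | succ n ih =>
      intro v hv hn hmax
      obtain ⟨i, hi⟩ := exists_pos_of_tot_pos (v := v) (by omega)
      have h1 := mul_birth_nonpos_of_max hp hβ hN (hv ▸ hn) hmax
      have h2 := fun i => death_term_nonpos_of_max (hv ▸ hn) hmax i
      have h3 := hh v (hv ▸ hn)
      -- Birth and death parts are both nonpositive and add up to zero.
      have h4 : death h v = 0 := le_antisymm (Finset.sum_nonpos fun i _ => h2 i) (by
        rw [gen] at h3; linarith)
      have h5 := (Finset.sum_eq_zero_iff_of_nonpos fun i _ => h2 i).1 h4 i (Finset.mem_univ i)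
      have h6 : h (v - Pi.single i 1) = h v := by
        rcases mul_eq_zero.1 h5 with h | h
        · exact absurd h (by exact_mod_cast hi.ne')
        · linarith
      have h7 := tot_sub_single hi
      exact ih (v - Pi.single i 1) (by omega) (by omega) fun w hw => h6 ▸ hmax w hw
  obtain ⟨v, hv, hmax⟩ := exists_max_tot_le h N
  exact key _ v rfl hv hmax w hw

/-- Extension by zero of a function on `{v | tot v ≤ N}`, also set to zero at the origin. -/
def extendZero (N : ℕ) : ({v : ι → ℕ // tot v ≤ N} → ℝ) →ₗ[ℝ] ((ι → ℕ) → ℝ) where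
  toFun k v := if hv : tot v ≤ N then (if v = 0 then 0 else k ⟨v, hv⟩) else 0
  map_add' k l := by
    funext v
    by_cases hv : tot v ≤ N <;> by_cases h0 : v = 0 <;> simp [hv, h0]
  map_smul' c k := by
    funext v
    by_cases hv : tot v ≤ N <;> by_cases h0 : v = 0 <;> simp [hv, h0]

/-- Fredholm alternative in finite dimension. As `h 0` is normalised to 0, the coordinate at the
origin is free to carry the unknown constant `c`, which makes the system square; injectivity is the
maximum principle. -/
theorem exists_truncated_solution (hp : ∀ i, 0 ≤ p i) (hβ : ∀ k, 0 ≤ β k) (hN : β N = 0)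
    (F : (ι → ℕ) → ℝ) :
    ∃ (h : (ι → ℕ) → ℝ) (c : ℝ), h 0 = 0 ∧ ∀ v, tot v ≤ N → gen p β h v = F v - c := by
  have h00 : tot (0 : ι → ℕ) ≤ N := by rw [tot_zero]; exact Nat.zero_le _
  have : Finite {v : ι → ℕ // tot v ≤ N} := (finite_tot_le N).to_subtype
  let Θ : ({v : ι → ℕ // tot v ≤ N} → ℝ) →ₗ[ℝ] ({v : ι → ℕ // tot v ≤ N} → ℝ) :=
    { toFun := fun k x => gen p β (extendZero N k) x.1 + k ⟨0, h00⟩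
      map_add' := fun k l => by
        funext x
        simp only [map_add, gen_add, Pi.add_apply]; ring
      map_smul' := fun c k => by
        funext x
        simp only [map_smul, gen_smul, Pi.smul_apply, RingHom.id_apply, smul_eq_mul]; ring }
  have hz : ∀ k, extendZero (ι := ι) N k 0 = 0 := fun k => by simp [extendZero]
  have hinj : Function.Injective Θ := by
    rw [← LinearMap.ker_eq_bot, LinearMap.ker_eq_bot']
    intro k hk
    have hk' : ∀ v, tot v ≤ N → gen p β (extendZero N k) v + k ⟨0, h00⟩ = 0 :=
      fun v hv => congrFun hk ⟨v, hv⟩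
    -- The generator is nonpositive at a maximum and nonnegative at a minimum, so the constant has
    -- both signs.
    have hc : k ⟨0, h00⟩ = 0 := by
      obtain ⟨v, hv, hmax⟩ := exists_max_tot_le (extendZero N k) N
      obtain ⟨w, hw, hmin⟩ := exists_max_tot_le (fun v => -extendZero N k v) N
      have h1 := gen_nonpos_of_max hp hβ hN hv hmax
      have h2 := gen_nonpos_of_max hp hβ hN hw hmin
      rw [gen_neg] at h2
      have h3 := hk' v hv
      have h4 := hk' w hw
      linarith
    have h1 : ∀ v, tot v ≤ N → gen p β (extendZero N k) v = 0 := fun v hv => by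
      have := hk' v hv
      rwa [hc, add_zero] at this
    have h2 : ∀ v, tot v ≤ N → gen p β (fun w => -extendZero N k w) v = 0 := fun v hv => by
      rw [gen_neg, h1 v hv, neg_zero]
    funext ⟨v, hv⟩
    have h3 := le_apply_zero_of_gen_eq_zero hp hβ hN h1 hv
    have h4 := le_apply_zero_of_gen_eq_zero hp hβ hN h2 hv
    rw [hz] at h3
    simp only [hz] at h4
    by_cases h0 : v = 0
    · subst h0; simpa using hc
    · have : extendZero N k v = k ⟨v, hv⟩ := by simp [extendZero, hv, h0]
      rw [← this, Pi.zero_apply]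
      linarith
  obtain ⟨k, hk⟩ := (LinearMap.injective_iff_surjective.1 hinj) fun x => F x.1
  refine ⟨extendZero N k, k ⟨0, h00⟩, hz k, fun v hv => ?_⟩
  have : gen p β (extendZero N k) v + k ⟨0, h00⟩ = F v := congrFun hk ⟨v, hv⟩
  linarith

/-- At a maximum of `h` the equation gives `F v ≤ c`, and at a minimum `c ≤ F w`. -/
theorem truncated_const_mem (hp : ∀ i, 0 ≤ p i) (hβ : ∀ k, 0 ≤ β k) (hN : β N = 0)
    {F h : (ι → ℕ) → ℝ} {c : ℝ} (hF0 : ∀ v, 0 ≤ F v) (hF1 : ∀ v, F v ≤ 1)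
    (hh : ∀ v, tot v ≤ N → gen p β h v = F v - c) : 0 ≤ c ∧ c ≤ 1 := by
  obtain ⟨v, hv, hmax⟩ := exists_max_tot_le h N
  obtain ⟨w, hw, hmin⟩ := exists_max_tot_le (fun v => -h v) N
  have h1 := gen_nonpos_of_max hp hβ hN hv hmax
  have h2 := gen_nonpos_of_max hp hβ hN hw hmin
  rw [gen_neg, hh w hw] at h2
  rw [hh v hv] at h1
  have h3 := hF0 v
  have h4 := hF1 w
  constructor <;> linarith

end Truncated

variable {ι : Type*} [Fintype ι] [DecidableEq ι]

/-! ### Maximum principles for the truncated Stein equation -/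

section MaximumPrinciple

variable {p : ι → ℝ} {β : ℕ → ℝ} {N : ℕ}

theorem birth_le (hp : ∀ i, 0 ≤ p i) (hp1 : ∑ i, p i = 1) {h : (ι → ℕ) → ℝ} {v : ι → ℕ} {d : ℝ}
    (hd : ∀ i, h (v + Pi.single i 1) - h v ≤ d) : birth p h v ≤ d := by
  calc birth p h v ≤ ∑ i, p i * d :=
        Finset.sum_le_sum fun i _ => mul_le_mul_of_nonneg_left (hd i) (hp i)
    _ = d := by rw [← Finset.sum_mul, hp1, one_mul]

theorem death_le {h : (ι → ℕ) → ℝ} {v : ι → ℕ} {d : ℝ}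
    (hd : ∀ i, 0 < v i → h (v - Pi.single i 1) - h v ≤ d) : death h v ≤ tot v * d := by
  rw [tot_cast, Finset.sum_mul]
  refine Finset.sum_le_sum fun i _ => ?_
  rcases Nat.eq_zero_or_pos (v i) with h0 | h0
  · simp [h0]
  · exact mul_le_mul_of_nonneg_left (hd i h0) (Nat.cast_nonneg _)

/-- The other points move as before, with the birth rate taken one level up, while the death of the
exchanged point ends the discrepancy: the difference is killed at unit rate. -/
theorem gen_swap (p : ι → ℝ) (β : ℕ → ℝ) (h : (ι → ℕ) → ℝ) (v : ι → ℕ) (i j : ι) :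
    gen p β h (v + Pi.single i 1) - gen p β h (v + Pi.single j 1) =
      β (tot v + 1) * birth p (fun w => h (w + Pi.single i 1) - h (w + Pi.single j 1)) v +
      death (fun w => h (w + Pi.single i 1) - h (w + Pi.single j 1)) v -
      (h (v + Pi.single i 1) - h (v + Pi.single j 1)) := by
  rw [gen, gen, death_add_single, death_add_single, tot_add_single, tot_add_single]
  have h1 : birth p (fun w => h (w + Pi.single i 1) - h (w + Pi.single j 1)) v =
      birth p h (v + Pi.single i 1) - birth p h (v + Pi.single j 1) := by
    rw [birth, birth, birth, ← Finset.sum_sub_distrib]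
    refine Finset.sum_congr rfl fun l _ => ?_
    rw [add_right_comm v (Pi.single l 1) (Pi.single i 1),
      add_right_comm v (Pi.single l 1) (Pi.single j 1)]
    ring
  have h2 : death (fun w => h (w + Pi.single i 1) - h (w + Pi.single j 1)) v =
      ∑ l, (v l : ℝ) * (h (v - Pi.single l 1 + Pi.single i 1) - h (v + Pi.single i 1)) -
      ∑ l, (v l : ℝ) * (h (v - Pi.single l 1 + Pi.single j 1) - h (v + Pi.single j 1)) := by
    rw [death, ← Finset.sum_sub_distrib]
    exact Finset.sum_congr rfl fun l _ => by ring
  rw [h1, h2]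
  ring

/-- A supersolution of the equation for the effect of moving one point dominates this effect. -/
theorem swap_le (hp : ∀ i, 0 ≤ p i) (hp1 : ∑ i, p i = 1) (hβ : ∀ k, 0 ≤ β k) (hN : β N = 0)
    {F h : (ι → ℕ) → ℝ} {c : ℝ} (hh : ∀ v, tot v ≤ N → gen p β h v = F v - c)
    (hF : ∀ v i j, |F (v + Pi.single i 1) - F (v + Pi.single j 1)| ≤ 1 / ((tot v : ℝ) + 1))
    {φ : ℕ → ℝ}
    (hφ : ∀ n < N, 1 / ((n : ℝ) + 1) + β (n + 1) * (φ (n + 1) - φ n) + n * (φ (n - 1) - φ n) ≤ φ n)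
    {v : ι → ℕ} (hv : tot v < N) (i j : ι) :
    h (v + Pi.single i 1) - h (v + Pi.single j 1) ≤ φ (tot v) := by
  obtain ⟨w, hw, hmax⟩ := exists_max_tot_le
    (fun v : ι → ℕ => h (v + Pi.single i 1) - h (v + Pi.single j 1) - φ (tot v)) (N - 1)
  have hw' : tot w < N := by omega
  suffices h (w + Pi.single i 1) - h (w + Pi.single j 1) - φ (tot w) ≤ 0 by
    have := hmax v (by omega)
    linarith
  have h1 := gen_swap p β h w i j
  rw [hh _ (by rw [tot_add_single]; omega), hh _ (by rw [tot_add_single]; omega)] at h1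
  have h2 : β (tot w + 1) * birth p (fun w => h (w + Pi.single i 1) - h (w + Pi.single j 1)) w ≤
      β (tot w + 1) * (φ (tot w + 1) - φ (tot w)) := by
    -- At the top level the maximum says nothing about a birth, but its rate is `β N = 0`.
    rcases (Nat.succ_le_of_lt hw').eq_or_lt with h0 | h0
    · rw [← Nat.succ_eq_add_one, h0, hN]; simp
    · refine mul_le_mul_of_nonneg_left (birth_le hp hp1 fun l => ?_) (hβ _)
      have := hmax (w + Pi.single l 1) (by rw [tot_add_single]; omega)
      rw [tot_add_single] at this
      linarith
  have h3 : death (fun w => h (w + Pi.single i 1) - h (w + Pi.single j 1)) w ≤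
      tot w * (φ (tot w - 1) - φ (tot w)) := by
    refine death_le fun l hl => ?_
    have h4 := tot_sub_single hl
    have := hmax (w - Pi.single l 1) (by omega)
    rw [show tot (w - Pi.single l 1) = tot w - 1 by omega] at this
    linarith
  have h4 := (abs_le.1 (hF w i j)).1
  have h5 := hφ _ hw'
  linarith

/-- Deficit of `η` with respect to `ξ`: the number of points of `ξ` that are missing in `η`. -/
def deficit (ξ η : ι → ℕ) : ℕ := tot (ξ - η)

theorem deficit_self (ξ : ι → ℕ) : deficit ξ ξ = 0 := by simp [deficit, tot_zero]

theorem deficit_add_single_le (ξ η : ι → ℕ) (i : ι) :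
    deficit ξ (η + Pi.single i 1) ≤ deficit ξ η :=
  Finset.sum_le_sum fun j _ => by simp only [Pi.sub_apply, Pi.add_apply]; omega

theorem deficit_sub_single_le (ξ η : ι → ℕ) (i : ι) :
    deficit ξ (η - Pi.single i 1) ≤ deficit ξ η + 1 := by
  have h1 : tot (ξ - (η - Pi.single i 1)) ≤ tot (ξ - η + Pi.single i 1) :=
    Finset.sum_le_sum fun j _ => by simp only [Pi.sub_apply, Pi.add_apply]; omega
  rwa [tot_add_single] at h1

theorem deficit_sub_single_of_lt {ξ η : ι → ℕ} {i : ι} (h : ξ i < η i) :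
    deficit ξ (η - Pi.single i 1) ≤ deficit ξ η := by
  refine Finset.sum_le_sum fun j _ => ?_
  by_cases hj : j = i
  · subst hj; simp only [Pi.sub_apply, Pi.single_eq_same]; omega
  · simp [hj]

/-- In a cell with surplus points a death does not raise the deficit; in any other cell there are at
most `ξ i` points that can die. -/
theorem death_deficit_le (ξ η : ι → ℕ) : death (fun w => (deficit ξ w : ℝ)) η ≤ tot ξ := by
  rw [tot_cast]
  refine Finset.sum_le_sum fun i _ => ?_
  rcases lt_or_ge (ξ i) (η i) with h | h
  · have : (deficit ξ (η - Pi.single i 1) : ℝ) ≤ deficit ξ η := by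
      exact_mod_cast deficit_sub_single_of_lt h
    have h0 : (0 : ℝ) ≤ ξ i := Nat.cast_nonneg _
    have h1 : (0 : ℝ) ≤ η i := Nat.cast_nonneg _
    nlinarith
  · have : (deficit ξ (η - Pi.single i 1) : ℝ) ≤ deficit ξ η + 1 := by
      exact_mod_cast deficit_sub_single_le ξ η i
    have h2 : (η i : ℝ) ≤ ξ i := by exact_mod_cast h
    have h1 : (0 : ℝ) ≤ η i := Nat.cast_nonneg _
    nlinarith

/-- Moving the points of `η` to those of `ξ` one at a time. -/
theorem swap_chain_le {h : (ι → ℕ) → ℝ} {Ψ : ℝ} {n : ℕ}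
    (hΨ : ∀ v, tot v = n → ∀ i j, h (v + Pi.single i 1) - h (v + Pi.single j 1) ≤ Ψ)
    (ξ z : ι → ℕ) (hn : tot ξ + tot z = n + 1) (η : ι → ℕ) (hη : tot η = tot ξ) :
    h (η + z) - h (ξ + z) ≤ deficit ξ η * Ψ := by
  obtain ⟨s, hs⟩ : ∃ s, deficit ξ η = s := ⟨_, rfl⟩
  induction s generalizing η with
  | zero =>
    have h1 : ∀ i, ξ i ≤ η i := fun i => by
      have := congrFun (tot_eq_zero.1 hs) i
      simpa [Nat.sub_eq_zero_iff_le] using this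
    have h2 : ξ = η := by
      have := (Finset.sum_eq_sum_iff_of_le fun i _ => h1 i).1 hη.symm
      exact funext fun i => this i (Finset.mem_univ i)
    simp [h2, deficit_self]
  | succ s ih =>
    obtain ⟨i, hi⟩ : ∃ i, η i < ξ i := by
      obtain ⟨i, hi⟩ := exists_pos_of_tot_pos (v := ξ - η) (by rw [deficit] at hs; omega)
      exact ⟨i, by simpa using hi⟩
    obtain ⟨j, hj⟩ : ∃ j, ξ j < η j := by
      by_contra hc
      push Not at hc
      have : tot η < tot ξ := Finset.sum_lt_sum (fun j _ => hc j) ⟨i, Finset.mem_univ i, hi⟩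
      omega
    have hij : i ≠ j := by rintro rfl; omega
    have hjp : 0 < η j := by omega
    -- A point moved from a surplus cell `j` to a lacking cell `i` repairs exactly one unit of the
    -- deficit.
    have h1 : deficit ξ (η - Pi.single j 1 + Pi.single i 1) + 1 = deficit ξ η := by
      rw [deficit, deficit, ← tot_add_single _ i]
      congr 1
      funext l
      simp only [Pi.add_apply, Pi.sub_apply, Pi.single_apply]
      split_ifs with h1 h2 h2
      · exact absurd (h2.symm.trans h1) hij
      · subst h1; omega
      · subst h2; omega
      · omega
    have h2 := tot_sub_single hjp
    have h3 := ih (η - Pi.single j 1 + Pi.single i 1) (by rw [tot_add_single]; omega) (by omega)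
    have h4 := hΨ (η - Pi.single j 1 + z) (by rw [tot_add]; omega) j i
    rw [add_right_comm, sub_single_add hjp, add_right_comm] at h4
    have h5 : (deficit ξ η : ℝ) = deficit ξ (η - Pi.single j 1 + Pi.single i 1) + 1 := by
      exact_mod_cast h1.symm
    rw [h5]
    linarith

/-- Barrier for reaching a larger total. -/
theorem le_mean_add_of_drift_pos (hp : ∀ i, 0 ≤ p i) (hp1 : ∑ i, p i = 1) (hβ : ∀ k, 0 ≤ β k)
    {h : (ι → ℕ) → ℝ} {n : ℕ} {c δ Ψ C : ℝ} (hc : 0 ≤ c) (hδ : 0 < δ)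
    (hΨ0 : 0 ≤ Ψ) (hΨ : ∀ v, tot v = n → ∀ i j, h (v + Pi.single i 1) - h (v + Pi.single j 1) ≤ Ψ)
    (hh : ∀ v, tot v ≤ n → -c ≤ gen p β h v) (hdrift : ∀ k ≤ n, δ ≤ β k - k)
    (hC : c + n * Ψ < C * δ) {ξ : ι → ℕ} (hξ : tot ξ = n) :
    h ξ ≤ ∑ i, p i * h (ξ + Pi.single i 1) + C := by
  have hC0 : 0 < C := by
    by_contra hcon
    have h1 : C * δ ≤ 0 := mul_nonpos_of_nonpos_of_nonneg (not_lt.1 hcon) hδ.le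
    have h2 : 0 ≤ n * Ψ := mul_nonneg (Nat.cast_nonneg _) hΨ0
    linarith
  set C0 := ∑ i, p i * h (ξ + Pi.single i 1) with hC0def
  -- The barrier charges `C` per level still to climb and `Ψ` per point of `ξ` lost on the way. The
  -- first part drifts down at rate at least `C * δ`, the second grows at rate at most `n * Ψ`.
  let W : (ι → ℕ) → ℝ := fun η => C0 + C * (n + 1 - tot η) + Ψ * deficit ξ η
  obtain ⟨w, hw, hmax⟩ := exists_max_tot_le (fun v : ι → ℕ => h v - W v) n
  suffices h w - W w ≤ 0 by
    have h1 := hmax ξ hξ.le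
    have h2 : W ξ = C0 + C := by simp [W, hξ, deficit_self]
    linarith
  by_contra hcon
  push Not at hcon
  have hW : ∀ v, W v = C0 + C * (n + 1 - tot v) + Ψ * deficit ξ v := fun v => rfl
  have hdeath : death h w ≤ tot w * C + n * Ψ := by
    have h1 : death h w ≤ death (fun v => Ψ * deficit ξ v) w + tot w * C := by
      rw [death, death, tot_cast, Finset.sum_mul, ← Finset.sum_add_distrib]
      refine Finset.sum_le_sum fun i _ => ?_
      rcases Nat.eq_zero_or_pos (w i) with h0 | h0
      · simp [h0]
      · rw [← mul_add]
        refine mul_le_mul_of_nonneg_left ?_ (Nat.cast_nonneg _)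
        have h4 := tot_sub_single h0
        have h5 := hmax (w - Pi.single i 1) (by omega)
        have h6 : (tot w : ℝ) = tot (w - Pi.single i 1) + 1 := by exact_mod_cast h4.symm
        rw [hW, hW, h6] at h5
        linarith
    have h2 : death (fun v => Ψ * deficit ξ v) w = Ψ * death (fun v => (deficit ξ v : ℝ)) w := by
      rw [death, death, Finset.mul_sum]
      exact Finset.sum_congr rfl fun i _ => by ring
    have h3 := mul_le_mul_of_nonneg_left (death_deficit_le ξ w) hΨ0
    rw [hξ] at h3
    linarith
  have hbirth : birth p h w ≤ -C := by
    rcases hw.eq_or_lt with h0 | h0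
    -- At level `n` a birth leaves the region of the maximum; the vectors reached are compared
    -- directly with those reached from `ξ`, at a cost of `Ψ` per missing point.
    · have h1 : ∀ i, h (w + Pi.single i 1) ≤ h (ξ + Pi.single i 1) + Ψ * deficit ξ w := fun i => by
        have := swap_chain_le hΨ ξ (Pi.single i 1) (by rw [tot_single, hξ]) w (by omega)
        linarith
      have h2 : birth p h w = ∑ i, p i * h (w + Pi.single i 1) - h w := by
        simp only [birth, mul_sub, Finset.sum_sub_distrib]
        rw [← Finset.sum_mul, hp1, one_mul]
      have h3 : ∑ i, p i * h (w + Pi.single i 1) ≤ C0 + Ψ * deficit ξ w := by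
        calc ∑ i, p i * h (w + Pi.single i 1)
            ≤ ∑ i, p i * (h (ξ + Pi.single i 1) + Ψ * deficit ξ w) :=
              Finset.sum_le_sum fun i _ => mul_le_mul_of_nonneg_left (h1 i) (hp i)
          _ = C0 + Ψ * deficit ξ w := by
              simp only [mul_add, Finset.sum_add_distrib]
              rw [← Finset.sum_mul, hp1, one_mul]
      rw [hW, h0] at hcon
      rw [h2]
      linarith
    · refine birth_le hp hp1 fun i => ?_
      have h1 := hmax (w + Pi.single i 1) (by rw [tot_add_single]; omega)
      have h2 : (deficit ξ (w + Pi.single i 1) : ℝ) ≤ deficit ξ w := by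
        exact_mod_cast deficit_add_single_le ξ w i
      have h3 := mul_le_mul_of_nonneg_left h2 hΨ0
      rw [hW, hW, tot_add_single] at h1
      push_cast at h1
      linarith
  have h1 := hh w hw
  rw [gen] at h1
  have h2 := mul_le_mul_of_nonneg_left hbirth (hβ (tot w))
  have h3 := mul_le_mul_of_nonneg_left (hdrift _ hw) hC0.le
  linarith

/-- Barrier for reaching a smaller total. -/
theorem le_add_of_drift_neg (hp : ∀ i, 0 ≤ p i) (hp1 : ∑ i, p i = 1) (hβ : ∀ k, 0 ≤ β k)
    (hN : β N = 0) {h : (ι → ℕ) → ℝ} {m : ℕ} {c δ Ψ C : ℝ} (hc : 0 ≤ c) (hδ : 0 < δ)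
    (hΨ0 : 0 ≤ Ψ)
    (hΨ : ∀ v, tot v + 1 = m → ∀ i j, h (v + Pi.single i 1) - h (v + Pi.single j 1) ≤ Ψ)
    (hh : ∀ v, tot v ≤ N → -c ≤ gen p β h v) (hdrift : ∀ k, m < k → k ≤ N → δ ≤ k - β k)
    (hC : c + m * Ψ < C * δ) {ζ : ι → ℕ} (hζ : tot ζ = m) (hm : m < N) (l : ι) :
    h (ζ + Pi.single l 1) ≤ h ζ + C := by
  have hC0 : 0 < C := by
    by_contra hcon
    have h1 : C * δ ≤ 0 := mul_nonpos_of_nonpos_of_nonneg (not_lt.1 hcon) hδ.le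
    have h2 : 0 ≤ m * Ψ := mul_nonneg (Nat.cast_nonneg _) hΨ0
    linarith
  -- The mirror image of the upward barrier: `C` per level still to descend to level `m`, and `Ψ`
  -- per point of `ζ` lost.
  let W : (ι → ℕ) → ℝ := fun η => h ζ + C * (tot η - m) + Ψ * deficit ζ η
  have hW : ∀ v, W v = h ζ + C * (tot v - m) + Ψ * deficit ζ v := fun v => rfl
  have hlevel : ∀ v, tot v = m → h v ≤ W v := by
    intro v hv
    rcases Nat.eq_zero_or_pos m with h0 | h0
    · have h1 : v = ζ := by
        rw [tot_eq_zero.1 (hv.trans h0), tot_eq_zero.1 (hζ.trans h0)]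
      rw [hW, h1, deficit_self, hζ]; simp
    · obtain ⟨m', rfl⟩ := Nat.exists_eq_succ_of_ne_zero h0.ne'
      have := swap_chain_le (n := m') (fun v hv => hΨ v (by omega)) ζ 0
        (by rw [hζ, tot_zero]) v (by omega)
      rw [add_zero, add_zero] at this
      rw [hW, hv]
      linarith
  obtain ⟨w, ⟨hwm, hwN⟩, hmax⟩ := Set.exists_max_image {v : ι → ℕ | m < tot v ∧ tot v ≤ N}
    (fun v => h v - W v) ((finite_tot_le N).subset fun v hv => hv.2)
    ⟨ζ + Pi.single l 1, by rw [Set.mem_ofPred_eq, tot_add_single]; omega⟩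
  suffices h w - W w ≤ 0 by
    have h1 := hmax (ζ + Pi.single l 1) (by rw [Set.mem_ofPred_eq, tot_add_single]; omega)
    have h3 : (deficit ζ (ζ + Pi.single l 1) : ℝ) ≤ 0 := by
      exact_mod_cast (deficit_add_single_le ζ ζ l).trans (deficit_self ζ).le
    have h4 := mul_le_mul_of_nonneg_left h3 hΨ0
    have h2 : W (ζ + Pi.single l 1) ≤ h ζ + C := by
      rw [hW, tot_add_single, hζ]
      push_cast
      linarith
    linarith
  by_contra hcon
  push Not at hcon
  have hdeath : death h w ≤ -(tot w * C) + m * Ψ := by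
    have h1 : death h w ≤ death (fun v => Ψ * deficit ζ v) w + tot w * (-C) := by
      rw [death, death, tot_cast, Finset.sum_mul, ← Finset.sum_add_distrib]
      refine Finset.sum_le_sum fun i _ => ?_
      rcases Nat.eq_zero_or_pos (w i) with h0 | h0
      · simp [h0]
      · rw [← mul_add]
        refine mul_le_mul_of_nonneg_left ?_ (Nat.cast_nonneg _)
        have h4 := tot_sub_single h0
        -- A death may leave the region by reaching level `m`; there the barrier already dominates
        -- `h`, whereas the maximum was assumed positive.
        have h5 : h (w - Pi.single i 1) - W (w - Pi.single i 1) ≤ h w - W w := by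
          by_cases h7 : tot (w - Pi.single i 1) = m
          · have := hlevel _ h7
            linarith
          · exact hmax _ ⟨by omega, by omega⟩
        have h6 : (tot w : ℝ) = tot (w - Pi.single i 1) + 1 := by exact_mod_cast h4.symm
        rw [hW, hW, h6] at h5
        linarith
    have h2 : death (fun v => Ψ * deficit ζ v) w = Ψ * death (fun v => (deficit ζ v : ℝ)) w := by
      rw [death, death, Finset.mul_sum]
      exact Finset.sum_congr rfl fun i _ => by ring
    have h3 := mul_le_mul_of_nonneg_left (death_deficit_le ζ w) hΨ0
    rw [hζ] at h3
    linarith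
  have hbirth : β (tot w) * birth p h w ≤ β (tot w) * C := by
    rcases hwN.eq_or_lt with h0 | h0
    · rw [h0, hN]; simp
    · refine mul_le_mul_of_nonneg_left (birth_le hp hp1 fun i => ?_) (hβ _)
      have h1 := hmax (w + Pi.single i 1) (by rw [Set.mem_ofPred_eq, tot_add_single]; omega)
      have h2 : (deficit ζ (w + Pi.single i 1) : ℝ) ≤ deficit ζ w := by
        exact_mod_cast deficit_add_single_le ζ w i
      have h3 := mul_le_mul_of_nonneg_left h2 hΨ0
      rw [hW, hW, tot_add_single] at h1
      push_cast at h1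
      linarith
  have h1 := hh w hwN
  rw [gen] at h1
  have h3 := mul_le_mul_of_nonneg_left (hdrift _ hwm hwN) hC0.le
  linarith

end MaximumPrinciple

variable {ι : Type*} [Fintype ι] [DecidableEq ι]

/-! ### Estimates for the truncated Stein equation -/

/-- Birth rates `a + b k`, set to zero from `N` on. -/
def truncRate (a b : ℝ) (N k : ℕ) : ℝ := if k < N then a + b * k else 0

/-- Bound for the effect on the Stein solution of moving one point when there are `n` others. -/
def swapBound (a : ℝ) (n : ℕ) : ℝ := 1 / (2 * a) + (1 / 2 + 3 / (5 * a)) / (n + 1)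

theorem truncRate_nonneg {a b : ℝ} (ha : 0 < a) (hb : 0 ≤ b) (N k : ℕ) : 0 ≤ truncRate a b N k := by
  unfold truncRate; split_ifs <;> positivity

theorem truncRate_self (a b : ℝ) (N : ℕ) : truncRate a b N N = 0 := by simp [truncRate]

theorem truncRate_le {a b : ℝ} (ha : 0 < a) (hb : 0 ≤ b) (N k : ℕ) :
    truncRate a b N k ≤ a + b * k := by
  unfold truncRate; split_ifs
  · exact le_rfl
  · positivity

theorem swapBound_nonneg {a : ℝ} (ha : 0 < a) (n : ℕ) : 0 ≤ swapBound a n := by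
  unfold swapBound; positivity

theorem swapBound_succ_le {a : ℝ} (ha : 0 < a) (n : ℕ) : swapBound a (n + 1) ≤ swapBound a n := by
  unfold swapBound; push_cast; gcongr; linarith

theorem mul_swapBound_pred_le {a : ℝ} (ha : 0 < a) (n : ℕ) :
    n * swapBound a (n - 1) ≤ n / (2 * a) + (1 / 2 + 3 / (5 * a)) := by
  rcases n with _ | n
  · simp; positivity
  · simp only [Nat.add_sub_cancel, swapBound]
    push_cast
    have : (n : ℝ) + 1 ≠ 0 := by positivity
    rw [mul_add, mul_div_cancel₀ _ this]
    apply le_of_eq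
    ring

theorem mul_swapBound_le {a : ℝ} (ha : 0 < a) (n : ℕ) :
    n * swapBound a n ≤ n / (2 * a) + (1 / 2 + 3 / (5 * a)) := by
  refine le_trans ?_ (mul_swapBound_pred_le ha n)
  rcases n with _ | n
  · simp
  · exact mul_le_mul_of_nonneg_left (swapBound_succ_le ha n) (Nat.cast_nonneg _)

/-- With `A` the coefficient of `1 / (n + 1)`, deaths contribute at most `A / (n + 1)`, exactly the
decaying part of the right side. What is left for `n ≥ 1` is `1 / (n + 1) - a * A / ((n + 1) * (n +
2)) ≤ 1 / (2 * a)`, and `a * A = a / 2 + 3 / 5` makes it a perfect square plus a positive remainder.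
-/
theorem swapBound_supersolution {a b : ℝ} (ha : 0 < a) (hb : 0 ≤ b) {N : ℕ} (hN : 2 * a ≤ N)
    {n : ℕ} (hn : n < N) :
    1 / ((n : ℝ) + 1) + truncRate a b N (n + 1) * (swapBound a (n + 1) - swapBound a n) +
      n * (swapBound a (n - 1) - swapBound a n) ≤ swapBound a n := by
  set A : ℝ := 1 / 2 + 3 / (5 * a) with hA
  have hA0 : 0 < A := by positivity
  have haA : a * A = a / 2 + 3 / 5 := by rw [hA]; field_simp
  have hn1 : (0 : ℝ) < n + 1 := by positivity
  have hn2 : (0 : ℝ) < n + 2 := by positivity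
  have hup : swapBound a (n + 1) - swapBound a n = -(A / ((n + 1) * (n + 2))) := by
    simp only [swapBound, ← hA]
    push_cast
    field_simp
    ring
  have hdown : n * (swapBound a (n - 1) - swapBound a n) ≤ A / (n + 1) := by
    rcases n with _ | n
    · simp; positivity
    · simp only [swapBound, ← hA, Nat.add_sub_cancel]
      push_cast
      apply le_of_eq
      have : (n : ℝ) + 1 ≠ 0 := by positivity
      have : (n : ℝ) + 1 + 1 ≠ 0 := by positivity
      field_simp
      ring
  rcases lt_or_ge (n + 1) N with h | h
  · have hrate : a ≤ truncRate a b N (n + 1) := by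
      have : 0 ≤ b * ((n + 1 : ℕ) : ℝ) := by positivity
      simp only [truncRate, h, if_true]; linarith
    have h1 : truncRate a b N (n + 1) * (swapBound a (n + 1) - swapBound a n) ≤
        -(a * A / ((n + 1) * (n + 2))) := by
      rw [hup, mul_neg, neg_le_neg_iff, mul_div_assoc]
      exact mul_le_mul_of_nonneg_right hrate (by positivity)
    rcases Nat.eq_zero_or_pos n with h0 | h0
    · subst h0
      simp only [Nat.cast_zero, zero_add, one_mul, zero_mul, add_zero, div_one] at h1 ⊢
      have h2 : swapBound a 0 = 1 / (2 * a) + A := by simp [swapBound, hA]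
      refine (add_le_add le_rfl h1).trans ?_
      rw [h2, haA, hA]
      -- At level zero there is no death term, so all of `swapBound a 0` is available and the
      -- inequality is a separate one.
      have h3 : 1 / 5 ≤ a / 4 + 11 / 10 / a := by
        rw [← sub_nonneg]
        have : a / 4 + 11 / 10 / a - 1 / 5 = ((a - 2 / 5) ^ 2 + 4.24) / (4 * a) := by
          field_simp; ring
        rw [this]; positivity
      have h4 : 1 / (2 * a) + (1 / 2 + 3 / (5 * a)) = 1 / 2 + 11 / 10 / a := by field_simp; ring
      rw [h4]
      linarith
    · have h2 : swapBound a n = 1 / (2 * a) + A / (n + 1) := rfl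
      have h3 : 1 / ((n : ℝ) + 1) + -(a * A / ((n + 1) * (n + 2))) ≤ 1 / (2 * a) := by
        rw [haA, ← sub_nonneg]
        have h4 : 1 / (2 * a) - (1 / ((n : ℝ) + 1) + -((a / 2 + 3 / 5) / ((n + 1) * (n + 2)))) =
            ((a - (n + 2) + 3 / 5) ^ 2 + (n + 2) / 5 - 9 / 25) / (2 * a * ((n + 1) * (n + 2))) := by
          field_simp; ring
        rw [h4]
        have h5 : (1 : ℝ) ≤ n := by exact_mod_cast h0
        refine div_nonneg ?_ (by positivity)
        have := sq_nonneg (a - (n + 2) + 3 / 5)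
        linarith
      linarith
  -- At the top level there are no births to help; the hypothesis `2 * a ≤ N` takes their place.
  · have h0 : truncRate a b N (n + 1) = 0 := by simp [truncRate, h]
    have hnN : (n : ℝ) + 1 = N := by exact_mod_cast (by omega : n + 1 = N)
    rw [h0, zero_mul, add_zero]
    have h2 : swapBound a n = 1 / (2 * a) + A / (n + 1) := rfl
    have h3 : 1 / ((n : ℝ) + 1) ≤ 1 / (2 * a) :=
      one_div_le_one_div_of_le (by positivity) (hnN ▸ hN)
    linarith

/-- The barriers have drift larger by `1 - b` than the coefficient met in the Stein equation; this
passes to the smaller coefficient whatever the sign of `q`. -/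
theorem mul_le_of_mul_le_of_le {s d q K : ℝ} (hs : 0 ≤ s) (hsd : s ≤ d) (hK : 0 ≤ K)
    (h : d * q ≤ K) : s * q ≤ K := by
  rcases le_or_gt q 0 with h0 | h0
  · exact (mul_nonpos_of_nonneg_of_nonpos hs h0).trans hK
  · exact (mul_le_mul_of_nonneg_right hsd h0.le).trans h

/-- The hypothesis is `5 / a + 2 / m < 2` cleared of denominators. It forces `a > 5 / 2`, and if `a
< 13 / 5` it also forces `m > 25`; either way the numerator is nonnegative. -/
theorem second_diff_arith_up {a m : ℝ} (ha : 0 < a) (hm : 0 < m) (hmul : 5 * m + 2 * a < 2 * a * m) :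
    3 * (1 / (2 * a) + (1 / 2 + 3 / (5 * a)) / m) + (3 / a + 6 / 5 / a ^ 2) ≤ 5 / a + 2 / m := by
  rw [← sub_nonneg]
  have h13 : 5 / a + 2 / m - (3 * (1 / (2 * a) + (1 / 2 + 3 / (5 * a)) / m) +
      (3 / a + 6 / 5 / a ^ 2)) =
      (m * a + a ^ 2 - 18 / 5 * a - 12 / 5 * m) / (2 * a ^ 2 * m) := by
    field_simp; ring
  rw [h13]
  refine div_nonneg ?_ (by positivity)
  have h14 : 5 / 2 < a := by
    by_contra hcon
    nlinarith
  rcases le_or_gt (13 / 5) a with h15 | h15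
  · nlinarith
  · have h16 : 25 ≤ m := by nlinarith
    nlinarith

theorem second_diff_arith_down {a m : ℝ} (ha : 0 < a) (hm : 0 < m)
    (hmul : 5 * m + 2 * a < 2 * a * m) (hma : a < m) :
    2 * (1 / (2 * a) + (1 / 2 + 3 / (5 * a)) / m) + (2 / m + 1 / a + 6 / 5 / (a * m)) ≤
      5 / a + 2 / m := by
  rw [← sub_nonneg]
  have h13 : 5 / a + 2 / m - (2 * (1 / (2 * a) + (1 / 2 + 3 / (5 * a)) / m) +
      (2 / m + 1 / a + 6 / 5 / (a * m))) = (3 * m - a - 12 / 5) / (a * m) := by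
    field_simp; ring
  rw [h13]
  refine div_nonneg ?_ (by positivity)
  have h14 : 2 < m := by nlinarith
  linarith

theorem quotient_arith_up {a n α : ℝ} (ha : 0 < a) (hn : n ≤ α) (hα : a ≤ α) :
    (1 + 2 * (n / (2 * a) + (1 / 2 + 3 / (5 * a)))) / α ≤ 3 / a + 6 / 5 / a ^ 2 := by
  have h8 : 1 + 2 * (n / (2 * a) + (1 / 2 + 3 / (5 * a))) = 2 + 6 / 5 / a + n / a := by
    field_simp; ring
  have hαpos : 0 < α := ha.trans_le hα
  rw [h8, div_le_iff₀ hαpos]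
  have h9 : n / a ≤ α / a := by gcongr
  have h10 : 2 ≤ 2 / a * α := by
    rw [div_mul_eq_mul_div, le_div_iff₀ ha]
    linarith
  have h11 : 6 / 5 / a ≤ 6 / 5 / a ^ 2 * α := by
    have : 6 / 5 / a = 6 / 5 / a ^ 2 * a := by field_simp
    rw [this]
    exact mul_le_mul_of_nonneg_left hα (by positivity)
  have : (3 / a + 6 / 5 / a ^ 2) * α = α / a + 2 / a * α + 6 / 5 / a ^ 2 * α := by ring
  linarith

theorem quotient_arith_down {a n m : ℝ} (ha : 0 < a) (hm : 0 < m) (hn : n ≤ m) :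
    (1 + (m / (2 * a) + (1 / 2 + 3 / (5 * a))) + (n / (2 * a) + (1 / 2 + 3 / (5 * a)))) / m ≤
      2 / m + 1 / a + 6 / 5 / (a * m) := by
  have h8 : 2 / m + 1 / a + 6 / 5 / (a * m) = (2 + m / a + 6 / 5 / a) / m := by field_simp
  rw [h8]
  refine div_le_div_of_nonneg_right ?_ hm.le
  have h9 : n / (2 * a) ≤ m / (2 * a) := by gcongr
  have h10 : 2 + m / a + 6 / 5 / a =
      1 + (m / (2 * a) + (1 / 2 + 3 / (5 * a))) + (m / (2 * a) + (1 / 2 + 3 / (5 * a))) := by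
    field_simp; ring
  linarith

/-- `h` solves the Stein equation for `F` on `{tot v ≤ N}`, with the truncated rates. -/
structure TruncStein (p : ι → ℝ) (a b : ℝ) (N : ℕ) (F h : (ι → ℕ) → ℝ) (c : ℝ) : Prop where
  p_nonneg : ∀ i, 0 ≤ p i
  p_sum : ∑ i, p i = 1
  a_pos : 0 < a
  b_nonneg : 0 ≤ b
  b_lt : b < 1
  F_nonneg : ∀ v, 0 ≤ F v
  F_le : ∀ v, F v ≤ 1
  F_swap : ∀ v i j, |F (v + Pi.single i 1) - F (v + Pi.single j 1)| ≤ 1 / ((tot v : ℝ) + 1)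
  eq : ∀ v, tot v ≤ N → gen p (truncRate a b N) h v = F v - c
  le_size : 2 * a ≤ N

namespace TruncStein

variable {p : ι → ℝ} {a b : ℝ} {N : ℕ} {F h : (ι → ℕ) → ℝ} {c : ℝ}

theorem neg (H : TruncStein p a b N F h c) :
    TruncStein p a b N (fun v => 1 - F v) (fun v => -h v) (1 - c) where
  p_nonneg := H.p_nonneg
  p_sum := H.p_sum
  a_pos := H.a_pos
  b_nonneg := H.b_nonneg
  b_lt := H.b_lt
  F_nonneg v := by have := H.F_le v; linarith
  F_le v := by have := H.F_nonneg v; linarith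
  F_swap v i j := by
    have := H.F_swap v j i
    rwa [show 1 - F (v + Pi.single i 1) - (1 - F (v + Pi.single j 1)) =
      F (v + Pi.single j 1) - F (v + Pi.single i 1) by ring]
  eq v hv := by rw [gen_neg, H.eq v hv]; ring
  le_size := H.le_size

theorem const_mem (H : TruncStein p a b N F h c) : 0 ≤ c ∧ c ≤ 1 :=
  truncated_const_mem H.p_nonneg (truncRate_nonneg H.a_pos H.b_nonneg N) (truncRate_self a b N)
    H.F_nonneg H.F_le H.eq

theorem swap_le_swapBound (H : TruncStein p a b N F h c) {v : ι → ℕ} (hv : tot v < N) (i j : ι) :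
    h (v + Pi.single i 1) - h (v + Pi.single j 1) ≤ swapBound a (tot v) :=
  swap_le H.p_nonneg H.p_sum (truncRate_nonneg H.a_pos H.b_nonneg N) (truncRate_self a b N) H.eq
    H.F_swap (fun _ hn => swapBound_supersolution H.a_pos H.b_nonneg H.le_size hn) hv i j

theorem swap_le_one (H : TruncStein p a b N F h c) {v : ι → ℕ} (hv : tot v < N) (i j : ι) :
    h (v + Pi.single i 1) - h (v + Pi.single j 1) ≤ 1 :=
  swap_le H.p_nonneg H.p_sum (truncRate_nonneg H.a_pos H.b_nonneg N) (truncRate_self a b N) H.eq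
    H.F_swap (φ := fun _ => 1) (fun n _ => by
      simp only [sub_self, mul_zero, add_zero]
      rw [div_le_one (by positivity)]
      linarith [(Nat.cast_nonneg n : (0 : ℝ) ≤ n)]) hv i j

theorem neg_const_le (H : TruncStein p a b N F h c) {v : ι → ℕ} (hv : tot v ≤ N) :
    -c ≤ gen p (truncRate a b N) h v := by
  rw [H.eq v hv]
  linarith [H.F_nonneg v]

/-- The upward barrier applies, because births exceed deaths by at least `a - (1 - b) * tot ξ` at
every level up to that of `ξ`. -/
theorem sub_mean_le (H : TruncStein p a b N F h c) {ξ : ι → ℕ} (hξ : tot ξ < N)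
    (hδ : 0 < a - (1 - b) * tot ξ) :
    (a - (1 - b) * tot ξ) * (h ξ - ∑ i, p i * h (ξ + Pi.single i 1)) ≤
      c + (tot ξ / (2 * a) + (1 / 2 + 3 / (5 * a))) := by
  have hb := H.b_nonneg
  have hb1 := H.b_lt
  rw [mul_comm, ← le_div_iff₀ hδ]
  -- The barrier needs a strict inequality, so its slope decreases to the claimed value.
  refine le_of_forall_gt_imp_ge_of_dense fun C hC => ?_
  rw [div_lt_iff₀ hδ] at hC
  have := le_mean_add_of_drift_pos H.p_nonneg H.p_sum (truncRate_nonneg H.a_pos H.b_nonneg N)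
    H.const_mem.1 hδ (swapBound_nonneg H.a_pos (tot ξ))
    (fun v hv i j => hv ▸ H.swap_le_swapBound (hv ▸ hξ) i j)
    (fun v hv => H.neg_const_le (hv.trans hξ.le))
    (fun k hk => by
      have h1 : (k : ℝ) ≤ tot ξ := by exact_mod_cast hk
      simp only [truncRate, hk.trans_lt hξ, if_true]
      nlinarith)
    (lt_of_le_of_lt (add_le_add le_rfl (mul_swapBound_le H.a_pos _)) hC) rfl
  linarith

/-- The downward barrier applies, because above the level of `ζ` deaths exceed births by at least
`(1 - b) * (tot ζ + 1) - a`. -/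
theorem incr_le_of_drift_neg (H : TruncStein p a b N F h c) {ζ : ι → ℕ} (hζ : tot ζ < N)
    (hδ : 0 < (1 - b) * (tot ζ + 1) - a) (l : ι) :
    ((1 - b) * (tot ζ + 1) - a) * (h (ζ + Pi.single l 1) - h ζ) ≤
      c + (tot ζ / (2 * a) + (1 / 2 + 3 / (5 * a))) := by
  have hb := H.b_nonneg
  have hb1 := H.b_lt
  rw [mul_comm, ← le_div_iff₀ hδ]
  refine le_of_forall_gt_imp_ge_of_dense fun C hC => ?_
  rw [div_lt_iff₀ hδ] at hC
  have := le_add_of_drift_neg (m := tot ζ) H.p_nonneg H.p_sum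
    (truncRate_nonneg H.a_pos H.b_nonneg N) (truncRate_self a b N)
    H.const_mem.1 hδ (swapBound_nonneg H.a_pos (tot ζ - 1))
    -- For `tot ζ = 0` the index `tot ζ - 1` is a truncated 0, but the condition is then vacuous.
    (fun v hv i j => by
      have := H.swap_le_swapBound (v := v) (by omega) i j
      rwa [show tot ζ - 1 = tot v by omega])
    (fun v hv => H.neg_const_le hv)
    (fun k hk _ => by
      have h1 : (tot ζ : ℝ) + 1 ≤ k := by exact_mod_cast hk
      have h2 := truncRate_le H.a_pos H.b_nonneg N k
      nlinarith)
    (lt_of_le_of_lt (add_le_add le_rfl (mul_swapBound_pred_le H.a_pos _)) hC) rfl hζ l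
  linarith

theorem birth_eq (H : TruncStein p a b N F h c) (v : ι → ℕ) :
    birth p h v = ∑ i, p i * h (v + Pi.single i 1) - h v := by
  simp only [birth, mul_sub, Finset.sum_sub_distrib]
  rw [← Finset.sum_mul, H.p_sum, one_mul]

theorem sub_mean_le_of_swap (H : TruncStein p a b N F h c) {v : ι → ℕ} {Ψ : ℝ} {j : ι}
    (hΨ : ∀ i, h (v + Pi.single j 1) - h (v + Pi.single i 1) ≤ Ψ) :
    h (v + Pi.single j 1) - ∑ i, p i * h (v + Pi.single i 1) ≤ Ψ := by
  calc h (v + Pi.single j 1) - ∑ i, p i * h (v + Pi.single i 1)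
      = ∑ i, p i * (h (v + Pi.single j 1) - h (v + Pi.single i 1)) := by
        simp only [mul_sub, Finset.sum_sub_distrib]
        rw [← Finset.sum_mul, H.p_sum, one_mul]
    _ ≤ ∑ i, p i * Ψ := Finset.sum_le_sum fun i _ =>
        mul_le_mul_of_nonneg_left (hΨ i) (H.p_nonneg i)
    _ = Ψ := by rw [← Finset.sum_mul, H.p_sum, one_mul]

theorem mean_sub_le_of_swap (H : TruncStein p a b N F h c) {v : ι → ℕ} {Ψ : ℝ} {j : ι}
    (hΨ : ∀ i, h (v + Pi.single i 1) - h (v + Pi.single j 1) ≤ Ψ) :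
    ∑ i, p i * h (v + Pi.single i 1) - h (v + Pi.single j 1) ≤ Ψ := by
  have := H.neg.sub_mean_le_of_swap (v := v) (Ψ := Ψ) (j := j) fun i => by linarith [hΨ i]
  simp only [mul_neg, Finset.sum_neg_distrib] at this
  linarith

set_option maxHeartbeats 400000 in
/-- The second differences of the Stein solution, one-sided. -/
theorem second_diff_le (H : TruncStein p a b N F h c) {ξ : ι → ℕ} (hξ : tot ξ + 1 < N)
    (hlt : 5 / a + 2 / ((tot ξ : ℝ) + 1) < 2) (x y : ι) :
    h (ξ + Pi.single x 1 + Pi.single y 1) - h (ξ + Pi.single x 1) - h (ξ + Pi.single y 1) + h ξ ≤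
      5 / a + 2 / ((tot ξ : ℝ) + 1) := by
  have ha := H.a_pos
  have hb := H.b_nonneg
  have hb1 := H.b_lt
  obtain ⟨hc0, hc1⟩ := H.const_mem
  set ζ := ξ + Pi.single x 1 with hζdef
  have hζ : tot ζ = tot ξ + 1 := tot_add_single ξ x
  set n : ℝ := (tot ξ : ℝ) with hn
  have hn0 : 0 ≤ n := Nat.cast_nonneg _
  have hζ' : (tot ζ : ℝ) = n + 1 := by rw [hζ]; push_cast; rfl
  set m : ℝ := n + 1 with hm
  set α : ℝ := a + b * m with hα
  set A : ℝ := 1 / 2 + 3 / (5 * a) with hA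
  set g := birth p h ζ with hg
  set G := h ζ - h ξ with hG
  set S := ∑ z, (ξ z : ℝ) * (h (ξ - Pi.single z 1 + Pi.single x 1) - h ξ) with hS
  have hSle : -S ≤ n / (2 * a) + A := by
    refine le_trans ?_ (mul_swapBound_pred_le ha (tot ξ))
    rw [hS, ← Finset.sum_neg_distrib, tot_cast, Finset.sum_mul]
    refine Finset.sum_le_sum fun z _ => ?_
    rcases Nat.eq_zero_or_pos (ξ z) with h0 | h0
    · simp [h0]
    · rw [← mul_neg]
      refine mul_le_mul_of_nonneg_left ?_ (Nat.cast_nonneg _)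
      have h1 := tot_sub_single h0
      have := H.swap_le_swapBound (v := ξ - Pi.single z 1) (by omega) z x
      rw [sub_single_add h0, show tot (ξ - Pi.single z 1) = tot ξ - 1 by omega] at this
      linarith
  -- In the equation at `ζ`, deaths of points of `ξ` leave moves of one point, collected in `S`, and
  -- the death of the added point `x` gives the last `-G`.
  have hstein : α * g + S - m * G = F ζ - c := by
    have h1 := H.eq ζ (by omega)
    have h2 : truncRate a b N (tot ζ) = α := by
      simp only [truncRate, hζ' , if_pos (show tot ζ < N by omega), hα]
    have h3 : death h ζ = S - m * G := by
      have h4 : ∑ i, (ξ i : ℝ) * (h (ξ - Pi.single i 1 + Pi.single x 1) - h ζ) = S - n * G := by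
        rw [hS, hn, tot_cast, Finset.sum_mul, ← Finset.sum_sub_distrib, hG]
        exact Finset.sum_congr rfl fun i _ => by ring
      rw [hζdef, death_add_single, ← hζdef, h4, hm, hG]
      ring
    rw [gen, h2, h3] at h1
    linarith
  have hφ : swapBound a (tot ξ) = 1 / (2 * a) + A / m := by rw [swapBound, ← hn, ← hm, ← hA]
  set φ := swapBound a (tot ξ) with hφdef
  have hd1 : h (ζ + Pi.single y 1) - ∑ i, p i * h (ζ + Pi.single i 1) ≤ φ :=
    H.sub_mean_le_of_swap fun i => (H.swap_le_swapBound (by omega) y i).trans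
      (hζ ▸ swapBound_succ_le ha (tot ξ))
  have hd2 : h ζ - h (ξ + Pi.single y 1) ≤ φ := H.swap_le_swapBound (by omega) x y
  have hgeq : g = ∑ i, p i * h (ζ + Pi.single i 1) - h ζ := H.birth_eq ζ
  -- Replacing `y` by a random point above `ζ`, and by `x` above `ξ`, costs `φ` each; what remains
  -- compares two consecutive increments.
  have hmain : h (ζ + Pi.single y 1) - h ζ - h (ξ + Pi.single y 1) + h ξ ≤ 2 * φ + (g - G) := by
    rw [hG]; linarith
  have hF1 := H.F_le ζ
  have hmpos : 0 < m := by positivity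
  have hαpos : 0 < α := by positivity
  have hmul : 5 * m + 2 * a < 2 * a * m := by
    rw [div_add_div _ _ ha.ne' hmpos.ne', div_lt_iff₀ (by positivity)] at hlt
    linarith
  refine hmain.trans ?_
  -- The equation expresses `α * (g - G)` through `G`, and `m * (g - G)` through `g`. The sign of `α
  -- - m` decides which barrier bounds the leftover, and in both cases the `c` of the barrier
  -- cancels the `-c` of the equation.
  rcases le_or_gt m α with hcase | hcase
  · have hδ : a - (1 - b) * n = α - m + (1 - b) := by rw [hα, hm]; ring
    have hG1 : -(α - m) * G ≤ (α - m) * φ + c + (n / (2 * a) + A) := by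
      have h1 := H.sub_mean_le (ξ := ξ) (by omega) (by rw [← hn, hδ]; linarith)
      rw [← hn, hδ, ← hA] at h1
      have h2 : ∑ i, p i * h (ξ + Pi.single i 1) - h ζ ≤ φ :=
        H.mean_sub_le_of_swap fun i => H.swap_le_swapBound (by omega) i x
      set q := h ξ - ∑ i, p i * h (ξ + Pi.single i 1) with hq
      have h3 : -G ≤ φ + q := by rw [hG, hq]; linarith
      have h4 : (α - m) * q ≤ c + (n / (2 * a) + A) :=
        mul_le_of_mul_le_of_le (by linarith) (by linarith) (by positivity) h1
      have h5 := mul_le_mul_of_nonneg_left h3 (by linarith : 0 ≤ α - m)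
      linarith
    have hφ0 : 0 ≤ φ := swapBound_nonneg ha _
    have h6 : g - G ≤ φ + (1 + 2 * (n / (2 * a) + A)) / α := by
      rw [← sub_le_iff_le_add', le_div_iff₀ hαpos]
      have h8 := mul_nonneg hmpos.le hφ0
      linarith
    have h7 : (1 + 2 * (n / (2 * a) + A)) / α ≤ 3 / a + 6 / 5 / a ^ 2 := by
      rw [hA]
      exact quotient_arith_up ha (by linarith) (by rw [hα]; linarith [mul_nonneg hb hmpos.le])
    have h12 : 3 * φ + (3 / a + 6 / 5 / a ^ 2) ≤ 5 / a + 2 / m := by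
      rw [hφ, hA]
      exact second_diff_arith_up ha hmpos hmul
    linarith
  · have hδ : (1 - b) * (m + 1) - a = m - α + (1 - b) := by rw [hα]; ring
    have hgle : (m - α) * g ≤ c + (m / (2 * a) + A) := by
      have h1 : g ≤ (c + (m / (2 * a) + A)) / (m - α + (1 - b)) := by
        refine birth_le H.p_nonneg H.p_sum fun l => ?_
        rw [le_div_iff₀ (by linarith), mul_comm, ← hδ]
        have := H.incr_le_of_drift_neg (ζ := ζ) (by omega) (by rw [hζ', hδ]; linarith) l
        rwa [hζ', ← hA] at this
      rw [le_div_iff₀ (by linarith)] at h1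
      rw [mul_comm] at h1
      exact mul_le_of_mul_le_of_le (by linarith) (by linarith) (by positivity) h1
    have h6 : g - G ≤ (1 + (m / (2 * a) + A) + (n / (2 * a) + A)) / m := by
      rw [le_div_iff₀ hmpos]
      linarith
    have h7 : (1 + (m / (2 * a) + A) + (n / (2 * a) + A)) / m ≤ 2 / m + 1 / a + 6 / 5 / (a * m) := by
      rw [hA]
      exact quotient_arith_down ha hmpos (by linarith)
    have hma : a < m := by
      have : 0 ≤ b * m := by positivity
      linarith
    have h12 : 2 * φ + (2 / m + 1 / a + 6 / 5 / (a * m)) ≤ 5 / a + 2 / m := by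
      rw [hφ, hA]
      exact second_diff_arith_down ha hmpos hmul hma
    linarith

theorem abs_second_diff_le (H : TruncStein p a b N F h c) {ξ : ι → ℕ} (hξ : tot ξ + 1 < N)
    (hlt : 5 / a + 2 / ((tot ξ : ℝ) + 1) < 2) (x y : ι) :
    |h (ξ + Pi.single x 1 + Pi.single y 1) - h (ξ + Pi.single x 1) - h (ξ + Pi.single y 1) + h ξ| ≤
      5 / a + 2 / ((tot ξ : ℝ) + 1) := by
  have h1 := H.second_diff_le hξ hlt x y
  have h2 := H.neg.second_diff_le hξ hlt x y
  exact abs_le.2 ⟨by linarith, by linarith⟩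

/-- Recursive bound for the increments of the Stein solution. -/
def incrBound (a : ℝ) : ℕ → ℝ
  | 0 => 1 / a + 1
  | m + 1 => (1 + (m + 1) * incrBound a m) / a + 1

theorem incrBound_nonneg (ha : 0 < a) : ∀ m, 0 ≤ incrBound a m
  | 0 => by unfold incrBound; positivity
  | m + 1 => by
    have := incrBound_nonneg ha m
    unfold incrBound; positivity

/-- The equation at `v` bounds the mean increment by increments one level below, and trading the
random new point for `i` costs at most 1. The bound is crude but does not involve `N`. -/
theorem incr_le_incrBound (m : ℕ) : ∀ {F h : (ι → ℕ) → ℝ} {c : ℝ}, TruncStein p a b N F h c →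
    ∀ {v : ι → ℕ}, tot v = m → m < N → ∀ i, h (v + Pi.single i 1) - h v ≤ incrBound a m := by
  induction m with
  | zero =>
    intro F h c H v hv hm i
    have ha := H.a_pos
    have hv0 : v = 0 := tot_eq_zero.1 hv
    have h1 := H.eq v (by omega)
    have h2 := H.sub_mean_le_of_swap (v := v) fun l => H.swap_le_one (by omega) i l
    rw [gen, hv, truncRate, if_pos hm, H.birth_eq] at h1
    have h3 : death h v = 0 := by simp [death, hv0]
    rw [h3] at h1
    simp only [Nat.cast_zero, mul_zero, add_zero] at h1
    have h4 : ∑ i, p i * h (v + Pi.single i 1) - h v ≤ 1 / a := by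
      rw [le_div_iff₀ ha]
      have := H.F_le v
      have := H.const_mem.1
      linarith
    rw [incrBound]
    linarith
  | succ m ih =>
    intro F h c H v hv hm i
    have ha := H.a_pos
    have hb := H.b_nonneg
    have h1 := H.eq v (by omega)
    have h2 := H.sub_mean_le_of_swap (v := v) fun l => H.swap_le_one (by omega) i l
    rw [gen, hv, truncRate, if_pos hm, H.birth_eq] at h1
    set g := ∑ i, p i * h (v + Pi.single i 1) - h v with hg
    have h3 : -death h v ≤ (m + 1) * incrBound a m := by
      have h4 : death (fun w => -h w) v ≤ tot v * incrBound a m := by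
        refine death_le fun l hl => ?_
        have h5 := tot_sub_single hl
        have := ih H (v := v - Pi.single l 1) (by omega) (by omega) l
        rw [sub_single_add hl] at this
        linarith
      have h5 : death (fun w => -h w) v = -death h v := by
        rw [death, death, ← Finset.sum_neg_distrib]
        exact Finset.sum_congr rfl fun i _ => by ring
      rw [h5, hv] at h4
      exact_mod_cast h4
    have h0 := incrBound_nonneg ha m
    have h4 : g ≤ (1 + (m + 1) * incrBound a m) / a := by
      rw [le_div_iff₀ ha]
      rcases le_or_gt g 0 with h6 | h6
      · have : g * a ≤ 0 := mul_nonpos_of_nonpos_of_nonneg h6 ha.le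
        have : 0 ≤ 1 + ((m : ℝ) + 1) * incrBound a m := by positivity
        linarith
      · have := H.F_le v
        have := H.const_mem.1
        have : 0 ≤ b * ((m + 1 : ℕ) : ℝ) * g := by positivity
        linarith
    rw [incrBound]
    linarith

/-- Low levels use the recursion, high levels the downward drift. Only independence of `N` matters:
it gives compactness when `N` tends to infinity and linear growth of the limit. -/
theorem exists_incr_bound (a b : ℝ) (ha : 0 < a) (hb1 : b < 1) :
    ∃ C : ℝ, ∀ {p : ι → ℝ} {N : ℕ} {F h : (ι → ℕ) → ℝ} {c : ℝ}, TruncStein p a b N F h c →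
      ∀ v : ι → ℕ, tot v < N → ∀ i, |h (v + Pi.single i 1) - h v| ≤ C := by
  obtain ⟨M, hM⟩ := exists_nat_ge (2 * a / (1 - b))
  have hb1' : 0 < 1 - b := by linarith
  set C1 : ℝ := (1 + (1 / 2 + 3 / (5 * a)) + 1 / (2 * a)) * (2 / (1 - b)) with hC1
  set C2 : ℝ := ∑ m ∈ Finset.range M, incrBound a m with hC2
  have hC10 : 0 ≤ C1 := by positivity
  have hC20 : 0 ≤ C2 := Finset.sum_nonneg fun m _ => incrBound_nonneg ha m
  have key : ∀ {p : ι → ℝ} {N : ℕ} {F h : (ι → ℕ) → ℝ} {c : ℝ}, TruncStein p a b N F h c →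
      ∀ v : ι → ℕ, tot v < N → ∀ i, h (v + Pi.single i 1) - h v ≤ C1 + C2 := by
    intro p N F h c H v hv i
    rcases lt_or_ge (tot v) M with hvM | hvM
    · have h1 := incr_le_incrBound (tot v) H rfl hv i
      have h2 : incrBound a (tot v) ≤ C2 :=
        Finset.single_le_sum (f := fun m => incrBound a m) (fun m _ => incrBound_nonneg ha m)
          (Finset.mem_range.2 hvM)
      linarith
    -- Beyond level `M` the drift is at least half of `(1 - b) * (tot v + 1)`, hence of the same
    -- order as the numerator of the barrier bound.
    · have h1 : 2 * a ≤ (1 - b) * (tot v + 1) := by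
        have h2 : 2 * a / (1 - b) ≤ tot v := hM.trans (by exact_mod_cast hvM)
        rw [div_le_iff₀ hb1'] at h2
        nlinarith
      set t : ℝ := (tot v : ℝ) with ht
      have ht0 : 0 ≤ t := Nat.cast_nonneg _
      have h2 : 0 < (1 - b) * (t + 1) - a := by linarith
      have h3 := H.incr_le_of_drift_neg hv h2 i
      set X := h (v + Pi.single i 1) - h v with hX
      rcases le_or_gt X 0 with h0 | h0
      · linarith
      have h4 : (1 - b) * (t + 1) / 2 * X ≤ (1 - b) * (t + 1) / 2 * C1 := by
        have h5 : (1 - b) * (t + 1) / 2 * C1 = (1 + (1 / 2 + 3 / (5 * a)) + 1 / (2 * a)) * (t + 1) := by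
          rw [hC1]; field_simp
        have h6 : c + (t / (2 * a) + (1 / 2 + 3 / (5 * a))) ≤
            (1 + (1 / 2 + 3 / (5 * a)) + 1 / (2 * a)) * (t + 1) := by
          have h7 := H.const_mem.2
          have h8 : 0 < 1 / 2 + 3 / (5 * a) := by positivity
          have h9 : 0 < 1 / (2 * a) := by positivity
          have h10 : t / (2 * a) = 1 / (2 * a) * t := by ring
          rw [h10]
          nlinarith
        nlinarith
      have := le_of_mul_le_mul_left h4 (by positivity)
      linarith
  refine ⟨C1 + C2, fun H v hv i => abs_le.2 ⟨?_, key H v hv i⟩⟩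
  have := key H.neg v hv i
  linarith

end TruncStein

variable {ι : Type*} [Fintype ι] [DecidableEq ι]

/-! ### The Stein equation -/

-- The normalisation at the origin and the uniform increment bound keep each value `hN N v` in a
-- compact interval. A free ultrafilter gives all limits at once, and the equation and each estimate
-- involve only finitely many values of `h`.
open Filter Topology in
theorem exists_stein_solution_of_limit {p : ι → ℝ} {a b : ℝ} {F : (ι → ℕ) → ℝ}
    (hp : ∀ i, 0 ≤ p i) (hp1 : ∑ i, p i = 1) (ha : 0 < a) (hb : 0 ≤ b) (hb1 : b < 1)
    (hF0 : ∀ v, 0 ≤ F v) (hF1 : ∀ v, F v ≤ 1)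
    (hFs : ∀ v i j, |F (v + Pi.single i 1) - F (v + Pi.single j 1)| ≤ 1 / ((tot v : ℝ) + 1)) :
    ∃ (h : (ι → ℕ) → ℝ) (c C : ℝ), (∀ v, gen p (fun k => a + b * k) h v = F v - c) ∧
      (∀ (v : ι → ℕ) i, |h (v + Pi.single i 1) - h v| ≤ C) ∧
      (∀ (v : ι → ℕ) i j, |h (v + Pi.single i 1) - h (v + Pi.single j 1)| ≤ 1) ∧
      (∀ (v : ι → ℕ) i j, |h (v + Pi.single i 1) - h (v + Pi.single j 1)| ≤ swapBound a (tot v)) ∧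
      ∀ (v : ι → ℕ) i j, 5 / a + 2 / ((tot v : ℝ) + 1) < 2 →
        |h (v + Pi.single i 1 + Pi.single j 1) - h (v + Pi.single i 1) - h (v + Pi.single j 1) +
          h v| ≤ 5 / a + 2 / ((tot v : ℝ) + 1) := by
  have hex : ∀ N : ℕ, ∃ (h : (ι → ℕ) → ℝ) (c : ℝ), h 0 = 0 ∧
      ∀ v, tot v ≤ N → gen p (truncRate a b N) h v = F v - c := fun N =>
    exists_truncated_solution hp (truncRate_nonneg ha hb N) (truncRate_self a b N) F
  choose hN cN hN0 hNeq using hex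
  have H : ∀ N : ℕ, 2 * a ≤ N → TruncStein p a b N F (hN N) (cN N) := fun N hNa =>
    ⟨hp, hp1, ha, hb, hb1, hF0, hF1, hFs, hNeq N, hNa⟩
  obtain ⟨C, hC⟩ := TruncStein.exists_incr_bound (ι := ι) a b ha hb1
  let U : Ultrafilter ℕ := hyperfilter ℕ
  have hev : ∀ n : ℕ, ∀ᶠ N : ℕ in (U : Filter ℕ), 2 * a ≤ N ∧ n < N := fun n => by
    obtain ⟨M, hM⟩ := exists_nat_ge (2 * a)
    refine Nat.hyperfilter_le_atTop ((eventually_ge_atTop (max M (n + 1))).mono fun N hNM => ?_)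
    have h1 : M ≤ N := (le_max_left _ _).trans hNM
    have h2 : n + 1 ≤ N := (le_max_right _ _).trans hNM
    exact ⟨hM.trans (by exact_mod_cast h1), h2⟩
  have hbound : ∀ (v : ι → ℕ) (N : ℕ), 2 * a ≤ N → tot v ≤ N → |hN N v| ≤ C * tot v := by
    intro v N hNa
    induction v using vec_induction with
    | zero => intro _; simp [hN0, tot_zero]
    | add v i ih =>
      intro hv
      rw [tot_add_single] at hv ⊢
      have h1 := ih (by omega)
      have h2 := hC (H N hNa) v (by omega) i
      calc |hN N (v + Pi.single i 1)|
          = |(hN N (v + Pi.single i 1) - hN N v) + hN N v| := by rw [sub_add_cancel]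
        _ ≤ C + C * tot v := (abs_add_le _ _).trans (add_le_add h2 h1)
        _ = C * ((tot v + 1 : ℕ) : ℝ) := by push_cast; ring
  have hlim : ∀ v, ∃ y, Tendsto (fun N => hN N v) U (𝓝 y) := by
    intro v
    obtain ⟨y, _, hy⟩ := (isCompact_Icc (a := -(C * tot v)) (b := C * tot v)).ultrafilter_le_nhds
      (U.map fun N => hN N v) (by
        rw [le_principal_iff, Ultrafilter.coe_map, mem_map]
        filter_upwards [hev (tot v)] with N hNN
        exact abs_le.1 (hbound v N hNN.1 hNN.2.le))
    exact ⟨y, hy⟩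
  choose h hh using hlim
  obtain ⟨c, _, hc⟩ := (isCompact_Icc (a := (0 : ℝ)) (b := 1)).ultrafilter_le_nhds
    (U.map cN) (by
      rw [le_principal_iff, Ultrafilter.coe_map, mem_map]
      filter_upwards [hev 0] with N hNN
      exact (H N hNN.1).const_mem)
  replace hc : Tendsto cN U (𝓝 c) := hc
  refine ⟨h, c, C, fun v => ?_, fun v i => ?_, fun v i j => ?_, fun v i j => ?_,
    fun v i j hlt => ?_⟩
  · have h1 : Tendsto (fun N => gen p (fun k => a + b * k) (hN N) v) U
        (𝓝 (gen p (fun k => a + b * k) h v)) := by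
      unfold gen birth death
      refine Tendsto.add (Tendsto.const_mul _ (tendsto_finsetSum _ fun i _ =>
        ((hh _).sub (hh _)).const_mul _)) (tendsto_finsetSum _ fun i _ =>
        ((hh _).sub (hh _)).const_mul _)
    refine tendsto_nhds_unique h1 ((tendsto_const_nhds.sub hc).congr' ?_)
    filter_upwards [hev (tot v)] with N hNN
    rw [← hNeq N v hNN.2.le, gen, gen, truncRate, if_pos hNN.2]
  · refine le_of_tendsto ((hh _).sub (hh _)).abs ?_
    filter_upwards [hev (tot v)] with N hNN
    exact hC (H N hNN.1) v hNN.2 i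
  · refine le_of_tendsto ((hh _).sub (hh _)).abs ?_
    filter_upwards [hev (tot v)] with N hNN
    have h1 := (H N hNN.1).swap_le_one hNN.2 i j
    have h2 := (H N hNN.1).swap_le_one hNN.2 j i
    exact abs_le.2 ⟨by linarith, h1⟩
  · refine le_of_tendsto ((hh _).sub (hh _)).abs ?_
    filter_upwards [hev (tot v)] with N hNN
    have h1 := (H N hNN.1).swap_le_swapBound hNN.2 i j
    have h2 := (H N hNN.1).swap_le_swapBound hNN.2 j i
    exact abs_le.2 ⟨by linarith, h1⟩
  · refine le_of_tendsto ((((hh _).sub (hh _)).sub (hh _)).add (hh _)).abs ?_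
    filter_upwards [hev (tot v + 1)] with N hNN
    exact (H N hNN.1).abs_second_diff_le hNN.2 hlt i j

/-! ### The uniform bound for second differences -/

/-- `∑_{r < i, s < j} 1 / (r + s + 1)`, a bound for the mean time during which two critical
branching families of initial sizes `i` and `j` are both alive. -/
def pairBound (i j : ℕ) : ℝ := ∑ r ∈ Finset.range i, ∑ s ∈ Finset.range j, 1 / ((r + s + 1 : ℕ) : ℝ)

theorem pairBound_succ_left (i j : ℕ) :
    pairBound (i + 1) j = pairBound i j + ∑ s ∈ Finset.range j, 1 / ((i + s + 1 : ℕ) : ℝ) := by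
  rw [pairBound, Finset.sum_range_succ, ← pairBound]

theorem pairBound_comm (i j : ℕ) : pairBound i j = pairBound j i := by
  rw [pairBound, Finset.sum_comm, pairBound]
  simp only [add_comm]

theorem pairBound_nonneg (i j : ℕ) : 0 ≤ pairBound i j :=
  Finset.sum_nonneg fun _ _ => Finset.sum_nonneg fun _ _ => by positivity

theorem pairBound_zero_left (j : ℕ) : pairBound 0 j = 0 := by simp [pairBound]

theorem pairBound_one_one : pairBound 1 1 = 1 := by simp [pairBound]

/-- For `b ≤ 1` births weigh no more than deaths, which leaves the second difference of `pairBound`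
in `i`; it telescopes in `s`. -/
theorem pairBound_generator_left {b : ℝ} (hb1 : b ≤ 1) (i j : ℕ) :
    i * b * (pairBound (i + 1) j - pairBound i j) + i * (pairBound (i - 1) j - pairBound i j) ≤
      -(i * (j / (i * (i + j)))) := by
  rcases i with _ | i
  · simp
  · rw [Nat.add_sub_cancel, pairBound_succ_left (i + 1) j, add_sub_cancel_left,
      pairBound_succ_left i j]
    set S1 := ∑ s ∈ Finset.range j, 1 / ((i + 1 + s + 1 : ℕ) : ℝ) with hS1
    set S0 := ∑ s ∈ Finset.range j, 1 / ((i + s + 1 : ℕ) : ℝ) with hS0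
    have h1 : S1 - S0 = -(j / (((i + 1 : ℕ) : ℝ) * ((i + 1 : ℕ) + j))) := by
      rw [hS1, hS0, ← Finset.sum_sub_distrib]
      have h2 := Finset.sum_range_sub (fun s : ℕ => 1 / ((i + s + 1 : ℕ) : ℝ)) j
      have h3 : ∀ s : ℕ, i + (s + 1) + 1 = i + 1 + s + 1 := fun s => by omega
      simp only [h3] at h2
      rw [h2]
      push_cast
      have : (i : ℝ) + j + 1 ≠ 0 := by positivity
      have : (i : ℝ) + 0 + 1 ≠ 0 := by positivity
      have : (i : ℝ) + 1 + j ≠ 0 := by positivity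
      have : (i : ℝ) + 1 ≠ 0 := by positivity
      field_simp
      ring
    have h4 : 0 ≤ S1 := Finset.sum_nonneg fun _ _ => by positivity
    have h5 : (0 : ℝ) ≤ ((i + 1 : ℕ) : ℝ) := Nat.cast_nonneg _
    have h6 : ((i + 1 : ℕ) : ℝ) * b * S1 ≤ ((i + 1 : ℕ) : ℝ) * S1 := by
      refine mul_le_mul_of_nonneg_right ?_ h4
      nlinarith
    have h7 := congrArg (fun x => ((i + 1 : ℕ) : ℝ) * x) h1
    linarith

/-- The two telescoped contributions are `-j / (i + j)` and `-i / (i + j)`, which is why the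
summands `1 / (r + s + 1)` are the right ones. -/
theorem pairBound_generator_le {b : ℝ} (hb1 : b ≤ 1) {i j : ℕ} (hi : 0 < i) (hj : 0 < j) :
    (i * b * (pairBound (i + 1) j - pairBound i j) + i * (pairBound (i - 1) j - pairBound i j)) +
    (j * b * (pairBound i (j + 1) - pairBound i j) + j * (pairBound i (j - 1) - pairBound i j)) ≤
      -1 := by
  have h1 := pairBound_generator_left hb1 i j
  have h2 := pairBound_generator_left hb1 j i
  rw [pairBound_comm (j + 1) i, pairBound_comm j i, pairBound_comm (j - 1) i] at h2
  have hi' : (0 : ℝ) < i := by exact_mod_cast hi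
  have hj' : (0 : ℝ) < j := by exact_mod_cast hj
  have h3 : -((i : ℝ) * (j / (i * (i + j)))) + -((j : ℝ) * (i / (j * (j + i)))) = -1 := by
    field_simp; ring
  linarith

/-- Mixed difference of `h` in the directions `η` and `θ`. -/
def mixedDiff (h : (ι → ℕ) → ℝ) (ξ η θ : ι → ℕ) : ℝ :=
  h (ξ + η + θ) - h (ξ + η) - h (ξ + θ) + h ξ

/-- Generator of three independent groups of points, with immigration to the first. -/
def tripleGen (p : ι → ℝ) (a b : ℝ) (u : (ι → ℕ) → (ι → ℕ) → (ι → ℕ) → ℝ) (ξ η θ : ι → ℕ) : ℝ :=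
  ((a + b * tot ξ) * birth p (fun w => u w η θ) ξ + death (fun w => u w η θ) ξ) +
  (b * tot η * birth p (fun w => u ξ w θ) η + death (fun w => u ξ w θ) η) +
  (b * tot θ * birth p (fun w => u ξ η w) θ + death (fun w => u ξ η w) θ)

theorem tripleGen_add (p : ι → ℝ) (a b : ℝ) (u u' : (ι → ℕ) → (ι → ℕ) → (ι → ℕ) → ℝ)
    (ξ η θ : ι → ℕ) : tripleGen p a b (fun x y z => u x y z + u' x y z) ξ η θ =
      tripleGen p a b u ξ η θ + tripleGen p a b u' ξ η θ := by
  have hB : ∀ (f g : (ι → ℕ) → ℝ) v, birth p (fun w => f w + g w) v = birth p f v + birth p g v := by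
    intro f g v
    simp only [birth, ← Finset.sum_add_distrib]
    exact Finset.sum_congr rfl fun i _ => by ring
  have hD : ∀ (f g : (ι → ℕ) → ℝ) v, death (fun w => f w + g w) v = death f v + death g v := by
    intro f g v
    simp only [death, ← Finset.sum_add_distrib]
    exact Finset.sum_congr rfl fun i _ => by ring
  simp only [tripleGen, hB, hD]
  ring

theorem tripleGen_smul (p : ι → ℝ) (a b r : ℝ) (u : (ι → ℕ) → (ι → ℕ) → (ι → ℕ) → ℝ)
    (ξ η θ : ι → ℕ) : tripleGen p a b (fun x y z => r * u x y z) ξ η θ =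
      r * tripleGen p a b u ξ η θ := by
  have hB : ∀ (f : (ι → ℕ) → ℝ) v, birth p (fun w => r * f w) v = r * birth p f v := by
    intro f v
    simp only [birth, Finset.mul_sum]
    exact Finset.sum_congr rfl fun i _ => by ring
  have hD : ∀ (f : (ι → ℕ) → ℝ) v, death (fun w => r * f w) v = r * death f v := by
    intro f v
    simp only [death, Finset.mul_sum]
    exact Finset.sum_congr rfl fun i _ => by ring
  simp only [tripleGen, hB, hD]
  ring

theorem gen_add_eq (p : ι → ℝ) (a b : ℝ) (h : (ι → ℕ) → ℝ) (v w : ι → ℕ) :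
    gen p (fun k => a + b * k) h (v + w) =
      ((a + b * tot v) * birth p (fun x => h (x + w)) v + death (fun x => h (x + w)) v) +
      (b * tot w * birth p (fun x => h (v + x)) w + death (fun x => h (v + x)) w) := by
  have h1 : birth p (fun x => h (x + w)) v = birth p h (v + w) := by
    simp only [birth, add_right_comm]
  have h2 : birth p (fun x => h (v + x)) w = birth p h (v + w) := by
    simp only [birth, add_assoc]
  rw [gen, death_add, tot_add, h1, h2, death, death]
  push_cast
  ring

theorem birth_const (p : ι → ℝ) (r : ℝ) (v : ι → ℕ) : birth p (fun _ => r) v = 0 := by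
  simp [birth]

theorem death_const (r : ℝ) (v : ι → ℕ) : death (fun _ => r) v = 0 := by
  simp [death]

/-- Affine rates split over groups: immigration goes to the first group and every group branches on
its own. On a function of a sum of groups that includes the first, the triple generator therefore
acts as the original one. -/
theorem tripleGen_mixedDiff (p : ι → ℝ) (a b : ℝ) (h : (ι → ℕ) → ℝ) (ξ η θ : ι → ℕ) :
    tripleGen p a b (mixedDiff h) ξ η θ = mixedDiff (gen p (fun k => a + b * k) h) ξ η θ := by
  have e : mixedDiff h = fun x y z => (h (x + y + z) + (-1) * h (x + y)) +
      ((-1) * h (x + z) + h x) := by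
    funext x y z
    rw [mixedDiff]; ring
  rw [e, tripleGen_add, tripleGen_add, tripleGen_add, tripleGen_smul, tripleGen_smul]
  have h1 : tripleGen p a b (fun x y z => h (x + y + z)) ξ η θ =
      gen p (fun k => a + b * k) h (ξ + η + θ) := by
    rw [gen_add_eq p a b h (ξ + η) θ]
    have := gen_add_eq p a b (fun x => h (x + θ)) ξ η
    rw [gen] at this
    rw [this, tripleGen]
  have h2 : tripleGen p a b (fun x y _ => h (x + y)) ξ η θ =
      gen p (fun k => a + b * k) h (ξ + η) := by
    rw [gen_add_eq, tripleGen, birth_const, death_const]; ring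
  have h3 : tripleGen p a b (fun x _ z => h (x + z)) ξ η θ =
      gen p (fun k => a + b * k) h (ξ + θ) := by
    rw [gen_add_eq, tripleGen, birth_const p _ η, death_const _ η]; ring
  have h4 : tripleGen p a b (fun x _ _ => h x) ξ η θ = gen p (fun k => a + b * k) h ξ := by
    rw [gen, tripleGen, birth_const, death_const, birth_const, death_const]; ring
  rw [h1, h2, h3, h4, mixedDiff]
  ring

theorem tripleGen_pairBound (p : ι → ℝ) (hp1 : ∑ i, p i = 1) (a b : ℝ) (ξ η θ : ι → ℕ) :
    tripleGen p a b (fun _ y z => pairBound (tot y) (tot z)) ξ η θ =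
      (tot η * b * (pairBound (tot η + 1) (tot θ) - pairBound (tot η) (tot θ)) +
        tot η * (pairBound (tot η - 1) (tot θ) - pairBound (tot η) (tot θ))) +
      (tot θ * b * (pairBound (tot η) (tot θ + 1) - pairBound (tot η) (tot θ)) +
        tot θ * (pairBound (tot η) (tot θ - 1) - pairBound (tot η) (tot θ))) := by
  have hB : ∀ (f : ℕ → ℝ) (v : ι → ℕ), birth p (fun w => f (tot w)) v = f (tot v + 1) - f (tot v) := by
    intro f v
    simp only [birth, tot_add_single]
    rw [← Finset.sum_mul, hp1, one_mul]
  have hD : ∀ (f : ℕ → ℝ) (v : ι → ℕ),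
      death (fun w => f (tot w)) v = tot v * (f (tot v - 1) - f (tot v)) := by
    intro f v
    rw [death, tot_cast, Finset.sum_mul]
    refine Finset.sum_congr rfl fun i _ => ?_
    rcases Nat.eq_zero_or_pos (v i) with h0 | h0
    · simp [h0]
    · have := tot_sub_single h0
      rw [show tot (v - Pi.single i 1) = tot v - 1 by omega]
  rw [tripleGen, birth_const, death_const, hB (fun k => pairBound k (tot θ)),
    hD (fun k => pairBound k (tot θ)), hB (fun k => pairBound (tot η) k),
    hD (fun k => pairBound (tot η) k)]
  ring

theorem gen_sq_tot (p : ι → ℝ) (hp1 : ∑ i, p i = 1) (a b : ℝ) (v : ι → ℕ) :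
    gen p (fun k => a + b * k) (fun w => (tot w : ℝ) ^ 2) v =
      (a + b * tot v) * (2 * tot v + 1) + tot v * (1 - 2 * tot v) := by
  have h1 : birth p (fun w => (tot w : ℝ) ^ 2) v = 2 * tot v + 1 := by
    simp only [birth, tot_add_single]
    rw [← Finset.sum_mul, hp1, one_mul]
    push_cast; ring
  have h2 : death (fun w => (tot w : ℝ) ^ 2) v = tot v * (1 - 2 * tot v) := by
    have h3 : (tot v : ℝ) * (1 - 2 * tot v) = ∑ i, (v i : ℝ) * (1 - 2 * tot v) := by
      rw [← Finset.sum_mul, ← tot_cast]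
    rw [death, h3]
    refine Finset.sum_congr rfl fun i _ => ?_
    rcases Nat.eq_zero_or_pos (v i) with h0 | h0
    · simp [h0]
    · have : (tot v : ℝ) = tot (v - Pi.single i 1) + 1 := by exact_mod_cast (tot_sub_single h0).symm
      rw [this]; ring
  rw [gen, h1, h2]

/-- The generator sends the squared total to a quadratic with leading coefficient `-2 * (1 - b) <
0`. The squared total serves as a Lyapunov function on the infinite state space. -/
theorem tripleGen_sq_tot_le (p : ι → ℝ) (hp1 : ∑ i, p i = 1) {a b : ℝ} (hb1 : b < 1) :
    ∃ M : ℝ, 0 < M ∧ ∀ ξ η θ : ι → ℕ,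
      tripleGen p a b (fun x y z => (tot (x + y + z) : ℝ) ^ 2) ξ η θ ≤ M := by
  refine ⟨|a| + (2 * |a| + |b| + 1) ^ 2 / (8 * (1 - b)) + 1, ?_, fun ξ η θ => ?_⟩
  · have : 0 < 1 - b := by linarith
    positivity
  · have h1 : tripleGen p a b (fun x y z => (tot (x + y + z) : ℝ) ^ 2) ξ η θ =
        gen p (fun k => a + b * k) (fun w => (tot w : ℝ) ^ 2) (ξ + η + θ) := by
      rw [gen_add_eq p a b _ (ξ + η) θ]
      have := gen_add_eq p a b (fun x => (tot (x + θ) : ℝ) ^ 2) ξ η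
      rw [gen] at this
      rw [this, tripleGen]
    rw [h1, gen_sq_tot p hp1]
    set T : ℝ := (tot (ξ + η + θ) : ℝ) with hT
    have hT0 : 0 ≤ T := Nat.cast_nonneg _
    have hb : 0 < 1 - b := by linarith
    have h2 : (2 * |a| + |b| + 1) * T ≤ 2 * (1 - b) * T ^ 2 + (2 * |a| + |b| + 1) ^ 2 / (8 * (1 - b)) := by
      set K := 2 * |a| + |b| + 1
      rw [← sub_nonneg]
      have : 2 * (1 - b) * T ^ 2 + K ^ 2 / (8 * (1 - b)) - K * T =
          (4 * (1 - b) * T - K) ^ 2 / (8 * (1 - b)) := by field_simp; ring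
      rw [this]; positivity
    have h3 : a ≤ |a| := le_abs_self a
    have h4 : a * T ≤ |a| * T := mul_le_mul_of_nonneg_right h3 hT0
    have h5 : b * T ≤ |b| * T := mul_le_mul_of_nonneg_right (le_abs_self b) hT0
    nlinarith

theorem tripleGen_nonpos_of_max {p : ι → ℝ} (hp : ∀ i, 0 ≤ p i) {a b : ℝ} (ha : 0 ≤ a) (hb : 0 ≤ b)
    {u : (ι → ℕ) → (ι → ℕ) → (ι → ℕ) → ℝ} {ξ η θ : ι → ℕ}
    (hmax : ∀ x y z, u x y z ≤ u ξ η θ) : tripleGen p a b u ξ η θ ≤ 0 := by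
  have hB : ∀ (f : (ι → ℕ) → ℝ) v, (∀ w, f w ≤ f v) → birth p f v ≤ 0 := fun f v hf =>
    birth_nonpos hp fun i => hf _
  have hD : ∀ (f : (ι → ℕ) → ℝ) v, (∀ w, f w ≤ f v) → death f v ≤ 0 := fun f v hf =>
    Finset.sum_nonpos fun i _ =>
      mul_nonpos_of_nonneg_of_nonpos (Nat.cast_nonneg _) (sub_nonpos.2 (hf _))
  refine add_nonpos (add_nonpos (add_nonpos ?_ ?_) (add_nonpos ?_ ?_)) (add_nonpos ?_ ?_)
  · exact mul_nonpos_of_nonneg_of_nonpos (by positivity) (hB _ _ fun w => hmax _ _ _)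
  · exact hD _ _ fun w => hmax _ _ _
  · exact mul_nonpos_of_nonneg_of_nonpos (by positivity) (hB _ _ fun w => hmax _ _ _)
  · exact hD _ _ fun w => hmax _ _ _
  · exact mul_nonpos_of_nonneg_of_nonpos (by positivity) (hB _ _ fun w => hmax _ _ _)
  · exact hD _ _ fun w => hmax _ _ _

theorem abs_sub_le_of_incr {h : (ι → ℕ) → ℝ} {C : ℝ}
    (hC : ∀ v i, |h (v + Pi.single i 1) - h v| ≤ C) (v w : ι → ℕ) :
    |h (v + w) - h v| ≤ C * tot w := by
  induction w using vec_induction with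
  | zero => simp [tot_zero]
  | add w i ih =>
    rw [← add_assoc, tot_add_single]
    have h1 := hC (v + w) i
    have h2 := abs_add_le (h (v + w + Pi.single i 1) - h (v + w)) (h (v + w) - h v)
    rw [sub_add_sub_cancel] at h2
    push_cast
    linarith

/-- The triple generator sends the mixed difference to that of `F`, which is at least -2, and sends
`pairBound` below -1 while both families are alive. Once a family is extinct, the mixed difference
is zero. Comparison gives the factor 2. -/
theorem mixedDiff_le_of_stein {p : ι → ℝ} {a b : ℝ} {F h : (ι → ℕ) → ℝ} {c C : ℝ}
    (hp : ∀ i, 0 ≤ p i) (hp1 : ∑ i, p i = 1) (ha : 0 ≤ a) (hb : 0 ≤ b) (hb1 : b < 1)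
    (hF0 : ∀ v, 0 ≤ F v) (hF1 : ∀ v, F v ≤ 1)
    (hh : ∀ v, gen p (fun k => a + b * k) h v = F v - c)
    (hC : ∀ v i, |h (v + Pi.single i 1) - h v| ≤ C) (ξ η θ : ι → ℕ) :
    mixedDiff h ξ η θ ≤ 2 * pairBound (tot η) (tot θ) := by
  obtain ⟨M, hM0, hM⟩ := tripleGen_sq_tot_le p hp1 (a := a) hb1
  suffices key : ∀ ε : ℝ, 0 < ε → mixedDiff h ξ η θ ≤
      (2 + 2 * ε * M) * pairBound (tot η) (tot θ) + ε * (tot (ξ + η + θ) : ℝ) ^ 2 by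
    refine le_of_forall_pos_le_add fun δ hδ => ?_
    set K := 2 * M * pairBound (tot η) (tot θ) + (tot (ξ + η + θ) : ℝ) ^ 2 with hK
    have hK0 : 0 ≤ K := by
      have := pairBound_nonneg (tot η) (tot θ)
      positivity
    have h1 := key (δ / (K + 1)) (by positivity)
    have h2 : δ / (K + 1) * K ≤ δ := by
      rw [div_mul_eq_mul_div, div_le_iff₀ (by positivity)]
      nlinarith
    have h3 : (2 + 2 * (δ / (K + 1)) * M) * pairBound (tot η) (tot θ) +
        δ / (K + 1) * (tot (ξ + η + θ) : ℝ) ^ 2 =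
        2 * pairBound (tot η) (tot θ) + δ / (K + 1) * K := by rw [hK]; ring
    linarith
  intro ε hε
  by_contra hcon
  push Not at hcon
  -- The penalty `ε * tot ^ 2` beats the linear growth of `h`, so a positive supremum is attained;
  -- the extra `2 * ε * M` compensates the generator of the penalty with room to spare.
  let u : (ι → ℕ) → (ι → ℕ) → (ι → ℕ) → ℝ := fun x y z => mixedDiff h x y z +
    ((-(2 + 2 * ε * M)) * pairBound (tot y) (tot z) + (-ε) * (tot (x + y + z) : ℝ) ^ 2)
  have hu0 : 0 < u ξ η θ := by simp only [u]; linarith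
  have hgrow : ∀ x y z, u x y z ≤ 2 * |C| * tot (x + y + z) - ε * (tot (x + y + z) : ℝ) ^ 2 := by
    intro x y z
    have h1 := (abs_le.1 (abs_sub_le_of_incr hC (x + y) z)).2
    have h2 := (abs_le.1 (abs_sub_le_of_incr hC x z)).1
    have h3 : C * tot z ≤ |C| * tot z :=
      mul_le_mul_of_nonneg_right (le_abs_self C) (Nat.cast_nonneg _)
    have h4 : (tot z : ℝ) ≤ tot (x + y + z) := by
      rw [tot_add (x + y) z]; push_cast
      linarith [(Nat.cast_nonneg (tot (x + y)) : (0 : ℝ) ≤ _)]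
    have h5 := mul_le_mul_of_nonneg_left h4 (abs_nonneg C)
    have h6 : 0 ≤ (2 + 2 * ε * M) * pairBound (tot y) (tot z) :=
      mul_nonneg (by positivity) (pairBound_nonneg _ _)
    simp only [u, mixedDiff]
    linarith
  obtain ⟨R, hR⟩ := exists_nat_ge (2 * |C| / ε)
  have hbig : ∀ x y z, 0 < u x y z → tot (x + y + z) ≤ R := by
    intro x y z hxyz
    by_contra hlt
    push Not at hlt
    have h1 : 2 * |C| / ε ≤ tot (x + y + z) := hR.trans (by exact_mod_cast hlt.le)
    rw [div_le_iff₀ hε] at h1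
    have h2 := hgrow x y z
    have h3 : (0 : ℝ) ≤ tot (x + y + z) := Nat.cast_nonneg _
    nlinarith
  have hfin : {q : (ι → ℕ) × (ι → ℕ) × (ι → ℕ) | tot (q.1 + q.2.1 + q.2.2) ≤ R}.Finite := by
    refine ((finite_tot_le R).prod ((finite_tot_le R).prod (finite_tot_le R))).subset ?_
    rintro ⟨x, y, z⟩ hq
    simp only [Set.mem_ofPred_eq, tot_add] at hq
    refine ⟨?_, ?_, ?_⟩ <;> simp only [Set.mem_ofPred_eq] <;> omega
  obtain ⟨⟨x, y, z⟩, hq, hmax⟩ := Set.exists_max_image _ (fun q => u q.1 q.2.1 q.2.2) hfin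
    ⟨(ξ, η, θ), hbig _ _ _ hu0⟩
  simp only at hmax
  have hpos : 0 < u x y z := hu0.trans_le (hmax (ξ, η, θ) (hbig _ _ _ hu0))
  have hmax' : ∀ x' y' z', u x' y' z' ≤ u x y z := by
    intro x' y' z'
    rcases le_or_gt (u x' y' z') 0 with h0 | h0
    · exact h0.trans hpos.le
    · exact hmax (x', y', z') (hbig _ _ _ h0)
  have hgen := tripleGen_nonpos_of_max hp ha hb hmax'
  -- At a positive maximum neither family can be empty, for otherwise only the negative penalty
  -- would be left.
  have hy : 0 < tot y := by
    by_contra h0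
    have hy0 : y = 0 := tot_eq_zero.1 (by omega)
    have : u x y z = (-ε) * (tot (x + y + z) : ℝ) ^ 2 := by
      simp [u, hy0, mixedDiff, tot_zero, pairBound_zero_left]
    have h1 : 0 ≤ ε * (tot (x + y + z) : ℝ) ^ 2 := by positivity
    linarith
  have hz : 0 < tot z := by
    by_contra h0
    have hz0 : z = 0 := tot_eq_zero.1 (by omega)
    have : u x y z = (-ε) * (tot (x + y + z) : ℝ) ^ 2 := by
      simp [u, hz0, mixedDiff, tot_zero, pairBound_comm _ 0, pairBound_zero_left]
    have h1 : 0 ≤ ε * (tot (x + y + z) : ℝ) ^ 2 := by positivity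
    linarith
  have hval : tripleGen p a b u x y z = mixedDiff F x y z +
      ((-(2 + 2 * ε * M)) * tripleGen p a b (fun _ y z => pairBound (tot y) (tot z)) x y z +
      (-ε) * tripleGen p a b (fun x y z => (tot (x + y + z) : ℝ) ^ 2) x y z) := by
    simp only [u]
    rw [tripleGen_add p a b (mixedDiff h), tripleGen_add, tripleGen_smul, tripleGen_smul,
      tripleGen_mixedDiff]
    congr 1
    simp only [mixedDiff, hh]
    ring
  rw [tripleGen_pairBound p hp1] at hval
  have h1 := pairBound_generator_le hb1.le hy hz
  have h2 := hM x y z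
  have h3 : -2 ≤ mixedDiff F x y z := by
    rw [mixedDiff]
    linarith [hF0 (x + y + z), hF1 (x + y), hF1 (x + z), hF0 x]
  rw [hval] at hgen
  have h4 : 0 < 2 + 2 * ε * M := by positivity
  have h5 := mul_le_mul_of_nonneg_left h1 h4.le
  have h6 := mul_le_mul_of_nonneg_left h2 hε.le
  have h7 : 0 < ε * M := by positivity
  linarith

/-- Estimates for the solution `h` of the Stein equation of the birth-death process. -/
structure SteinBounds (a : ℝ) (h : (ι → ℕ) → ℝ) (C : ℝ) : Prop where
  incr : ∀ (v : ι → ℕ) i, |h (v + Pi.single i 1) - h v| ≤ C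
  swap_le_one : ∀ (v : ι → ℕ) i j, |h (v + Pi.single i 1) - h (v + Pi.single j 1)| ≤ 1
  swap_le : ∀ (v : ι → ℕ) i j, |h (v + Pi.single i 1) - h (v + Pi.single j 1)| ≤
    5 / 2 / a + 1 / ((tot v : ℝ) + 1)
  second_le_two : ∀ (v : ι → ℕ) i j, |h (v + Pi.single i 1 + Pi.single j 1) - h (v + Pi.single i 1) -
    h (v + Pi.single j 1) + h v| ≤ 2
  second_le : ∀ (v : ι → ℕ) i j, |h (v + Pi.single i 1 + Pi.single j 1) - h (v + Pi.single i 1) -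
    h (v + Pi.single j 1) + h v| ≤ 5 / a + 2 / ((tot v : ℝ) + 1)

/-- The bound 2 is the mixed-difference estimate for two single points, where `pairBound` is 1, and
it takes over when `5 / a + 2 / (n + 1) ≥ 2`. The bound for moving a point is relaxed to half the
bound for second differences, so that both can be smoothed in the same way. -/
theorem exists_stein_solution {p : ι → ℝ} {a b : ℝ} {F : (ι → ℕ) → ℝ}
    (hp : ∀ i, 0 ≤ p i) (hp1 : ∑ i, p i = 1) (ha : 0 < a) (hb : 0 ≤ b) (hb1 : b < 1)
    (hF0 : ∀ v, 0 ≤ F v) (hF1 : ∀ v, F v ≤ 1)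
    (hFs : ∀ v i j, |F (v + Pi.single i 1) - F (v + Pi.single j 1)| ≤ 1 / ((tot v : ℝ) + 1)) :
    ∃ (h : (ι → ℕ) → ℝ) (c C : ℝ), (∀ v, gen p (fun k => a + b * k) h v = F v - c) ∧
      SteinBounds a h C := by
  obtain ⟨h, c, C, heq, hC, hs1, hs2, hd⟩ :=
    exists_stein_solution_of_limit hp hp1 ha hb hb1 hF0 hF1 hFs
  have htwo : ∀ v i j, |h (v + Pi.single i 1 + Pi.single j 1) - h (v + Pi.single i 1) -
      h (v + Pi.single j 1) + h v| ≤ 2 := by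
    intro v i j
    have h1 := mixedDiff_le_of_stein hp hp1 ha.le hb hb1 hF0 hF1 heq hC v (Pi.single i 1)
      (Pi.single j 1)
    have h2 := mixedDiff_le_of_stein (F := fun v => 1 - F v) (h := fun v => -h v) (c := 1 - c)
      (C := C) hp hp1 ha.le hb hb1 (fun v => by linarith [hF1 v]) (fun v => by linarith [hF0 v])
      (fun v => by rw [gen_neg, heq]; ring)
      (fun v i => by rw [← abs_neg]; convert hC v i using 2; ring) v (Pi.single i 1)
      (Pi.single j 1)
    rw [tot_single, tot_single, pairBound_one_one, mixedDiff] at h1 h2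
    exact abs_le.2 ⟨by linarith, by linarith⟩
  refine ⟨h, c, C, heq, hC, hs1, fun v i j => (hs2 v i j).trans ?_, htwo, fun v i j => ?_⟩
  · have h1 : (0 : ℝ) < tot v + 1 := by positivity
    have h2 : 3 / (5 * a) / ((tot v : ℝ) + 1) ≤ 3 / (5 * a) :=
      div_le_self (by positivity) (by linarith [(Nat.cast_nonneg (tot v) : (0 : ℝ) ≤ _)])
    have h3 : swapBound a (tot v) =
        1 / (2 * a) + 1 / 2 * (1 / ((tot v : ℝ) + 1)) + 3 / (5 * a) / ((tot v : ℝ) + 1) := by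
      rw [swapBound]; ring
    have h4 : 1 / (2 * a) + 3 / (5 * a) ≤ 5 / 2 / a := by
      rw [← sub_nonneg]
      have : 5 / 2 / a - (1 / (2 * a) + 3 / (5 * a)) = 7 / 5 / a := by field_simp; ring
      rw [this]; positivity
    have h5 : 0 < 1 / ((tot v : ℝ) + 1) := by positivity
    linarith
  · rcases lt_or_ge (5 / a + 2 / ((tot v : ℝ) + 1)) 2 with h0 | h0
    · exact hd v i j h0
    · exact (htwo v i j).trans h0

variable {ι : Type*} [Fintype ι] [DecidableEq ι]

/-! ### Smoothing -/

/-- Total variation distance between the laws of `W` and `W + e_i`, for `W` of law `τ`. -/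
def tvShift (τ : Measure (ι → ℕ)) (i : ι) : ℝ≥0∞ :=
  ⨆ E : Set (ι → ℕ), ENNReal.ofReal |τ.real E - τ.real {w | w + Pi.single i 1 ∈ E}|

/-- Bound for the mean third differences of the Stein solution at a point of law `τ`. -/
def smoothBound (a u : ℝ) (τ : Measure (ι → ℕ)) : ℝ≥0∞ :=
  4 * τ {w | (tot w : ℝ) + 1 ≤ a / u} + ENNReal.ofReal ((4 * u + 10) / a) * ⨆ i, tvShift τ i

section Smoothing

variable {τ : Measure (ι → ℕ)} [IsProbabilityMeasure τ] {a u : ℝ}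

theorem tvShift_le_one (i : ι) : tvShift τ i ≤ 1 := by
  refine iSup_le fun E => ?_
  rw [← ENNReal.ofReal_one]
  refine ENNReal.ofReal_le_ofReal (abs_le.2 ⟨?_, ?_⟩)
  · linarith [measureReal_nonneg (μ := τ) (s := E),
      measureReal_le_one (μ := τ) (s := {w | w + Pi.single i 1 ∈ E})]
  · linarith [measureReal_le_one (μ := τ) (s := E),
      measureReal_nonneg (μ := τ) (s := {w | w + Pi.single i 1 ∈ E})]

theorem smoothBound_ne_top : smoothBound a u τ ≠ ∞ := by
  refine ENNReal.add_ne_top.2 ⟨ENNReal.mul_ne_top (by simp) (measure_ne_top _ _),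
    ENNReal.mul_ne_top ENNReal.ofReal_ne_top ?_⟩
  exact ((iSup_le fun i => tvShift_le_one i).trans_lt ENNReal.one_lt_top).ne

theorem integrable_of_abs_le {q : (ι → ℕ) → ℝ} {K : ℝ} (hq : ∀ w, |q w| ≤ K) : Integrable q τ :=
  Integrable.of_bound (Measurable.of_discrete).aestronglyMeasurable K
    (Filter.Eventually.of_forall hq)

/-- Layer-cake formula for `q + K`, which takes values in `[0, 2 * K]`: the level sets differ in
probability by at most `d`. -/
theorem abs_integral_sub_le_of_tv {α : Type*} [MeasurableSpace α] {μ ν : Measure α}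
    [IsProbabilityMeasure μ] [IsProbabilityMeasure ν] {d K : ℝ} {q : α → ℝ} (hq : Measurable q)
    (hK : ∀ x, |q x| ≤ K) (hd : ∀ E, MeasurableSet E → |μ.real E - ν.real E| ≤ d) :
    |∫ x, q x ∂μ - ∫ x, q x ∂ν| ≤ 2 * K * d := by
  have hK0 : 0 ≤ K := (abs_nonneg _).trans (hK (nonempty_of_isProbabilityMeasure μ).some)
  have hinteg : ∀ (ρ : Measure α) [IsProbabilityMeasure ρ], Integrable q ρ := fun ρ _ =>
    Integrable.of_bound hq.aestronglyMeasurable K (Filter.Eventually.of_forall hK)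
  have hanti : ∀ (ρ : Measure α) [IsProbabilityMeasure ρ],
      IntegrableOn (fun t => ρ.real {x | t ≤ q x + K}) (Set.Ioc 0 (2 * K)) := fun ρ _ => by
    have hmono : Antitone fun t => ρ.real {x | t ≤ q x + K} := fun s t hst =>
      measureReal_mono fun x (hx : t ≤ q x + K) => hst.trans hx
    exact Integrable.of_bound (hmono.measurable.aestronglyMeasurable) 1
      (Filter.Eventually.of_forall fun t => by
        rw [Real.norm_of_nonneg measureReal_nonneg]; exact measureReal_le_one)
  have hlayer : ∀ (ρ : Measure α) [IsProbabilityMeasure ρ],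
      ∫ x, q x ∂ρ + K = ∫ t in Set.Ioc 0 (2 * K), ρ.real {x | t ≤ q x + K} := fun ρ _ => by
    have hi : Integrable (fun x => q x + K) ρ := (hinteg ρ).add (integrable_const K)
    rw [← hi.integral_eq_integral_Ioc_meas_le (M := 2 * K)]
    · rw [integral_add (hinteg ρ) (integrable_const K)]
      simp
    · exact Filter.Eventually.of_forall fun x => by
        have := (abs_le.1 (hK x)).1
        simp only [Pi.zero_apply]; linarith
    · exact Filter.Eventually.of_forall fun x => by
        have := (abs_le.1 (hK x)).2
        simp only; linarith
  have h1 : ∫ x, q x ∂μ - ∫ x, q x ∂ν = ∫ t in Set.Ioc 0 (2 * K),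
      (μ.real {x | t ≤ q x + K} - ν.real {x | t ≤ q x + K}) := by
    rw [integral_sub (hanti μ) (hanti ν), ← hlayer μ, ← hlayer ν]; ring
  rw [h1, ← Real.norm_eq_abs]
  have h2 := norm_setIntegral_le_of_norm_le_const (μ := volume) (s := Set.Ioc 0 (2 * K)) (C := d)
    (f := fun t => μ.real {x | t ≤ q x + K} - ν.real {x | t ≤ q x + K}) measure_Ioc_lt_top
    (fun t _ => hd _ (measurableSet_le measurable_const (hq.add_const K)))
  refine h2.trans (le_of_eq ?_)
  rw [measureReal_def, Real.volume_Ioc, ENNReal.toReal_ofReal (by linarith)]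
  ring

theorem ofReal_abs_sub_le_tvShift (τ : Measure (ι → ℕ)) (i : ι) (E : Set (ι → ℕ)) :
    ENNReal.ofReal |τ.real E - τ.real {w | w + Pi.single i 1 ∈ E}| ≤ tvShift τ i := by
  unfold tvShift
  refine le_iSup_of_le E ?_
  rfl

theorem abs_measureReal_sub_le_tvShift (i : ι) (E : Set (ι → ℕ)) :
    |τ.real E - τ.real {w | w + Pi.single i 1 ∈ E}| ≤ (tvShift τ i).toReal := by
  have hne : tvShift τ i ≠ ∞ := ((tvShift_le_one (τ := τ) i).trans_lt ENNReal.one_lt_top).ne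
  have h1 := ENNReal.toReal_mono hne (ofReal_abs_sub_le_tvShift τ i E)
  rwa [ENNReal.toReal_ofReal (abs_nonneg _)] at h1

theorem abs_integral_shift_le {q : (ι → ℕ) → ℝ} {K : ℝ} (hK : ∀ w, |q w| ≤ K) (i : ι) :
    |∫ w, (q (w + Pi.single i 1) - q w) ∂τ| ≤ 2 * K * (tvShift τ i).toReal := by
  have hm : Measurable fun w : ι → ℕ => w + Pi.single i 1 := Measurable.of_discrete
  have : IsProbabilityMeasure (τ.map fun w => w + Pi.single i 1) :=
    Measure.isProbabilityMeasure_map hm.aemeasurable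
  have h1 : ∫ w, (q (w + Pi.single i 1) - q w) ∂τ =
      ∫ w, q w ∂(τ.map fun w => w + Pi.single i 1) - ∫ w, q w ∂τ := by
    rw [integral_sub (integrable_of_abs_le fun w => hK _) (integrable_of_abs_le hK),
      integral_map hm.aemeasurable (Measurable.of_discrete).aestronglyMeasurable]
  rw [h1, abs_sub_comm]
  refine abs_integral_sub_le_of_tv Measurable.of_discrete hK fun E _ => ?_
  rw [map_measureReal_apply hm (MeasurableSet.of_discrete)]
  exact abs_measureReal_sub_le_tvShift i E

/-- Second differences of the Stein solution satisfy these bounds. -/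
def IsSmoothable (a : ℝ) (q : (ι → ℕ) → ℝ) : Prop :=
  ∀ v, |q v| ≤ 2 ∧ |q v| ≤ 5 / a + 2 / ((tot v : ℝ) + 1)

theorem smoothBound_toReal (ha : 0 < a) (hu : 0 < u) : (smoothBound a u τ).toReal =
    4 * τ.real {w | (tot w : ℝ) + 1 ≤ a / u} + (4 * u + 10) / a * (⨆ i, tvShift τ i).toReal := by
  rw [smoothBound, ENNReal.toReal_add (ENNReal.mul_ne_top (by simp) (measure_ne_top _ _)),
    ENNReal.toReal_mul, ENNReal.toReal_mul, ENNReal.toReal_ofReal (by positivity), measureReal_def]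
  · simp
  · exact ENNReal.mul_ne_top ENNReal.ofReal_ne_top
      ((iSup_le fun i => tvShift_le_one i).trans_lt ENNReal.one_lt_top).ne

/-- Split `q` according to whether the random vector has few points. If it has many, `|q| ≤ (2 * u +
5) / a`, even after adding `v`, and total variation gives the factor `(4 * u + 10) / a`. If it has
few, both terms are at most 2, which gives `4 * τ E`. -/
theorem IsSmoothable.abs_integral_le (ha : 0 < a) (hu : 0 < u) {q : (ι → ℕ) → ℝ}
    (hq : IsSmoothable a q) (v : ι → ℕ) (i : ι) :
    |∫ w, (q (v + w + Pi.single i 1) - q (v + w)) ∂τ| ≤ (smoothBound a u τ).toReal := by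
  set E : Set (ι → ℕ) := {w | (tot w : ℝ) + 1 ≤ a / u} with hE
  set K : ℝ := (2 * u + 5) / a with hK
  have hK0 : 0 ≤ K := by positivity
  let g1 : (ι → ℕ) → ℝ := Eᶜ.indicator fun w => q (v + w)
  let g2 : (ι → ℕ) → ℝ := E.indicator fun w => q (v + w)
  have hg : ∀ w, q (v + w) = g1 w + g2 w := fun w =>
    (congrFun (Set.indicator_compl_add_self E fun w => q (v + w)) w).symm
  have hg1 : ∀ w, |g1 w| ≤ K := by
    intro w
    by_cases hw : w ∈ E
    · simp [g1, hw, hK0]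
    · simp only [g1, Set.indicator_of_mem (Set.mem_compl hw)]
      refine (hq (v + w)).2.trans ?_
      have h1 : a / u < (tot w : ℝ) + 1 := not_le.1 hw
      have h2 : (tot w : ℝ) + 1 ≤ tot (v + w) + 1 := by
        rw [tot_add]; push_cast; linarith [(Nat.cast_nonneg (tot v) : (0 : ℝ) ≤ _)]
      have h3 : 2 / ((tot (v + w) : ℝ) + 1) ≤ 2 / (a / u) := by
        gcongr; linarith
      have h4 : K = 5 / a + 2 / (a / u) := by rw [hK]; field_simp; ring
      linarith
  have hg2 : ∀ w, |g2 w| ≤ 2 * E.indicator (fun _ => (1 : ℝ)) w := by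
    intro w
    by_cases hw : w ∈ E
    · simpa [g2, hw] using (hq (v + w)).1
    · simp [g2, hw]
  -- The set `E` is closed under removing points, so the shifted term also lives on `E`.
  have hg2' : ∀ w, |g2 (w + Pi.single i 1)| ≤ 2 * E.indicator (fun _ => (1 : ℝ)) w := by
    intro w
    refine (hg2 _).trans ?_
    gcongr
    by_cases hw : w + Pi.single i 1 ∈ E
    · have : w ∈ E := by
        have h1 : (tot (w + Pi.single i 1) : ℝ) + 1 ≤ a / u := hw
        rw [tot_add_single] at h1
        push_cast at h1
        show (tot w : ℝ) + 1 ≤ a / u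
        linarith
      simp [hw, this]
    · rw [Set.indicator_of_notMem hw]
      exact Set.indicator_nonneg (fun _ _ => zero_le_one) _
  have hg22 : ∀ w, |g2 w| ≤ 2 := fun w => (hg2 w).trans (by
    by_cases hw : w ∈ E <;> simp [hw])
  have hsplit : ∫ w, (q (v + w + Pi.single i 1) - q (v + w)) ∂τ =
      ∫ w, (g1 (w + Pi.single i 1) - g1 w) ∂τ + ∫ w, (g2 (w + Pi.single i 1) - g2 w) ∂τ := by
    rw [← integral_add]
    · refine integral_congr_ae (Filter.Eventually.of_forall fun w => ?_)
      simp only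
      rw [add_assoc v w, hg, hg]
      ring
    · exact (integrable_of_abs_le fun w => hg1 _).sub (integrable_of_abs_le hg1)
    · exact (integrable_of_abs_le fun w => hg22 _).sub (integrable_of_abs_le hg22)
  have h1 := abs_integral_shift_le (τ := τ) hg1 i
  have h2 : |∫ w, (g2 (w + Pi.single i 1) - g2 w) ∂τ| ≤ 4 * τ.real E := by
    have h3 : ∫ w, 4 * E.indicator (fun _ => (1 : ℝ)) w ∂τ = 4 * τ.real E := by
      rw [integral_const_mul, integral_indicator MeasurableSet.of_discrete]
      simp
    rw [← h3, ← Real.norm_eq_abs]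
    refine norm_integral_le_of_norm_le ?_ (Filter.Eventually.of_forall fun w => ?_)
    · refine integrable_of_abs_le (K := 4) fun w => ?_
      by_cases hw : w ∈ E <;> simp [hw]
    · rw [Real.norm_eq_abs]
      have h4 := abs_sub (g2 (w + Pi.single i 1)) (g2 w)
      linarith [hg2 w, hg2' w]
  have h5 : (tvShift τ i).toReal ≤ (⨆ i, tvShift τ i).toReal :=
    ENNReal.toReal_mono ((iSup_le fun i => tvShift_le_one i).trans_lt ENNReal.one_lt_top).ne
      (le_iSup (tvShift τ) i)
  rw [hsplit, smoothBound_toReal ha hu, ← hE]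
  have h6 := mul_le_mul_of_nonneg_left h5 (by positivity : 0 ≤ 2 * K)
  have h7 : (4 * u + 10) / a = 2 * K := by rw [hK]; ring
  rw [h7]
  have := abs_add_le (∫ w, (g1 (w + Pi.single i 1) - g1 w) ∂τ)
    (∫ w, (g2 (w + Pi.single i 1) - g2 w) ∂τ)
  linarith

theorem IsSmoothable.integrable {q : (ι → ℕ) → ℝ} (hq : IsSmoothable a q) (v : ι → ℕ) :
    Integrable (fun w => q (v + w)) τ := integrable_of_abs_le fun w => (hq (v + w)).1

theorem IsSmoothable.abs_integral_add_le (ha : 0 < a) (hu : 0 < u) {q : (ι → ℕ) → ℝ}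
    (hq : IsSmoothable a q) (v s : ι → ℕ) :
    |∫ w, (q (v + s + w) - q (v + w)) ∂τ| ≤ (smoothBound a u τ).toReal * tot s := by
  induction s using vec_induction with
  | zero => simp [tot_zero]
  | add s i ih =>
    have h1 := hq.abs_integral_le (τ := τ) ha hu (v + s) i
    have h2 : ∫ w, (q (v + (s + Pi.single i 1) + w) - q (v + w)) ∂τ =
        ∫ w, (q (v + s + w + Pi.single i 1) - q (v + s + w)) ∂τ +
          ∫ w, (q (v + s + w) - q (v + w)) ∂τ := by
      rw [← integral_add]
      · refine integral_congr_ae (Filter.Eventually.of_forall fun w => ?_)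
        simp only
        rw [← add_assoc v s, add_right_comm (v + s)]
        ring
      · refine Integrable.sub ?_ (hq.integrable _)
        exact integrable_of_abs_le fun w => (hq _).1
      · exact (hq.integrable _).sub (hq.integrable _)
    rw [h2, tot_add_single]
    push_cast
    have := abs_add_le (∫ w, (q (v + s + w + Pi.single i 1) - q (v + s + w)) ∂τ)
      (∫ w, (q (v + s + w) - q (v + w)) ∂τ)
    linarith

/-- First difference. -/
def fd (h : (ι → ℕ) → ℝ) (i : ι) (v : ι → ℕ) : ℝ := h (v + Pi.single i 1) - h v

/-- Second difference. -/
def sd (h : (ι → ℕ) → ℝ) (i j : ι) (v : ι → ℕ) : ℝ :=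
  h (v + Pi.single i 1 + Pi.single j 1) - h (v + Pi.single i 1) - h (v + Pi.single j 1) + h v

theorem sd_eq (h : (ι → ℕ) → ℝ) (i j : ι) (v : ι → ℕ) :
    sd h i j v = fd h j (v + Pi.single i 1) - fd h j v := by
  rw [sd, fd, fd]; ring

variable {h : (ι → ℕ) → ℝ} {C : ℝ}

theorem SteinBounds.isSmoothable_sd (H : SteinBounds a h C) (i j : ι) : IsSmoothable a (sd h i j) :=
  fun v => ⟨H.second_le_two v i j, H.second_le v i j⟩

/-- The factor 2 uses up the slack between the two kinds of bounds and is regained as `1 / 2` when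
types of second differences are exchanged. -/
theorem SteinBounds.isSmoothable_swap (H : SteinBounds a h C) (i j : ι) :
    IsSmoothable a fun v => 2 * (h (v + Pi.single i 1) - h (v + Pi.single j 1)) := fun v => by
  have h1 := H.swap_le_one v i j
  have h2 := H.swap_le v i j
  rw [abs_mul, abs_of_pos (zero_lt_two : (0 : ℝ) < 2)]
  refine ⟨by linarith, ?_⟩
  have h3 : 5 / a + 2 / ((tot v : ℝ) + 1) = 2 * (5 / 2 / a + 1 / ((tot v : ℝ) + 1)) := by ring
  linarith

/-- The types change one at a time: `i` to `o` in the presence of `j`, then `j` to `o` in the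
presence of `o`. Each change is a one-point shift of half a smoothable function, so the two together
cost one `smoothBound`. -/
theorem SteinBounds.abs_integral_sd_sub_le (H : SteinBounds a h C) (ha : 0 < a) (hu : 0 < u)
    (i j o : ι) :
    |∫ w, (sd h i j w - sd h o o w) ∂τ| ≤ (smoothBound a u τ).toReal := by
  have h1 := (H.isSmoothable_swap i o).abs_integral_le (τ := τ) ha hu 0 j
  have h2 := (H.isSmoothable_swap j o).abs_integral_le (τ := τ) ha hu 0 o
  simp only [zero_add] at h1 h2
  set f1 : (ι → ℕ) → ℝ := fun w =>
    2 * (h (w + Pi.single j 1 + Pi.single i 1) - h (w + Pi.single j 1 + Pi.single o 1)) -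
      2 * (h (w + Pi.single i 1) - h (w + Pi.single o 1)) with hf1
  set f2 : (ι → ℕ) → ℝ := fun w =>
    2 * (h (w + Pi.single o 1 + Pi.single j 1) - h (w + Pi.single o 1 + Pi.single o 1)) -
      2 * (h (w + Pi.single j 1) - h (w + Pi.single o 1)) with hf2
  have i1 : Integrable f1 τ :=
    (integrable_of_abs_le fun w => (H.isSmoothable_swap i o _).1).sub
      (integrable_of_abs_le fun w => (H.isSmoothable_swap i o _).1)
  have i2 : Integrable f2 τ :=
    (integrable_of_abs_le fun w => (H.isSmoothable_swap j o _).1).sub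
      (integrable_of_abs_le fun w => (H.isSmoothable_swap j o _).1)
  have h3 : ∫ w, (sd h i j w - sd h o o w) ∂τ = 1 / 2 * (∫ w, f1 w ∂τ + ∫ w, f2 w ∂τ) := by
    rw [← integral_add i1 i2, ← integral_const_mul]
    refine integral_congr_ae (Filter.Eventually.of_forall fun w => ?_)
    simp only [hf1, hf2, sd]
    rw [add_right_comm w (Pi.single j 1) (Pi.single i 1),
      add_right_comm w (Pi.single j 1) (Pi.single o 1)]
    ring
  rw [h3, abs_mul, abs_of_pos (by norm_num : (0 : ℝ) < 1 / 2)]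
  have := abs_add_le (∫ w, f1 w ∂τ) (∫ w, f2 w ∂τ)
  linarith

theorem SteinBounds.integrable_fd (H : SteinBounds a h C) (i : ι) (v : ι → ℕ) :
    Integrable (fun w => fd h i (v + w)) τ := integrable_of_abs_le fun w => H.incr (v + w) i

/-- Every pair of a point of `α` and a point of `s` contributes one mean third difference. -/
theorem SteinBounds.abs_integral_fd_mixed_le (H : SteinBounds a h C) (ha : 0 < a) (hu : 0 < u)
    (i : ι) (α s : ι → ℕ) :
    |∫ w, ((fd h i (α + s + w) - fd h i (s + w)) - (fd h i (α + w) - fd h i w)) ∂τ| ≤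
      (smoothBound a u τ).toReal * (tot α * tot s) := by
  have hi0 : Integrable (fd h i) τ := by simpa using H.integrable_fd (τ := τ) i 0
  induction α using vec_induction with
  | zero => simp [tot_zero]
  | add α j ih =>
    have h1 := (H.isSmoothable_sd j i).abs_integral_add_le (τ := τ) ha hu α s
    have h2 : ∫ w, ((fd h i (α + Pi.single j 1 + s + w) - fd h i (s + w)) -
        (fd h i (α + Pi.single j 1 + w) - fd h i w)) ∂τ =
        ∫ w, (sd h j i (α + s + w) - sd h j i (α + w)) ∂τ +
          ∫ w, ((fd h i (α + s + w) - fd h i (s + w)) - (fd h i (α + w) - fd h i w)) ∂τ := by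
      rw [← integral_add]
      · refine integral_congr_ae (Filter.Eventually.of_forall fun w => ?_)
        simp only [sd_eq]
        rw [add_right_comm α (Pi.single j 1) s, add_right_comm (α + s) (Pi.single j 1) w,
          add_right_comm α (Pi.single j 1) w]
        ring
      · exact ((H.isSmoothable_sd j i).integrable _).sub ((H.isSmoothable_sd j i).integrable _)
      · exact ((H.integrable_fd i _).sub (H.integrable_fd i _)).sub
          ((H.integrable_fd i _).sub hi0)
    rw [h2, tot_add_single]
    push_cast
    have := abs_add_le (∫ w, (sd h j i (α + s + w) - sd h j i (α + w)) ∂τ)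
      (∫ w, ((fd h i (α + s + w) - fd h i (s + w)) - (fd h i (α + w) - fd h i w)) ∂τ)
    linarith

/-- A point of `α` added after `l` others contributes `l` third differences to remove those others,
and one exchange of types; the sum of `l + 1` over `l < tot α` is the triangular number. -/
theorem SteinBounds.abs_integral_fd_sub_le (H : SteinBounds a h C) (ha : 0 < a) (hu : 0 < u)
    (i o : ι) (α : ι → ℕ) :
    |∫ w, (fd h i (α + w) - fd h i w - tot α * sd h o o w) ∂τ| ≤
      (smoothBound a u τ).toReal * ((tot α + 1) * tot α / 2) := by
  have hi0 : Integrable (fd h i) τ := by simpa using H.integrable_fd (τ := τ) i 0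
  have hs0 : ∀ j k, Integrable (sd h j k) τ := fun j k =>
    by simpa using (H.isSmoothable_sd j k).integrable (τ := τ) 0
  induction α using vec_induction with
  | zero => simp [tot_zero]
  | add α j ih =>
    have h1 := (H.isSmoothable_sd j i).abs_integral_add_le (τ := τ) ha hu 0 α
    have h2 := H.abs_integral_sd_sub_le (τ := τ) ha hu j i o
    simp only [zero_add] at h1
    have h3 : ∫ w, (fd h i (α + Pi.single j 1 + w) - fd h i w -
        tot (α + Pi.single j 1) * sd h o o w) ∂τ =
        ∫ w, (sd h j i (α + w) - sd h j i w) ∂τ + ∫ w, (sd h j i w - sd h o o w) ∂τ +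
          ∫ w, (fd h i (α + w) - fd h i w - tot α * sd h o o w) ∂τ := by
      rw [← integral_add, ← integral_add]
      · refine integral_congr_ae (Filter.Eventually.of_forall fun w => ?_)
        simp only [sd_eq _ j i, tot_add_single]
        rw [add_right_comm α (Pi.single j 1) w]
        push_cast
        ring
      · exact (((H.isSmoothable_sd j i).integrable _).sub (hs0 _ _)).add ((hs0 _ _).sub (hs0 _ _))
      · exact ((H.integrable_fd i _).sub hi0).sub ((hs0 _ _).const_mul _)
      · exact ((H.isSmoothable_sd j i).integrable _).sub (hs0 _ _)
      · exact (hs0 _ _).sub (hs0 _ _)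
    rw [h3, tot_add_single]
    push_cast
    have h4 := abs_add_le (∫ w, (sd h j i (α + w) - sd h j i w) ∂τ +
      ∫ w, (sd h j i w - sd h o o w) ∂τ) (∫ w, (fd h i (α + w) - fd h i w - tot α * sd h o o w) ∂τ)
    have h5 := abs_add_le (∫ w, (sd h j i (α + w) - sd h j i w) ∂τ)
      (∫ w, (sd h j i w - sd h o o w) ∂τ)
    have h6 : (smoothBound a u τ).toReal * (((tot α : ℝ) + 1 + 1) * (tot α + 1) / 2) =
        (smoothBound a u τ).toReal * tot α + (smoothBound a u τ).toReal +
        (smoothBound a u τ).toReal * ((tot α + 1) * tot α / 2) := by ring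
    linarith

end Smoothing

end BirthDeath

/-! ### Configurations -/

namespace Config

section Basic

variable {Γ : Type*} [MeasurableSpace Γ]

theorem measurable_apply {S : Set Γ} (hS : MeasurableSet S) :
    Measurable fun ξ : Config Γ => ξ.1 S :=
  (Measure.measurable_coe hS).comp measurable_subtype_coe

theorem measurable_count {S : Set Γ} (hS : MeasurableSet S) :
    Measurable fun ξ : Config Γ => Config.count ξ S :=
  Nat.measurable_floor.comp (ENNReal.measurable_toReal.comp (measurable_apply hS))

theorem measurable_of_apply {α : Type*} [MeasurableSpace α] {f : α → Config Γ}
    (hf : ∀ S, MeasurableSet S → Measurable fun x => (f x).1 S) : Measurable f :=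
  (Measure.measurable_of_measurable_coe _ hf).subtype_mk (h := fun x => (f x).2)

theorem measurable_restrict {S : Set Γ} (hS : MeasurableSet S) :
    Measurable fun ξ : Config Γ => Config.restrict ξ S := by
  refine measurable_of_apply fun T hT => ?_
  simp only [Config.restrict, Measure.restrict_apply hT]
  exact measurable_apply (hT.inter hS)

theorem restrict_apply (ξ : Config Γ) (S : Set Γ) {T : Set Γ} (hT : MeasurableSet T) :
    (Config.restrict ξ S).1 T = ξ.1 (T ∩ S) := Measure.restrict_apply hT

theorem count_restrict (ξ : Config Γ) (S : Set Γ) {T : Set Γ} (hT : MeasurableSet T) :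
    Config.count (Config.restrict ξ S) T = Config.count ξ (T ∩ S) := by
  rw [Config.count, Config.count, restrict_apply ξ S hT]

theorem restrict_restrict (ξ : Config Γ) {S T : Set Γ} (hS : MeasurableSet S) :
    Config.restrict (Config.restrict ξ T) S = Config.restrict ξ (S ∩ T) :=
  Subtype.ext (Measure.restrict_restrict hS)

theorem count_union (ξ : Config Γ) {S T : Set Γ} (hST : Disjoint S T) (hT : MeasurableSet T) :
    Config.count ξ (S ∪ T) = Config.count ξ S + Config.count ξ T := by
  have h := measure_union (μ := ξ.1) hST hT
  rw [← Config.coe_count, ← Config.coe_count, ← Config.coe_count] at h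
  exact_mod_cast h

theorem apply_ne_top (ξ : Config Γ) (S : Set Γ) : ξ.1 S ≠ ∞ := by
  rw [← Config.coe_count]; exact ENNReal.natCast_ne_top _

instance isFiniteMeasure (ξ : Config Γ) : IsFiniteMeasure ξ.1 :=
  ⟨(apply_ne_top ξ _).lt_top⟩

theorem ofCounts_apply {k : ℕ} (t : Fin k → Γ) (v : Fin k → ℕ) {S : Set Γ}
    (hS : MeasurableSet S) [DecidablePred (· ∈ S)] :
    (Config.ofCounts t v).1 S = ∑ i, if t i ∈ S then (v i : ℝ≥0∞) else 0 := by
  simp [Config.ofCounts, Set.indicator_apply, hS]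

end Basic

section Palm

variable {Γ : Type*} [MetricSpace Γ] [CompactSpace Γ] [MeasurableSpace Γ] [BorelSpace Γ]

/-- Around a non-atom the masses of shrinking balls tend to 0, and, being integers, vanish
eventually. The set of non-atoms is thus locally null, hence null. -/
theorem ae_apply_singleton_ne_zero (ξ : Config Γ) : ∀ᵐ x ∂ξ.1, ξ.1 {x} ≠ 0 := by
  rw [ae_iff]
  refine measure_null_of_locally_null _ fun x hx => ?_
  simp only [ne_eq, not_not, Set.mem_ofPred_eq] at hx
  have hlim : Filter.Tendsto (fun n : ℕ => ξ.1 (Metric.closedBall x (1 / ((n : ℝ) + 1))))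
      Filter.atTop (nhds (ξ.1 (⋂ n : ℕ, Metric.closedBall x (1 / ((n : ℝ) + 1))))) := by
    refine tendsto_measure_iInter_atTop (fun n => Metric.isClosed_closedBall.measurableSet.nullMeasurableSet)
      (fun m n hmn => Metric.closedBall_subset_closedBall ?_) ⟨0, apply_ne_top ξ _⟩
    gcongr
  have hinter : ⋂ n : ℕ, Metric.closedBall x (1 / ((n : ℝ) + 1)) = {x} := by
    ext y
    simp only [Set.mem_iInter, Metric.mem_closedBall, Set.mem_singleton_iff]
    constructor
    · intro h
      exact dist_le_zero.1 (ge_of_tendsto' tendsto_one_div_add_atTop_nhds_zero_nat h)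
    · rintro rfl n
      rw [dist_self]; positivity
  rw [hinter, hx] at hlim
  obtain ⟨n, hn⟩ := (hlim.eventually_lt_const (zero_lt_one)).exists
  refine ⟨Metric.closedBall x (1 / ((n : ℝ) + 1)),
    mem_nhdsWithin_of_mem_nhds (Metric.closedBall_mem_nhds x (by positivity)), ?_⟩
  rw [← Config.coe_count] at hn ⊢
  have : Config.count ξ (Metric.closedBall x (1 / ((n : ℝ) + 1))) < 1 := by exact_mod_cast hn
  rw [Nat.lt_one_iff.1 this, Nat.cast_zero]

theorem removePoint_apply (ξ : Config Γ) {x : Γ} (hx : ξ.1 {x} ≠ 0) {S : Set Γ}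
    (hS : MeasurableSet S) [Decidable (x ∈ S)] :
    (Config.removePoint ξ x).1 S + (if x ∈ S then 1 else 0) = ξ.1 S := by
  have hle : Measure.dirac x ≤ ξ.1 := by
    refine Measure.le_iff.2 fun T hT => ?_
    by_cases hxT : x ∈ T
    · rw [Measure.dirac_apply_of_mem hxT]
      refine le_trans ?_ (measure_mono (Set.singleton_subset_iff.2 hxT))
      rw [← Config.coe_count] at hx ⊢
      exact_mod_cast Nat.one_le_iff_ne_zero.2 (by exact_mod_cast hx)
    · simp [hxT, hT]
  have h1 : (Config.removePoint ξ x).1 S = ξ.1 S - Measure.dirac x S := Measure.sub_apply hS hle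
  have h2 : Measure.dirac x S = if x ∈ S then (1 : ℝ≥0∞) else 0 := by
    rw [Measure.dirac_apply' x hS, Set.indicator_apply]; rfl
  rw [h1, h2]
  refine tsub_add_cancel_of_le ?_
  rw [← h2]
  exact hle S

end Palm

end Config

namespace BirthDeath

variable {ι : Type*} [Fintype ι] [DecidableEq ι]

/-! ### Counts of points in the cells of a partition -/

section Cells

variable {Γ : Type*} [MeasurableSpace Γ] [MeasurableSpace ι] [DiscreteMeasurableSpace ι]
  {κ : Γ → ι}

/-- Numbers of points of a configuration in the cells `κ ⁻¹' {i}`. -/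
def cellCounts (κ : Γ → ι) (ξ : Config Γ) : ι → ℕ := fun i => Config.count ξ (κ ⁻¹' {i})

theorem measurableSet_cell (hκ : Measurable κ) (i : ι) : MeasurableSet (κ ⁻¹' {i}) :=
  hκ MeasurableSet.of_discrete

theorem measurable_cellCounts (hκ : Measurable κ) :
    Measurable (cellCounts κ : Config Γ → ι → ℕ) :=
  measurable_pi_lambda _ fun i => Config.measurable_count (measurableSet_cell hκ i)

theorem coe_cellCounts (ξ : Config Γ) (i : ι) :
    (cellCounts κ ξ i : ℝ≥0∞) = ξ.1 (κ ⁻¹' {i}) := Config.coe_count _ _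

theorem cast_inj_of_ennreal {v w : ι → ℕ} (h : ∀ i, (v i : ℝ≥0∞) = w i) : v = w :=
  funext fun i => by exact_mod_cast h i

theorem coe_tot_cellCounts (hκ : Measurable κ) (ξ : Config Γ) :
    (tot (cellCounts κ ξ) : ℝ≥0∞) = ξ.1 Set.univ := by
  rw [tot, Nat.cast_sum]
  simp only [coe_cellCounts]
  rw [← measure_biUnion_finset]
  · congr 1
    ext x; simp
  · intro i _ j _ hij
    exact Disjoint.preimage κ (Set.disjoint_singleton.2 hij)
  · intro i _; exact measurableSet_cell hκ i

theorem cellCounts_restrict_union (hκ : Measurable κ) (ξ : Config Γ) {S T : Set Γ}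
    (hST : Disjoint S T) (hT : MeasurableSet T) :
    cellCounts κ (Config.restrict ξ (S ∪ T)) =
      cellCounts κ (Config.restrict ξ S) + cellCounts κ (Config.restrict ξ T) := by
  funext i
  have hi := measurableSet_cell hκ i
  simp only [cellCounts, Pi.add_apply, Config.count_restrict _ _ hi]
  rw [Set.inter_union_distrib_left,
    Config.count_union _ (hST.mono Set.inter_subset_right Set.inter_subset_right) (hi.inter hT)]

theorem cellCounts_restrict_univ (ξ : Config Γ) :
    cellCounts κ (Config.restrict ξ Set.univ) = cellCounts κ ξ := by
  rw [show Config.restrict ξ Set.univ = ξ from Subtype.ext Measure.restrict_univ]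

theorem cellCounts_restrict_add_compl (hκ : Measurable κ) (ξ : Config Γ) {S : Set Γ}
    (hS : MeasurableSet S) :
    cellCounts κ (Config.restrict ξ S) + cellCounts κ (Config.restrict ξ Sᶜ) = cellCounts κ ξ := by
  rw [← cellCounts_restrict_union hκ ξ disjoint_compl_right hS.compl, Set.union_compl_self,
    cellCounts_restrict_univ]

theorem coe_tot_cellCounts_restrict (hκ : Measurable κ) (ξ : Config Γ) (S : Set Γ) :
    (tot (cellCounts κ (Config.restrict ξ S)) : ℝ≥0∞) = ξ.1 S := by
  rw [coe_tot_cellCounts hκ, Config.restrict_apply _ _ MeasurableSet.univ, Set.univ_inter]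

theorem tot_cellCounts_restrict (hκ : Measurable κ) (ξ : Config Γ) (S : Set Γ) :
    tot (cellCounts κ (Config.restrict ξ S)) = Config.count ξ S := by
  have := coe_tot_cellCounts_restrict hκ ξ S
  rw [← Config.coe_count] at this
  exact_mod_cast this

theorem lintegral_cell (hκ : Measurable κ) (ξ : Config Γ) (g : ι → ℝ≥0∞) :
    ∫⁻ x, g (κ x) ∂ξ.1 = ∑ i, cellCounts κ ξ i * g i := by
  rw [← lintegral_map (f := g) Measurable.of_discrete hκ, lintegral_fintype]
  refine Finset.sum_congr rfl fun i _ => ?_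
  rw [Measure.map_apply hκ MeasurableSet.of_discrete, coe_cellCounts, mul_comm]

theorem cellCounts_ofPoints (hκ : Measurable κ) {n : ℕ} (x : Fin n → Γ) :
    cellCounts κ (Config.ofPoints x) = ∑ j, Pi.single (κ (x j)) 1 := by
  classical
  refine cast_inj_of_ennreal fun i => ?_
  rw [coe_cellCounts, Config.ofPoints, Config.ofCounts_apply _ _ (measurableSet_cell hκ i),
    Finset.sum_apply]
  push_cast
  refine Finset.sum_congr rfl fun j _ => ?_
  simp only [Set.mem_preimage, Set.mem_singleton_iff, Pi.single_apply, eq_comm (a := i)]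
  split_ifs <;> simp

end Cells

section Palm

variable {Γ : Type*} [MetricSpace Γ] [CompactSpace Γ] [MeasurableSpace Γ] [BorelSpace Γ]
  [MeasurableSpace ι] [DiscreteMeasurableSpace ι] {κ : Γ → ι}

theorem cellCounts_removePoint (hκ : Measurable κ) (ξ : Config Γ) {x : Γ} (hx : ξ.1 {x} ≠ 0) :
    cellCounts κ (Config.removePoint ξ x) + Pi.single (κ x) 1 = cellCounts κ ξ := by
  classical
  refine cast_inj_of_ennreal fun i => ?_
  rw [coe_cellCounts, ← Config.removePoint_apply ξ hx (measurableSet_cell hκ i), Pi.add_apply,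
    Nat.cast_add, coe_cellCounts]
  congr 1
  simp only [Set.mem_preimage, Set.mem_singleton_iff, Pi.single_apply, eq_comm (a := i)]
  split_ifs <;> simp

end Palm

variable {ι : Type*} [Fintype ι] [DecidableEq ι]

/-! ### The distance between configurations -/

section Distance

variable {Γ : Type*} [MeasurableSpace Γ]

/-- The configuration with `v i` points at `loc i`. -/
def placeAt (loc : ι → Γ) (v : ι → ℕ) : Config Γ :=
  ⟨∑ i, v i • Measure.dirac (loc i), fun S hS => by
    classical
    refine ⟨∑ i, v i * (if loc i ∈ S then 1 else 0), ?_⟩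
    simp [Set.indicator_apply, hS]⟩

theorem placeAt_apply (loc : ι → Γ) (v : ι → ℕ) {S : Set Γ} (hS : MeasurableSet S)
    [DecidablePred (· ∈ S)] :
    (placeAt loc v).1 S = ∑ i, if loc i ∈ S then (v i : ℝ≥0∞) else 0 := by
  simp [placeAt, Set.indicator_apply, hS]

theorem placeAt_univ (loc : ι → Γ) (v : ι → ℕ) : (placeAt loc v).1 Set.univ = tot v := by
  classical
  rw [placeAt_apply loc v MeasurableSet.univ]
  simp [tot]

theorem placeAt_add_single (loc : ι → Γ) (v : ι → ℕ) (i : ι) :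
    (placeAt loc (v + Pi.single i 1)).1 = (placeAt loc v).1 + Measure.dirac (loc i) := by
  simp only [placeAt, Pi.add_apply, add_smul, Finset.sum_add_distrib]
  congr 1
  rw [Finset.sum_eq_single i]
  · simp
  · intro j _ hj; simp [hj]
  · simp

variable [MeasurableSpace ι] [DiscreteMeasurableSpace ι] {κ : Γ → ι} {loc : ι → Γ}

theorem map_eq_placeAt (hκ : Measurable κ) (ξ : Config Γ) :
    ξ.1.map (fun x => loc (κ x)) = (placeAt loc (cellCounts κ ξ)).1 := by
  classical
  have hm : Measurable fun x => loc (κ x) := (Measurable.of_discrete (f := loc)).comp hκ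
  ext S hS
  rw [Measure.map_apply hm hS, placeAt_apply _ _ hS]
  have h := lintegral_cell hκ ξ fun i => if loc i ∈ S then 1 else 0
  have h2 : ∫⁻ x, (if loc (κ x) ∈ S then 1 else 0) ∂ξ.1 =
      ∫⁻ x, ((fun x => loc (κ x)) ⁻¹' S).indicator 1 x ∂ξ.1 :=
    lintegral_congr fun x => by simp [Set.indicator_apply]
  rw [h2, lintegral_indicator_one (hm hS)] at h
  rw [h]
  exact Finset.sum_congr rfl fun i _ => by split_ifs <;> simp

end Distance

section Lipschitz

variable {Γ : Type*} [MetricSpace Γ] [CompactSpace Γ] [MeasurableSpace Γ] [BorelSpace Γ]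

theorem continuous_of_abs_sub_le {f : Γ → ℝ} (hf : ∀ x y, |f x - f y| ≤ dist x y) : Continuous f :=
  (LipschitzWith.of_dist_le_mul (K := 1) fun x y => by
    simpa [Real.dist_eq] using hf x y).continuous

theorem integrable_of_abs_sub_le {f : Γ → ℝ} (hf : ∀ x y, |f x - f y| ≤ dist x y) (ξ : Config Γ) :
    Integrable f ξ.1 := by
  obtain ⟨K, hK⟩ := (isCompact_range (continuous_of_abs_sub_le hf)).isBounded.exists_norm_le
  exact Integrable.of_bound (continuous_of_abs_sub_le hf).aestronglyMeasurable K
    (Filter.Eventually.of_forall fun x => hK _ ⟨x, rfl⟩)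

theorem d1_le_of_forall {ξ η : Config Γ} (h : ξ.1 Set.univ = η.1 Set.univ) {K : ℝ} (hK : 0 ≤ K)
    (hle : ∀ f : Γ → ℝ, (∀ x y, |f x - f y| ≤ dist x y) →
      |∫ x, f x ∂ξ.1 - ∫ x, f x ∂η.1| ≤ K * (ξ.1 Set.univ).toReal) : d1 ξ η ≤ K := by
  rw [d1, if_pos h]
  split_ifs with h0
  · exact hK
  · have hpos : 0 < (ξ.1 Set.univ).toReal := ENNReal.toReal_pos h0 (Config.apply_ne_top ξ _)
    rw [inv_mul_le_iff₀ hpos, mul_comm]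
    exact Real.iSup_le (fun f => hle f.1 f.2) (by positivity)

theorem d1_le_one (hdist : ∀ x y : Γ, dist x y ≤ 1) (ξ η : Config Γ) : d1 ξ η ≤ 1 := by
  by_cases h : ξ.1 Set.univ = η.1 Set.univ
  · refine d1_le_of_forall h zero_le_one fun f hf => ?_
    rcases isEmpty_or_nonempty Γ with hΓ | hΓ
    · simp [Measure.eq_zero_of_isEmpty]
    obtain ⟨x₀, -, hx₀⟩ := isCompact_univ.exists_isMinOn Set.univ_nonempty
      (continuous_of_abs_sub_le hf).continuousOn
    have hlow : ∀ x, f x₀ ≤ f x := fun x => hx₀ (Set.mem_univ x)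
    have hup : ∀ x, f x ≤ f x₀ + 1 := fun x => by
      have := (abs_le.1 ((hf x x₀).trans (hdist x x₀))).2
      linarith
    have key : ∀ ζ : Config Γ, f x₀ * (ζ.1 Set.univ).toReal ≤ ∫ x, f x ∂ζ.1 ∧
        ∫ x, f x ∂ζ.1 ≤ (f x₀ + 1) * (ζ.1 Set.univ).toReal := fun ζ => by
      have h1 := integral_mono (μ := ζ.1) (integrable_const (f x₀)) (integrable_of_abs_sub_le hf ζ)
        hlow
      have h2 := integral_mono (μ := ζ.1) (integrable_of_abs_sub_le hf ζ)
        (integrable_const (f x₀ + 1)) hup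
      rw [integral_const, smul_eq_mul, measureReal_def, mul_comm] at h1 h2
      exact ⟨h1, h2⟩
    have h1 := key ξ
    have h2 := key η
    rw [← h] at h2
    exact abs_le.2 ⟨by linarith [h1.1, h2.2], by linarith [h1.2, h2.1]⟩
  · rw [d1, if_neg h]

variable {loc : ι → Γ}

/-- The common points cancel, one pair of points at distance at most 1 remains, and `d1` divides by
the total number. -/
theorem d1_placeAt_swap_le (hdist : ∀ x y : Γ, dist x y ≤ 1) (v : ι → ℕ) (i j : ι) :
    d1 (placeAt loc (v + Pi.single i 1)) (placeAt loc (v + Pi.single j 1)) ≤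
      1 / ((tot v : ℝ) + 1) := by
  refine d1_le_of_forall ?_ (by positivity) fun f hf => ?_
  · rw [placeAt_univ, placeAt_univ, tot_add_single, tot_add_single]
  · have hinteg : ∀ l, ∫ x, f x ∂(placeAt loc (v + Pi.single l 1)).1 =
        ∫ x, f x ∂(placeAt loc v).1 + f (loc l) := fun l => by
      rw [placeAt_add_single, integral_add_measure (integrable_of_abs_sub_le hf _), integral_dirac]
      exact (integrable_dirac (by simp))
    rw [hinteg, hinteg, placeAt_univ, tot_add_single]
    have h1 : (1 / ((tot v : ℝ) + 1)) * ((tot v + 1 : ℕ) : ℝ≥0∞).toReal = 1 := by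
      rw [ENNReal.toReal_natCast]; push_cast; field_simp
    rw [h1, add_sub_add_left_eq_sub]
    exact (hf _ _).trans (hdist _ _)

variable [MeasurableSpace ι] [DiscreteMeasurableSpace ι] {κ : Γ → ι}

theorem d1_placeAt_cellCounts_le (hκ : Measurable κ) {ε : ℝ} (hε : 0 ≤ ε)
    (hloc : ∀ x, dist x (loc (κ x)) ≤ ε) (ξ : Config Γ) :
    d1 ξ (placeAt loc (cellCounts κ ξ)) ≤ ε := by
  have hm : Measurable fun x => loc (κ x) := (Measurable.of_discrete (f := loc)).comp hκ
  refine d1_le_of_forall ?_ hε fun f hf => ?_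
  · rw [placeAt_univ, coe_tot_cellCounts hκ]
  · have hc := continuous_of_abs_sub_le hf
    have hinteg : Integrable (fun x => f (loc (κ x))) ξ.1 := by
      obtain ⟨K, hK⟩ := (isCompact_range hc).isBounded.exists_norm_le
      exact Integrable.of_bound (hc.measurable.comp hm).aestronglyMeasurable K
        (Filter.Eventually.of_forall fun x => hK _ ⟨_, rfl⟩)
    rw [← map_eq_placeAt hκ, integral_map hm.aemeasurable hc.aestronglyMeasurable,
      ← integral_sub (integrable_of_abs_sub_le hf ξ) hinteg, ← Real.norm_eq_abs]
    refine (norm_integral_le_of_norm_le_const (C := ε) (Filter.Eventually.of_forall fun x => ?_))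
    exact (hf _ _).trans (hloc x)

end Lipschitz

/-! ### Measurability of Lipschitz functionals of configurations -/

section Measurability

variable {Γ : Type*} [MetricSpace Γ] [CompactSpace Γ] [MeasurableSpace Γ] [BorelSpace Γ]

theorem exists_simpleFunc_dist_le [Nonempty Γ] {ε : ℝ} (hε : 0 < ε) :
    ∃ φ : SimpleFunc Γ Γ, ∀ x, dist x (φ x) ≤ ε := by
  obtain ⟨s, hs⟩ := isCompact_univ.elim_finite_subcover
    (fun n : ℕ => Metric.ball (TopologicalSpace.denseSeq Γ n) ε) (fun n => Metric.isOpen_ball)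
    (fun x _ => by
      obtain ⟨n, hn⟩ := (TopologicalSpace.denseRange_denseSeq Γ).exists_dist_lt x hε
      exact Set.mem_iUnion.2 ⟨n, hn⟩)
  refine ⟨SimpleFunc.nearestPt (TopologicalSpace.denseSeq Γ) (s.sup id), fun x => ?_⟩
  obtain ⟨n, hn, hx⟩ := Set.mem_iUnion₂.1 (hs (Set.mem_univ x))
  have h1 := SimpleFunc.edist_nearestPt_le (TopologicalSpace.denseSeq Γ) x
    (Finset.le_sup (f := id) hn)
  rw [edist_dist, edist_dist, ENNReal.ofReal_le_ofReal_iff dist_nonneg] at h1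
  rw [dist_comm]
  refine h1.trans ?_
  rw [dist_comm]
  exact (Metric.mem_ball.1 hx).le

/-- On finer and finer finite partitions `f` is the limit of functions of count vectors, and these
range over a countable discrete space. -/
theorem measurable_of_abs_sub_le_d1 [Nonempty Γ] {f : Config Γ → ℝ}
    (hf : ∀ ξ η, |f ξ - f η| ≤ d1 ξ η) : Measurable f := by
  classical
  choose φ hφ using fun n : ℕ => exists_simpleFunc_dist_le (Γ := Γ) (ε := 1 / ((n : ℝ) + 1))
    (by positivity)
  let κ : ∀ n, Γ → (φ n).range := fun n x => ⟨φ n x, (φ n).mem_range_self x⟩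
  have hκ : ∀ n, Measurable (κ n) := fun n => (φ n).measurable.subtype_mk
  let g : ℕ → Config Γ → ℝ := fun n ξ => f (placeAt Subtype.val (cellCounts (κ n) ξ))
  have hg : ∀ n, Measurable (g n) := fun n =>
    (Measurable.of_discrete (f := fun v : (φ n).range → ℕ => f (placeAt Subtype.val v))).comp
      (measurable_cellCounts (hκ n))
  refine measurable_of_tendsto_metrizable hg (tendsto_pi_nhds.2 fun ξ => ?_)
  rw [tendsto_iff_dist_tendsto_zero]
  refine squeeze_zero (fun n => dist_nonneg) (fun n => ?_) tendsto_one_div_add_atTop_nhds_zero_nat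
  rw [dist_comm, Real.dist_eq]
  exact (hf _ _).trans (d1_placeAt_cellCounts_le (hκ n) (by positivity) (hφ n) ξ)

end Measurability

variable {ι : Type*} [Fintype ι] [DecidableEq ι]

/-! ### The Stein identity of the birth-death point process -/

/-- Mean of `q` after adding one random point with law `p`. -/
def shiftMean (p : ι → ℝ) (q : (ι → ℕ) → ℝ) (v : ι → ℕ) : ℝ := ∑ i, p i * q (v + Pi.single i 1)

theorem iterate_shiftMean_add (p : ι → ℝ) (q r : (ι → ℕ) → ℝ) (n : ℕ) :
    (shiftMean p)^[n] (q + r) = (shiftMean p)^[n] q + (shiftMean p)^[n] r := by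
  induction n with
  | zero => rfl
  | succ n ih =>
    simp only [Function.iterate_succ', Function.comp_apply, ih]
    funext v
    simp only [shiftMean, Pi.add_apply, mul_add, Finset.sum_add_distrib]

theorem iterate_shiftMean_mul_tot (p : ι → ℝ) (ψ : ℕ → ℝ) (q : (ι → ℕ) → ℝ) (n : ℕ) (v : ι → ℕ) :
    (shiftMean p)^[n] (fun w => ψ (tot w) * q w) v = ψ (tot v + n) * (shiftMean p)^[n] q v := by
  induction n generalizing v with
  | zero => rfl
  | succ n ih =>
    simp only [Function.iterate_succ', Function.comp_apply, shiftMean, Finset.mul_sum]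
    refine Finset.sum_congr rfl fun i _ => ?_
    rw [ih, tot_add_single, show tot v + 1 + n = tot v + (n + 1) by ring]
    ring

theorem shiftMean_sub_const {p : ι → ℝ} (hp1 : ∑ i, p i = 1) (q : (ι → ℕ) → ℝ) (c : ℝ) :
    shiftMean p (fun v => q v - c) = fun v => shiftMean p q v - c := by
  funext v
  simp only [shiftMean, mul_sub, Finset.sum_sub_distrib, ← Finset.sum_mul, hp1, one_mul]

theorem iterate_shiftMean_sub_const {p : ι → ℝ} (hp1 : ∑ i, p i = 1) (q : (ι → ℕ) → ℝ) (c : ℝ)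
    (n : ℕ) (v : ι → ℕ) :
    (shiftMean p)^[n] (fun v => q v - c) v = (shiftMean p)^[n] q v - c := by
  induction n generalizing q with
  | zero => rfl
  | succ n ih => rw [Function.iterate_succ_apply, shiftMean_sub_const hp1, ih,
      Function.iterate_succ_apply]

theorem birth_eq_shiftMean {p : ι → ℝ} (hp1 : ∑ i, p i = 1) (q : (ι → ℕ) → ℝ) (v : ι → ℕ) :
    birth p q v = shiftMean p q v - q v := by
  simp only [birth, shiftMean, mul_sub, Finset.sum_sub_distrib, ← Finset.sum_mul, hp1, one_mul]

theorem shiftMean_death {p : ι → ℝ} (q : (ι → ℕ) → ℝ) (v : ι → ℕ) :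
    shiftMean p (death q) v = death (shiftMean p q) v + ∑ i, p i * (q v - q (v + Pi.single i 1)) := by
  simp only [shiftMean, death_add_single, mul_add, Finset.sum_add_distrib]
  congr 1
  simp only [death, shiftMean, Finset.mul_sum, ← Finset.sum_sub_distrib]
  rw [Finset.sum_comm]
  exact Finset.sum_congr rfl fun i _ => Finset.sum_congr rfl fun j _ => by ring

/-- The commutator of `death` with `shiftMean p` is the identity minus `shiftMean p`: the added
point may itself die. Iterating gives the factor `n`, which also hides the truncated `n - 1` at `n =
0`. -/
theorem iterate_shiftMean_death {p : ι → ℝ} (hp1 : ∑ i, p i = 1) (q : (ι → ℕ) → ℝ) (n : ℕ) :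
    (shiftMean p)^[n] (death q) = death ((shiftMean p)^[n] q) + fun v =>
      (n : ℝ) * ((shiftMean p)^[n - 1] q v - (shiftMean p)^[n] q v) := by
  induction n generalizing q with
  | zero => funext v; simp
  | succ n ih =>
    have h1 : shiftMean p (death q) = death (shiftMean p q) + (fun v => q v - shiftMean p q v) := by
      funext v
      rw [shiftMean_death, Pi.add_apply, show q v - shiftMean p q v = -birth p q v by
        rw [birth_eq_shiftMean hp1]; ring, birth, ← Finset.sum_neg_distrib]
      congr 1
      exact Finset.sum_congr rfl fun i _ => by ring
    have h2 : (fun v => q v - shiftMean p q v) = q + (fun v => -1 * shiftMean p q v) := by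
      funext v; simp [sub_eq_add_neg]
    rw [Function.iterate_succ_apply, h1, iterate_shiftMean_add, ih, h2, iterate_shiftMean_add]
    funext v
    have h3 := iterate_shiftMean_mul_tot p (fun _ => -1) (shiftMean p q) n v
    simp only [Pi.add_apply, h3]
    rcases n with _ | n
    · simp; ring
    · simp only [Nat.add_sub_cancel, ← Function.iterate_succ_apply]
      push_cast
      ring

theorem death_zero (q : (ι → ℕ) → ℝ) : death q 0 = 0 := by simp [death]

/-- Averaged over `n` independent points, the generator becomes that of the one-dimensional
birth-death process acting on `n ↦ (shiftMean p)^[n] h 0`. -/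
theorem iterate_shiftMean_gen {p : ι → ℝ} (hp1 : ∑ i, p i = 1) (β : ℕ → ℝ) (h : (ι → ℕ) → ℝ)
    (n : ℕ) :
    (shiftMean p)^[n] (gen p β h) 0 =
      β n * ((shiftMean p)^[n + 1] h 0 - (shiftMean p)^[n] h 0) +
        n * ((shiftMean p)^[n - 1] h 0 - (shiftMean p)^[n] h 0) := by
  have h1 : gen p β h = (fun v => β (tot v) * birth p h v) + death h := rfl
  have h2 : birth p h = shiftMean p h + (fun v => -1 * h v) := by
    funext v; rw [birth_eq_shiftMean hp1]; simp [sub_eq_add_neg]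
  have h3 := iterate_shiftMean_mul_tot p (fun _ => -1) h n 0
  rw [h1, iterate_shiftMean_add, Pi.add_apply, iterate_shiftMean_mul_tot, h2,
    iterate_shiftMean_add, iterate_shiftMean_death hp1]
  simp only [Pi.add_apply, h3, death_zero, tot_zero, zero_add, ← Function.iterate_succ_apply]
  ring

theorem abs_shiftMean_le {p : ι → ℝ} (hp : ∀ i, 0 ≤ p i) (hp1 : ∑ i, p i = 1)
    {q : (ι → ℕ) → ℝ} {K : ℝ} (hq : ∀ v, |q v| ≤ K) (v : ι → ℕ) : |shiftMean p q v| ≤ K := by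
  refine (Finset.abs_sum_le_sum_abs _ _).trans ?_
  calc ∑ i, |p i * q (v + Pi.single i 1)| ≤ ∑ i, p i * K :=
        Finset.sum_le_sum fun i _ => by
          rw [abs_mul, abs_of_nonneg (hp i)]
          exact mul_le_mul_of_nonneg_left (hq _) (hp i)
    _ = K := by rw [← Finset.sum_mul, hp1, one_mul]

theorem abs_iterate_shiftMean_le {p : ι → ℝ} (hp : ∀ i, 0 ≤ p i) (hp1 : ∑ i, p i = 1)
    {q : (ι → ℕ) → ℝ} {K : ℝ} (hq : ∀ v, |q v| ≤ K) (n : ℕ) (v : ι → ℕ) :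
    |(shiftMean p)^[n] q v| ≤ K := by
  induction n generalizing q with
  | zero => exact hq v
  | succ n ih => exact ih fun w => abs_shiftMean_le hp hp1 hq w

theorem abs_iterate_succ_sub_le {p : ι → ℝ} (hp : ∀ i, 0 ≤ p i) (hp1 : ∑ i, p i = 1)
    {h : (ι → ℕ) → ℝ} {C : ℝ} (hC : ∀ v i, |h (v + Pi.single i 1) - h v| ≤ C) (n : ℕ) :
    |(shiftMean p)^[n + 1] h 0 - (shiftMean p)^[n] h 0| ≤ C := by
  have h2 : birth p h = shiftMean p h + (fun v => -1 * h v) := by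
    funext v; rw [birth_eq_shiftMean hp1]; simp [sub_eq_add_neg]
  have h3 := iterate_shiftMean_mul_tot p (fun _ => -1) h n 0
  have h4 : (shiftMean p)^[n + 1] h 0 - (shiftMean p)^[n] h 0 = (shiftMean p)^[n] (birth p h) 0 := by
    rw [h2, iterate_shiftMean_add, Pi.add_apply, h3, Function.iterate_succ_apply]; ring
  rw [h4]
  refine abs_iterate_shiftMean_le hp hp1 (fun v => ?_) n 0
  refine (Finset.abs_sum_le_sum_abs _ _).trans ?_
  calc ∑ i, |p i * (h (v + Pi.single i 1) - h v)| ≤ ∑ i, p i * C :=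
        Finset.sum_le_sum fun i _ => by
          rw [abs_mul, abs_of_nonneg (hp i)]
          exact mul_le_mul_of_nonneg_left (hC _ _) (hp i)
    _ = C := by rw [← Finset.sum_mul, hp1, one_mul]

theorem tendsto_birthRate_mul_pbdWeight {a b : ℝ} (ha : 0 < a) (hb : 0 ≤ b) (hb1 : b < 1) :
    Filter.Tendsto (fun n => birthRate a b n * pbdWeight a b 0 n) Filter.atTop (nhds 0) := by
  refine Summable.tendsto_atTop_zero ?_
  refine summable_of_ratio_norm_eventually_le (r := (1 + b) / 2) (by linarith) ?_
  obtain ⟨N, hN⟩ := exists_nat_ge (2 * a / (1 - b))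
  filter_upwards [Filter.eventually_ge_atTop N] with n hn
  have hw := mul_pos (birthRate_pos ha hb n) (pbdWeight_pos ha hb le_rfl n)
  have hw' := mul_pos (birthRate_pos ha hb (n + 1)) (pbdWeight_pos ha hb le_rfl (n + 1))
  rw [Real.norm_of_nonneg hw.le, Real.norm_of_nonneg hw'.le, pbdWeight_succ]
  have h2 : 2 * a / (1 - b) ≤ n := hN.trans (by exact_mod_cast hn)
  rw [div_le_iff₀ (by linarith)] at h2
  have h3 : birthRate a b (n + 1) / deathRate 0 (n + 1) ≤ (1 + b) / 2 := by
    rw [div_le_iff₀ (deathRate_succ_pos le_rfl n)]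
    simp only [birthRate, deathRate]
    push_cast
    nlinarith
  calc birthRate a b (n + 1) * (pbdWeight a b 0 n * (birthRate a b n / deathRate 0 (n + 1)))
      = birthRate a b (n + 1) / deathRate 0 (n + 1) * (birthRate a b n * pbdWeight a b 0 n) := by
        ring
    _ ≤ _ := mul_le_mul_of_nonneg_right h3 hw.le

/-- By detailed balance the partial sums collapse to one boundary term, a flow times an increment of
`H`; increments are bounded and the flow tends to 0. -/
theorem tsum_pbdWeight_mul_eq_zero {a b : ℝ} (ha : 0 < a) (hb : 0 ≤ b) (hb1 : b < 1)
    {H L : ℕ → ℝ} {C K : ℝ} (hC : ∀ n, |H (n + 1) - H n| ≤ C)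
    (hL : ∀ n, L n = (a + b * n) * (H (n + 1) - H n) + n * (H (n - 1) - H n))
    (hK : ∀ n, |L n| ≤ K) :
    ∑' n, pbdWeight a b 0 n * L n = 0 := by
  have hsum : Summable fun n => pbdWeight a b 0 n * L n := by
    refine Summable.of_norm_bounded ((summable_pbdWeight ha hb hb1 le_rfl).mul_right K) fun n => ?_
    rw [Real.norm_eq_abs, abs_mul, abs_of_pos (pbdWeight_pos ha hb le_rfl n)]
    exact mul_le_mul_of_nonneg_left (hK n) (pbdWeight_pos ha hb le_rfl n).le
  have hpart : ∀ n, ∑ i ∈ Finset.range (n + 1), pbdWeight a b 0 i * L i =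
      birthRate a b n * pbdWeight a b 0 n * (H (n + 1) - H n) := by
    intro n
    induction n with
    | zero => simp [hL, birthRate]; ring
    | succ n ih =>
      rw [Finset.sum_range_succ, ih, hL, Nat.add_sub_cancel]
      have hd := (deathRate_succ_pos (le_refl (0 : ℝ)) n).ne'
      have h1 : birthRate a b n * pbdWeight a b 0 n = ((n : ℝ) + 1) * pbdWeight a b 0 (n + 1) := by
        rw [pbdWeight_succ]
        have : deathRate 0 (n + 1) = (n : ℝ) + 1 := by simp [deathRate]
        rw [this] at hd ⊢
        field_simp
      rw [h1, birthRate]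
      push_cast
      ring
  have h1 := (Filter.tendsto_add_atTop_iff_nat 1).2 hsum.hasSum.tendsto_sum_nat
  refine tendsto_nhds_unique h1 ?_
  refine squeeze_zero_norm (a := fun n => birthRate a b n * pbdWeight a b 0 n * C) (fun n => ?_) ?_
  · have hw := mul_pos (birthRate_pos ha hb n) (pbdWeight_pos ha hb le_rfl n)
    rw [hpart, Real.norm_eq_abs, abs_mul, abs_of_pos hw]
    exact mul_le_mul_of_nonneg_left (hC n) hw.le
  · simpa using (tendsto_birthRate_mul_pbdWeight ha hb hb1).mul_const C

/-! ### Integration over the birth-death point process -/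

section PointProcess

variable {Γ : Type*} [MeasurableSpace Γ] [MeasurableSpace ι] [DiscreteMeasurableSpace ι]
  {κ : Γ → ι} {ν : Measure Γ}

theorem measurable_ofPoints (n : ℕ) : Measurable (Config.ofPoints : (Fin n → Γ) → Config Γ) := by
  classical
  refine Config.measurable_of_apply fun S hS => ?_
  simp only [Config.ofPoints, Config.ofCounts_apply _ _ hS]
  refine Finset.measurable_sum _ fun i _ => ?_
  exact Measurable.ite ((measurable_pi_apply i) hS) measurable_const measurable_const

theorem integral_cell (hκ : Measurable κ) [IsFiniteMeasure ν] (g : ι → ℝ) :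
    ∫ x, g (κ x) ∂ν = ∑ i, ν.real (κ ⁻¹' {i}) * g i := by
  rw [← integral_map (f := g) hκ.aemeasurable (Measurable.of_discrete.aestronglyMeasurable),
    integral_fintype .of_finite]
  refine Finset.sum_congr rfl fun i _ => ?_
  rw [map_measureReal_apply hκ MeasurableSet.of_discrete, smul_eq_mul]

theorem integral_cellCounts_ofPoints (hκ : Measurable κ) [IsProbabilityMeasure ν]
    {q : (ι → ℕ) → ℝ} {K : ℝ} (hq : ∀ v, |q v| ≤ K) (n : ℕ) (v : ι → ℕ) :
    ∫ x, q (v + ∑ j, Pi.single (κ (x j)) 1) ∂(Measure.pi fun _ : Fin n => ν) =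
      (shiftMean fun i => ν.real (κ ⁻¹' {i}))^[n] q v := by
  induction n generalizing v with
  | zero => simp
  | succ n ih =>
    rw [← ((measurePreserving_piFinSuccAbove (fun _ : Fin (n + 1) => ν) 0).symm).integral_comp']
    simp_rw [MeasurableEquiv.piFinSuccAbove_symm_apply, Fin.insertNthEquiv,
      Fin.sum_univ_succ, Fin.insertNth_zero, Equiv.coe_fn_mk, Fin.cons_succ,
      Fin.cons_zero, ← add_assoc]
    have hm : Measurable fun x : Γ × (Fin n → Γ) =>
        (v + Pi.single (κ x.1) 1 + ∑ j, Pi.single (κ (x.2 j)) 1 : ι → ℕ) := by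
      have h1 : Measurable fun x : Γ => (Pi.single (κ x) 1 : ι → ℕ) :=
        (Measurable.of_discrete (f := fun i : ι => (Pi.single i 1 : ι → ℕ))).comp hκ
      exact (measurable_const.add (h1.comp measurable_fst)).add
        (Finset.measurable_fun_sum _ fun j _ =>
          h1.comp ((measurable_pi_apply j).comp measurable_snd))
    have hinteg : Integrable (fun x : Γ × (Fin n → Γ) =>
        q (v + Pi.single (κ x.1) 1 + ∑ j, Pi.single (κ (x.2 j)) 1))
        (ν.prod (Measure.pi fun _ : Fin n => ν)) :=
      Integrable.of_bound ((Measurable.of_discrete (f := q)).comp hm).aestronglyMeasurable K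
        (Filter.Eventually.of_forall fun x => hq _)
    refine (integral_prod _ hinteg).trans ?_
    simp only [ih]
    rw [Function.iterate_succ_apply', shiftMean]
    exact integral_cell (ν := ν) hκ fun i => (shiftMean fun i => ν.real (κ ⁻¹' {i}))^[n] q (v + Pi.single i 1)

theorem integral_pbdp {a b : ℝ} (ha : 0 < a) (hb : 0 ≤ b) (hb1 : b < 1) [IsProbabilityMeasure ν]
    {ψ : Config Γ → ℝ} (hψ : Measurable ψ) {K : ℝ} (hK : ∀ ξ, |ψ ξ| ≤ K) :
    ∫ ξ, ψ ξ ∂(pbdp a b 0 ν) = ∑' n, (pbd a b 0).real {n} *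
      ∫ x, ψ (Config.ofPoints x) ∂(Measure.pi fun _ : Fin n => ν) := by
  have := isProbabilityMeasure_pbd ha hb hb1 (le_refl (0 : ℝ))
  let k : Kernel ℕ (Config Γ) := Kernel.ofFunOfCountable
    (fun n => (Measure.pi fun _ : Fin n => ν).map Config.ofPoints)
  have : IsMarkovKernel k := ⟨fun n => by
    exact Measure.isProbabilityMeasure_map (measurable_ofPoints n).aemeasurable⟩
  have hk : pbdp a b 0 ν = k ∘ₘ pbd a b 0 := rfl
  have hint2 : Integrable (fun z : ℕ × Config Γ => ψ z.2) (pbd a b 0 ⊗ₘ k) :=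
    Integrable.of_bound (hψ.comp measurable_snd).aestronglyMeasurable K
      (Filter.Eventually.of_forall fun z => hK _)
  have h1 : ∫ ξ, ψ ξ ∂(k ∘ₘ pbd a b 0) = ∫ n, ∫ ξ, ψ ξ ∂(k n) ∂(pbd a b 0) := by
    rw [← Measure.snd_compProd, Measure.snd,
      integral_map measurable_snd.aemeasurable hψ.aestronglyMeasurable,
      Measure.integral_compProd hint2]
  rw [hk, h1, integral_countable (Integrable.of_bound
    Measurable.of_discrete.aestronglyMeasurable K (Filter.Eventually.of_forall fun n => ?_))]
  swap
  · simpa using norm_integral_le_of_norm_le_const (μ := k n) (f := ψ) (C := K)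
      (Filter.Eventually.of_forall hK)
  refine tsum_congr fun n => ?_
  rw [smul_eq_mul]
  congr 1
  exact integral_map (measurable_ofPoints n).aemeasurable hψ.aestronglyMeasurable

/-- The Stein identity of the birth-death point process. -/
theorem integral_pbdp_eq (hκ : Measurable κ) [IsProbabilityMeasure ν] {a b : ℝ} (ha : 0 < a)
    (hb : 0 ≤ b) (hb1 : b < 1) {F h : (ι → ℕ) → ℝ} {c C : ℝ}
    (hF0 : ∀ v, 0 ≤ F v) (hF1 : ∀ v, F v ≤ 1)
    (hC : ∀ v i, |h (v + Pi.single i 1) - h v| ≤ C)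
    (hh : ∀ v, gen (fun i => ν.real (κ ⁻¹' {i})) (fun k => a + b * k) h v = F v - c) :
    ∫ ξ, F (cellCounts κ ξ) ∂(pbdp a b 0 ν) = c := by
  set p : ι → ℝ := fun i => ν.real (κ ⁻¹' {i}) with hpdef
  have hp : ∀ i, 0 ≤ p i := fun i => measureReal_nonneg
  have hp1 : ∑ i, p i = 1 := by
    have := integral_cell (ν := ν) hκ fun _ => 1
    simpa using this.symm
  have hFb : ∀ v, |F v| ≤ 1 := fun v => abs_le.2 ⟨by linarith [hF0 v], hF1 v⟩
  have hgen : gen p (fun k => a + b * k) h = fun v => F v - c := funext hh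
  have hT : ∀ n, (shiftMean p)^[n] (gen p (fun k => a + b * k) h) 0 = (shiftMean p)^[n] F 0 - c :=
    fun n => by rw [hgen, iterate_shiftMean_sub_const hp1]
  -- Here `H n` and `L n` are the means of `h` and of `F - c` given that there are `n` points.
  have hL := tsum_pbdWeight_mul_eq_zero ha hb hb1 (H := fun n => (shiftMean p)^[n] h 0)
    (L := fun n => (shiftMean p)^[n] F 0 - c) (K := 1 + |c|)
    (abs_iterate_succ_sub_le hp hp1 hC)
    (fun n => by rw [← hT, iterate_shiftMean_gen hp1])
    (fun n => (abs_sub _ _).trans (by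
      gcongr; exact abs_iterate_shiftMean_le hp hp1 hFb n 0))
  have hs := summable_pbdWeight ha hb hb1 (le_refl (0 : ℝ))
  have hpos : 0 < ∑' m, pbdWeight a b 0 m :=
    hs.tsum_pos (fun n => (pbdWeight_pos ha hb le_rfl n).le) 0 (pbdWeight_pos ha hb le_rfl 0)
  have hsF : Summable fun n => pbdWeight a b 0 n * (shiftMean p)^[n] F 0 := by
    refine Summable.of_norm_bounded hs fun n => ?_
    rw [Real.norm_eq_abs, abs_mul, abs_of_pos (pbdWeight_pos ha hb le_rfl n)]
    exact mul_le_of_le_one_right (pbdWeight_pos ha hb le_rfl n).le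
      (abs_iterate_shiftMean_le hp hp1 hFb n 0)
  rw [integral_pbdp ha hb hb1 (ψ := fun ξ => F (cellCounts κ ξ)) ((Measurable.of_discrete (f := F)).comp (measurable_cellCounts hκ))
    (fun ξ => hFb _)]
  have h1 : ∀ n, (pbd a b 0).real {n} * ∫ x, F (cellCounts κ (Config.ofPoints x))
      ∂(Measure.pi fun _ : Fin n => ν) =
      pbdWeight a b 0 n * (shiftMean p)^[n] F 0 / ∑' m, pbdWeight a b 0 m := fun n => by
    rw [pbd_real_singleton n (div_nonneg (pbdWeight_pos ha hb le_rfl n).le hpos.le),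
      ← integral_cellCounts_ofPoints hκ hFb n 0]
    simp only [cellCounts_ofPoints hκ, zero_add]
    ring
  rw [tsum_congr h1, tsum_div_const, div_eq_iff hpos.ne']
  have h2 : ∑' n, (pbdWeight a b 0 n * (shiftMean p)^[n] F 0 - pbdWeight a b 0 n * c) = 0 := by
    exact (tsum_congr fun n => by ring).trans hL
  rw [hsF.tsum_sub (hs.mul_right c), tsum_mul_right, sub_eq_zero] at h2
  rw [h2, mul_comm]

end PointProcess

variable {ι : Type*} [Fintype ι] [DecidableEq ι]

/-! ### The Palm identity for cell counts -/

section PalmIdentity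

variable {Γ : Type*} [MetricSpace Γ] [CompactSpace Γ] [MeasurableSpace Γ] [BorelSpace Γ]
  [MeasurableSpace ι] [DiscreteMeasurableSpace ι] {κ : Γ → ι}
  {P : Measure (Config Γ)} {Q : Kernel Γ (Config Γ)}

theorem lintegral_meanMeasure (P : Measure (Config Γ)) {g : Γ → ℝ≥0∞} (hg : Measurable g) :
    ∫⁻ x, g x ∂(meanMeasure P) = ∫⁻ ξ, ∫⁻ x, g x ∂ξ.1 ∂P :=
  Measure.lintegral_bind measurable_subtype_coe.aemeasurable hg.aemeasurable

theorem meanMeasure_univ (P : Measure (Config Γ)) :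
    meanMeasure P Set.univ = ∫⁻ ξ, ξ.1 Set.univ ∂P := by
  simpa using lintegral_meanMeasure P (g := fun _ => 1) measurable_const

theorem measurable_palm (hκ : Measurable κ) {β : Type*} [MeasurableSpace β]
    (q : ι → (ι → ℕ) → β) : Measurable fun z : Γ × Config Γ => q (κ z.1) (cellCounts κ z.2) :=
  (Measurable.of_discrete (f := fun z : ι × (ι → ℕ) => q z.1 z.2)).comp
    ((hκ.comp measurable_fst).prodMk ((measurable_cellCounts hκ).comp measurable_snd))

/-- Almost every `x` under `ξ` is an atom, so removing it lowers the count of its cell by exactly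
one. -/
theorem lintegral_palm (hκ : Measurable κ) (hQ : IsReducedPalm P Q) (q : ι → (ι → ℕ) → ℝ≥0∞) :
    ∫⁻ ξ, ∑ i, (cellCounts κ ξ i : ℝ≥0∞) * q i (cellCounts κ ξ - Pi.single i 1) ∂P =
      ∫⁻ x, ∫⁻ ζ, q (κ x) (cellCounts κ ζ) ∂(Q x) ∂(meanMeasure P) := by
  rw [← hQ (fun z => q (κ z.1) (cellCounts κ z.2)) (measurable_palm hκ q)]
  refine lintegral_congr fun ξ => ?_
  refine (lintegral_cell hκ ξ fun i => q i (cellCounts κ ξ - Pi.single i 1)).symm.trans ?_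
  refine lintegral_congr_ae ?_
  filter_upwards [Config.ae_apply_singleton_ne_zero ξ] with x hx
  simp only [← cellCounts_removePoint hκ ξ hx, add_tsub_cancel_right]

/-- The quantity `∑ i, v i * q i (v - e_i)`. -/
def palmSum (q : ι → (ι → ℕ) → ℝ) (v : ι → ℕ) : ℝ := ∑ i, (v i : ℝ) * q i (v - Pi.single i 1)

variable [IsMarkovKernel Q]

/-- This form admits unbounded `q`; with `q` the total it yields the second moment of Ξ. -/
theorem integral_palm_nonneg (hκ : Measurable κ) (hQ : IsReducedPalm P Q) {q : ι → (ι → ℕ) → ℝ}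
    (hq : ∀ i v, 0 ≤ q i v) (hinteg : Integrable (fun ξ => palmSum q (cellCounts κ ξ)) P) :
    ∫ ξ, palmSum q (cellCounts κ ξ) ∂P =
        ∫ x, ∫ ζ, q (κ x) (cellCounts κ ζ) ∂(Q x) ∂(meanMeasure P) ∧
      Integrable (fun x => ∫ ζ, q (κ x) (cellCounts κ ζ) ∂(Q x)) (meanMeasure P) ∧
      ∀ᵐ x ∂(meanMeasure P), Integrable (fun ζ => q (κ x) (cellCounts κ ζ)) (Q x) := by
  have hs0 : ∀ v, 0 ≤ palmSum q v := fun v =>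
    Finset.sum_nonneg fun i _ => mul_nonneg (Nat.cast_nonneg _) (hq _ _)
  have hE : ∫⁻ ξ, ENNReal.ofReal (palmSum q (cellCounts κ ξ)) ∂P =
      ∫⁻ x, ∫⁻ ζ, ENNReal.ofReal (q (κ x) (cellCounts κ ζ)) ∂(Q x) ∂(meanMeasure P) := by
    rw [← lintegral_palm hκ hQ fun i v => ENNReal.ofReal (q i v)]
    refine lintegral_congr fun ξ => ?_
    rw [palmSum, ENNReal.ofReal_sum_of_nonneg
      fun i _ => mul_nonneg (Nat.cast_nonneg _) (hq _ _)]
    refine Finset.sum_congr rfl fun i _ => ?_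
    rw [ENNReal.ofReal_mul (Nat.cast_nonneg _), ENNReal.ofReal_natCast]
  have hfin : ∫⁻ ξ, ENNReal.ofReal (palmSum q (cellCounts κ ξ)) ∂P ≠ ∞ :=
    (hinteg.lintegral_lt_top).ne
  have hm : Measurable fun x => ∫⁻ ζ, ENNReal.ofReal (q (κ x) (cellCounts κ ζ)) ∂(Q x) :=
    Measurable.lintegral_kernel_prod_right'
      (f := fun z : Γ × Config Γ => ENNReal.ofReal (q (κ z.1) (cellCounts κ z.2)))
      (measurable_palm hκ fun i v => ENNReal.ofReal (q i v))
  have hmeas : ∀ x, Measurable fun ζ => q (κ x) (cellCounts κ ζ) := fun x =>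
    (Measurable.of_discrete (f := q (κ x))).comp (measurable_cellCounts hκ)
  have hinner : ∀ x, ∫ ζ, q (κ x) (cellCounts κ ζ) ∂(Q x) =
      (∫⁻ ζ, ENNReal.ofReal (q (κ x) (cellCounts κ ζ)) ∂(Q x)).toReal := fun x =>
    integral_eq_lintegral_of_nonneg_ae (Filter.Eventually.of_forall fun ζ => hq _ _)
      (hmeas x).aestronglyMeasurable
  have hae := ae_lt_top hm (hE ▸ hfin)
  refine ⟨?_, ?_, ?_⟩
  · rw [integral_eq_lintegral_of_nonneg_ae (Filter.Eventually.of_forall fun ξ => hs0 _)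
      hinteg.aestronglyMeasurable, hE]
    simp only [hinner]
    rw [integral_toReal hm.aemeasurable hae]
  · simp only [hinner]
    exact integrable_toReal_of_lintegral_ne_top hm.aemeasurable (hE ▸ hfin)
  · filter_upwards [hae] with x hx
    refine ⟨(hmeas x).aestronglyMeasurable, ?_⟩
    rw [hasFiniteIntegral_iff_ofReal (Filter.Eventually.of_forall fun ζ => hq _ _)]
    exact hx

theorem abs_palmSum_le {q : ι → (ι → ℕ) → ℝ} {C : ℝ} (hq : ∀ i v, |q i v| ≤ C) (v : ι → ℕ) :
    |palmSum q v| ≤ C * tot v := by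
  rw [tot_cast, Finset.mul_sum]
  refine (Finset.abs_sum_le_sum_abs _ _).trans (Finset.sum_le_sum fun i _ => ?_)
  rw [abs_mul, abs_of_nonneg (Nat.cast_nonneg _), mul_comm]
  exact mul_le_mul_of_nonneg_right (hq _ _) (Nat.cast_nonneg _)

theorem integrable_tot [IsFiniteMeasure (meanMeasure P)] (hκ : Measurable κ) :
    Integrable (fun ξ => (tot (cellCounts κ ξ) : ℝ)) P := by
  refine ⟨((Measurable.of_discrete (f := fun v : ι → ℕ => (tot v : ℝ))).comp
    (measurable_cellCounts hκ)).aestronglyMeasurable, ?_⟩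
  rw [hasFiniteIntegral_iff_ofReal (Filter.Eventually.of_forall fun ξ => Nat.cast_nonneg _)]
  simp only [ENNReal.ofReal_natCast, coe_tot_cellCounts hκ]
  rw [← meanMeasure_univ]
  exact measure_lt_top _ _

theorem integral_tot [IsFiniteMeasure (meanMeasure P)] (hκ : Measurable κ) :
    ∫ ξ, (tot (cellCounts κ ξ) : ℝ) ∂P = (meanMeasure P).real Set.univ := by
  rw [integral_eq_lintegral_of_nonneg_ae (Filter.Eventually.of_forall fun ξ => Nat.cast_nonneg _)
    (integrable_tot hκ).aestronglyMeasurable, measureReal_def, meanMeasure_univ]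
  simp only [ENNReal.ofReal_natCast, coe_tot_cellCounts hκ]

theorem integrable_of_abs_le_tot [IsFiniteMeasure (meanMeasure P)] (hκ : Measurable κ)
    {g : (ι → ℕ) → ℝ} {C : ℝ} (hg : ∀ v, |g v| ≤ C * tot v) :
    Integrable (fun ξ => g (cellCounts κ ξ)) P :=
  ((integrable_tot hκ).const_mul C).mono'
    ((Measurable.of_discrete (f := g)).comp (measurable_cellCounts hκ)).aestronglyMeasurable
    (Filter.Eventually.of_forall fun _ => hg _)

/-- Adding the constant `K` makes `q` nonnegative, and the corresponding total `K * tot` is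
integrable on both sides. -/
theorem integral_palm [IsFiniteMeasure (meanMeasure P)] (hκ : Measurable κ)
    (hQ : IsReducedPalm P Q) {q : ι → (ι → ℕ) → ℝ} {C : ℝ} (hq : ∀ i v, |q i v| ≤ C) :
    ∫ ξ, palmSum q (cellCounts κ ξ) ∂P =
        ∫ x, ∫ ζ, q (κ x) (cellCounts κ ζ) ∂(Q x) ∂(meanMeasure P) ∧
      Integrable (fun x => ∫ ζ, q (κ x) (cellCounts κ ζ) ∂(Q x)) (meanMeasure P) := by
  obtain ⟨K, hK, hq⟩ : ∃ K : ℝ, 0 ≤ K ∧ ∀ i v, |q i v| ≤ K :=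
    ⟨|C|, abs_nonneg C, fun i v => (hq i v).trans (le_abs_self C)⟩
  have hb : ∀ i v, |q i v + K| ≤ K + K := fun i v =>
    (abs_add_le _ _).trans (by rw [abs_of_nonneg hK]; gcongr; exact hq i v)
  have hsum : ∀ v, palmSum (fun i v => q i v + K) v = palmSum q v + K * tot v := fun v => by
    simp only [palmSum, mul_add, Finset.sum_add_distrib, tot_cast, Finset.mul_sum]
    congr 1
    exact Finset.sum_congr rfl fun i _ => mul_comm _ _
  have h1 := integral_palm_nonneg hκ hQ (q := fun i v => q i v + K)
    (fun i v => by linarith [(abs_le.1 (hq i v)).1])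
    (integrable_of_abs_le_tot hκ (abs_palmSum_le hb))
  have hi : ∀ x, Integrable (fun ζ => q (κ x) (cellCounts κ ζ)) (Q x) := fun x =>
    Integrable.of_bound ((Measurable.of_discrete (f := q (κ x))).comp
      (measurable_cellCounts hκ)).aestronglyMeasurable K (Filter.Eventually.of_forall fun _ => hq _ _)
  have hi2 : ∀ x, ∫ ζ, (q (κ x) (cellCounts κ ζ) + K) ∂(Q x) =
      ∫ ζ, q (κ x) (cellCounts κ ζ) ∂(Q x) + K := fun x => by
    rw [integral_add (hi x) (integrable_const _)]; simp
  obtain ⟨h2, h3, -⟩ := h1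
  simp only [hi2, hsum] at h2 h3
  have h4 : Integrable (fun x => ∫ ζ, q (κ x) (cellCounts κ ζ) ∂(Q x)) (meanMeasure P) := by
    exact (h3.sub (integrable_const K)).congr (Filter.Eventually.of_forall fun x => by simp)
  refine ⟨?_, h4⟩
  rw [integral_add (integrable_of_abs_le_tot hκ (abs_palmSum_le hq))
    ((integrable_tot hκ).const_mul _), integral_add h4 (integrable_const _), integral_const_mul,
    integral_const, smul_eq_mul] at h2
  rw [integral_tot hκ] at h2
  linarith

end PalmIdentity

variable {ι : Type*} [Fintype ι] [DecidableEq ι]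

/-! ### Comparison of the smoothness bounds with the error terms -/

section Merge

variable {k : ℕ} {s : Fin k → ι}

/-- Adds up the counts of the cells with the same label. -/
def merge (s : Fin k → ι) (W : Fin k → ℕ) : ι → ℕ := fun i => ∑ j, if s j = i then W j else 0

theorem tot_merge (W : Fin k → ℕ) : tot (merge s W) = tot W := by
  simp only [tot, merge]
  rw [Finset.sum_comm]
  simp

variable {Γ : Type*} [MeasurableSpace Γ] [MeasurableSpace ι] [DiscreteMeasurableSpace ι]
  {idx : Γ → Fin k} {loc : ι → Γ}

theorem cellCounts_comp (hidx : Measurable idx) (ξ : Config Γ) :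
    cellCounts (fun x => s (idx x)) ξ = merge s (cellCounts idx ξ) := by
  refine cast_inj_of_ennreal fun i => ?_
  have h := lintegral_cell hidx ξ fun j => if s j = i then 1 else 0
  have h2 : ∫⁻ x, (if s (idx x) = i then 1 else 0) ∂ξ.1 =
      ∫⁻ x, ((fun x => s (idx x)) ⁻¹' {i}).indicator 1 x ∂ξ.1 :=
    lintegral_congr fun x => by by_cases hx : s (idx x) = i <;> simp [hx]
  have hm : Measurable fun x => s (idx x) := (Measurable.of_discrete (f := s)).comp hidx
  rw [h2, lintegral_indicator_one (hm MeasurableSet.of_discrete)] at h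
  rw [coe_cellCounts, h, merge]
  push_cast
  exact Finset.sum_congr rfl fun j _ => by split_ifs <;> simp

/-- Numbers of points at the locations `loc i`. -/
def locCounts (loc : ι → Γ) (η : Config Γ) : ι → ℕ := fun i => Config.count η {loc i}

variable [MeasurableSingletonClass Γ]

theorem measurable_locCounts : Measurable (locCounts loc : Config Γ → ι → ℕ) :=
  measurable_pi_lambda _ fun _ => Config.measurable_count (measurableSet_singleton _)

theorem locCounts_ofCounts (hloc : Function.Injective loc) (W : Fin k → ℕ) :
    locCounts loc (Config.ofCounts (fun j => loc (s j)) W) = merge s W := by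
  classical
  refine cast_inj_of_ennreal fun i => ?_
  rw [locCounts, Config.coe_count, Config.ofCounts_apply _ _ (measurableSet_singleton _), merge]
  push_cast
  exact Finset.sum_congr rfl fun j _ => by simp [hloc.eq_iff]

theorem locCounts_addPoint (hloc : Function.Injective loc) (η : Config Γ) (i : ι) :
    locCounts loc (Config.addPoint η (loc i)) = locCounts loc η + Pi.single i 1 := by
  classical
  refine cast_inj_of_ennreal fun l => ?_
  rw [Pi.add_apply, Nat.cast_add, locCounts, locCounts, Config.coe_count, Config.coe_count,
    Config.addPoint, Measure.add_apply, Measure.dirac_apply' _ (measurableSet_singleton _)]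
  congr 1
  by_cases h : i = l
  · simp [h]
  · simp [h, hloc.eq_iff, Ne.symm h]

theorem measurable_ofCounts (t : Fin k → Γ) : Measurable (Config.ofCounts t) :=
  Measurable.of_discrete

/-- For distinct locations, counts at the locations recover the merged vector from the assembled
configuration, and adding a point there adds a unit vector. Each event about vectors is thus an
event about configurations. -/
theorem tvShift_map_merge_le (hloc : Function.Injective loc) (τ : Measure (Fin k → ℕ)) (j : Fin k) :
    tvShift (τ.map (merge s)) (s j) ≤
      shiftTV (τ.map (Config.ofCounts fun j => loc (s j))) (loc (s j)) := by
  refine iSup_le fun E => ?_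
  unfold shiftTV
  refine le_iSup_of_le ⟨locCounts loc ⁻¹' E, measurable_locCounts MeasurableSet.of_discrete⟩ ?_
  have hS : MeasurableSet (locCounts loc ⁻¹' E) := measurable_locCounts MeasurableSet.of_discrete
  have hS2 : MeasurableSet {η : Config Γ | Config.addPoint η (loc (s j)) ∈ locCounts loc ⁻¹' E} := by
    simp only [Set.mem_preimage, locCounts_addPoint hloc]
    exact (measurable_locCounts (loc := loc))
      (MeasurableSet.of_discrete (s := {w : ι → ℕ | w + Pi.single (s j) 1 ∈ E}))
  have hm : Measurable (merge s) := Measurable.of_discrete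
  rw [map_measureReal_apply (measurable_ofCounts _) hS,
    map_measureReal_apply (measurable_ofCounts _) hS2,
    map_measureReal_apply hm MeasurableSet.of_discrete,
    map_measureReal_apply hm MeasurableSet.of_discrete]
  apply le_of_eq
  congr 4
  · ext W
    simp [locCounts_ofCounts hloc]
  · ext W
    simp [locCounts_ofCounts hloc, locCounts_addPoint hloc]

theorem smoothBound_map_merge_le (hs : Function.Surjective s) (hloc : Function.Injective loc)
    (a u : ℝ) (τ : Measure (Fin k → ℕ)) :
    smoothBound a u (τ.map (merge s)) ≤ 4 * τ {W | (tot W : ℝ) + 1 ≤ a / u} +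
      ENNReal.ofReal ((4 * u + 10) / a) *
        ⨆ j, shiftTV (τ.map (Config.ofCounts fun j => loc (s j))) (loc (s j)) := by
  have hm : Measurable (merge s) := Measurable.of_discrete
  rw [smoothBound, Measure.map_apply hm MeasurableSet.of_discrete]
  refine add_le_add (le_of_eq ?_) (mul_le_mul_right (iSup_le fun i => ?_) _)
  · congr 2
    ext W
    simp [tot_merge]
  · obtain ⟨j, rfl⟩ := hs i
    exact (tvShift_map_merge_le hloc τ j).trans (le_iSup_of_le j le_rfl)

end Merge

/-! ### Smoothing in terms of `rCond` and `rMean` -/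

section ErrorTerms

variable {k : ℕ} {s : Fin k → ι} {Γ : Type*} [MeasurableSpace Γ] [MeasurableSingletonClass Γ]
  [MeasurableSpace ι] [DiscreteMeasurableSpace ι]
  {idx : Γ → Fin k} {loc : ι → Γ} {μ : Measure (Config Γ)} [IsProbabilityMeasure μ]
  {A B : Set Γ} {a u : ℝ}

theorem smoothBound_map_le_rMean (hidx : Measurable idx) (hs : Function.Surjective s)
    (hloc : Function.Injective loc) (hB : MeasurableSet B) :
    smoothBound a u (μ.map fun ψ => cellCounts (fun x => s (idx x)) (Config.restrict ψ Bᶜ)) ≤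
      rMean a u (fun j => idx ⁻¹' {j}) (fun j => loc (s j)) μ B := by
  have hW : Measurable fun ψ : Config Γ => cellCounts idx (Config.restrict ψ Bᶜ) :=
    (measurable_cellCounts hidx).comp (Config.measurable_restrict hB.compl)
  have hm : Measurable (merge s) := Measurable.of_discrete
  have h1 : (μ.map fun ψ => cellCounts (fun x => s (idx x)) (Config.restrict ψ Bᶜ)) =
      (μ.map fun ψ => cellCounts idx (Config.restrict ψ Bᶜ)).map (merge s) := by
    rw [Measure.map_map hm hW]
    congr 1
    funext ψ
    exact cellCounts_comp hidx _
  rw [h1]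
  refine (smoothBound_map_merge_le hs hloc a u _).trans (le_of_eq ?_)
  rw [rMean, Measure.map_apply hW MeasurableSet.of_discrete, Measure.map_map (measurable_ofCounts _) hW]
  congr 2
  congr 1
  ext ψ
  simp [tot_cellCounts_restrict hidx]

/-- The error term uses separately chosen conditional laws of the total and of the cell counts; as
the total is a function of the counts, the two versions agree almost everywhere. -/
theorem ae_smoothBound_cond_le (hidx : Measurable idx) (hs : Function.Surjective s)
    (hloc : Function.Injective loc) (hB : MeasurableSet B) :
    ∀ᵐ η ∂(μ.map fun ψ => Config.restrict ψ B),
      smoothBound a u ((condDistrib (fun ψ : Config Γ => cellCounts idx (Config.restrict ψ Bᶜ))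
        (fun ψ => Config.restrict ψ B) μ η).map (merge s)) ≤
      4 * condDistrib (fun ψ : Config Γ => Config.count ψ Bᶜ) (fun ψ => Config.restrict ψ B) μ η
          {n : ℕ | (n : ℝ) + 1 ≤ a / u} +
        ENNReal.ofReal ((4 * u + 10) / a) * ⨆ j, shiftTV
          ((condDistrib (fun ψ : Config Γ => cellCounts idx (Config.restrict ψ Bᶜ))
            (fun ψ => Config.restrict ψ B) μ η).map (Config.ofCounts fun j => loc (s j)))
          (loc (s j)) := by
  have hW : Measurable fun ψ : Config Γ => cellCounts idx (Config.restrict ψ Bᶜ) :=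
    (measurable_cellCounts hidx).comp (Config.measurable_restrict hB.compl)
  have htot : Measurable (tot : (Fin k → ℕ) → ℕ) := Measurable.of_discrete
  have hc := condDistrib_comp (mβ := inferInstance) (μ := μ) (fun ψ : Config Γ => Config.restrict ψ B)
    hW.aemeasurable htot
  have he : (tot ∘ fun ψ : Config Γ => cellCounts idx (Config.restrict ψ Bᶜ)) =
      fun ψ => Config.count ψ Bᶜ := funext fun ψ => tot_cellCounts_restrict hidx ψ Bᶜ
  rw [he] at hc
  filter_upwards [hc] with η hη
  refine (smoothBound_map_merge_le hs hloc a u _).trans (le_of_eq ?_)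
  rw [hη, Kernel.map_apply' _ htot _ MeasurableSet.of_discrete]
  rfl

variable {E : Type*} [MeasurableSpace E] [DiscreteMeasurableSpace E] [Countable E]

/-- Conditional smoothing, given the configuration in `B`. -/
theorem ofReal_abs_integral_le_rCond (hidx : Measurable idx) (hs : Function.Surjective s)
    (hloc : Function.Injective loc) (hB : MeasurableSet B) {φ : Config Γ → E} (hφ : Measurable φ)
    (g : E → (ι → ℕ) → ℝ) (K : E → ℝ≥0∞)
    (hg : ∀ e (τ : Measure (ι → ℕ)) [IsProbabilityMeasure τ],
      ENNReal.ofReal |∫ w, g e w ∂τ| ≤ smoothBound a u τ * K e) :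
    ENNReal.ofReal |∫ ψ, g (φ (Config.restrict ψ B))
        (cellCounts (fun x => s (idx x)) (Config.restrict ψ Bᶜ)) ∂μ| ≤
      ∫⁻ ψ, rCond a u (fun j => idx ⁻¹' {j}) (fun j => loc (s j)) μ B ψ *
        K (φ (Config.restrict ψ B)) ∂μ := by
  have hR : Measurable fun ψ : Config Γ => Config.restrict ψ B := Config.measurable_restrict hB
  have hW : Measurable fun ψ : Config Γ => cellCounts idx (Config.restrict ψ Bᶜ) :=
    (measurable_cellCounts hidx).comp (Config.measurable_restrict hB.compl)
  have hm : Measurable (merge s) := Measurable.of_discrete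
  set c := condDistrib (fun ψ : Config Γ => cellCounts idx (Config.restrict ψ Bᶜ))
    (fun ψ => Config.restrict ψ B) μ with hcdef
  have hprod : (μ.map fun ψ : Config Γ => Config.restrict ψ B) ⊗ₘ c =
      μ.map fun ψ => (Config.restrict ψ B, cellCounts idx (Config.restrict ψ Bᶜ)) :=
    compProd_map_condDistrib hW.aemeasurable
  have : IsProbabilityMeasure (μ.map fun ψ : Config Γ => Config.restrict ψ B) :=
    Measure.isProbabilityMeasure_map hR.aemeasurable
  have hf : Measurable fun z : Config Γ × (Fin k → ℕ) => g (φ z.1) (merge s z.2) :=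
    (Measurable.of_discrete (f := fun z : E × (Fin k → ℕ) => g z.1 (merge s z.2))).comp
      ((hφ.comp measurable_fst).prodMk measurable_snd)
  have h1 : ∫ ψ, g (φ (Config.restrict ψ B))
        (cellCounts (fun x => s (idx x)) (Config.restrict ψ Bᶜ)) ∂μ =
      ∫ z, g (φ z.1) (merge s z.2) ∂((μ.map fun ψ : Config Γ => Config.restrict ψ B) ⊗ₘ c) := by
    rw [hprod, integral_map (hR.prodMk hW).aemeasurable hf.aestronglyMeasurable]
    simp only [cellCounts_comp hidx]
  rw [h1]
  by_cases hinteg : Integrable (fun z : Config Γ × (Fin k → ℕ) => g (φ z.1) (merge s z.2))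
      ((μ.map fun ψ : Config Γ => Config.restrict ψ B) ⊗ₘ c)
  -- A nonintegrable function has integral 0 by convention, and the bound is trivial.
  swap
  · rw [integral_undef hinteg]; simp
  rw [Measure.integral_compProd hinteg, ← Real.enorm_eq_ofReal_abs]
  refine (enorm_integral_le_lintegral_enorm _).trans ?_
  -- This direction of the change of variables needs no measurability of the integrand, which
  -- contains suprema over events.
  refine le_trans ?_ (lintegral_map_le (μ := μ) (fun η =>
    (4 * condDistrib (fun ψ : Config Γ => Config.count ψ Bᶜ) (fun ψ => Config.restrict ψ B) μ η
          {n : ℕ | (n : ℝ) + 1 ≤ a / u} +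
        ENNReal.ofReal ((4 * u + 10) / a) * ⨆ j, shiftTV
          ((condDistrib (fun ψ : Config Γ => cellCounts idx (Config.restrict ψ Bᶜ))
            (fun ψ => Config.restrict ψ B) μ η).map (Config.ofCounts fun j => loc (s j)))
          (loc (s j))) * K (φ η)) (fun ψ => Config.restrict ψ B))
  refine lintegral_mono_ae ?_
  filter_upwards [ae_smoothBound_cond_le (μ := μ) (a := a) (u := u) hidx hs hloc hB] with η hη
  have : IsProbabilityMeasure ((c η).map (merge s)) := Measure.isProbabilityMeasure_map hm.aemeasurable
  have h2 : ∫ W, g (φ η) (merge s W) ∂(c η) = ∫ w, g (φ η) w ∂((c η).map (merge s)) :=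
    (integral_map hm.aemeasurable Measurable.of_discrete.aestronglyMeasurable).symm
  simp only [h2, Real.enorm_eq_ofReal_abs]
  exact (hg (φ η) _).trans (mul_le_mul_left hη _)

/-- Smoothing by a configuration in `Bᶜ` that is independent of the configuration in `A`. -/
theorem ofReal_abs_integral_le_rMean (hidx : Measurable idx) (hs : Function.Surjective s)
    (hloc : Function.Injective loc) (hA : MeasurableSet A) (hB : MeasurableSet B)
    (hind : IndepFun (fun ξ => Config.restrict ξ Bᶜ) (fun ξ => Config.restrict ξ A) μ)
    {φ : Config Γ → E} (hφ : Measurable φ)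
    (g : E → (ι → ℕ) → ℝ) (K : E → ℝ≥0∞)
    (hg : ∀ e (τ : Measure (ι → ℕ)) [IsProbabilityMeasure τ],
      ENNReal.ofReal |∫ w, g e w ∂τ| ≤ smoothBound a u τ * K e) :
    ENNReal.ofReal |∫ ψ, g (φ (Config.restrict ψ A))
        (cellCounts (fun x => s (idx x)) (Config.restrict ψ Bᶜ)) ∂μ| ≤
      ∫⁻ ψ, rMean a u (fun j => idx ⁻¹' {j}) (fun j => loc (s j)) μ B *
        K (φ (Config.restrict ψ A)) ∂μ := by
  have hκ : Measurable fun x => s (idx x) := (Measurable.of_discrete (f := s)).comp hidx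
  have hR : Measurable fun ψ : Config Γ => φ (Config.restrict ψ A) :=
    hφ.comp (Config.measurable_restrict hA)
  have hW : Measurable fun ψ : Config Γ => cellCounts (fun x => s (idx x)) (Config.restrict ψ Bᶜ) :=
    (measurable_cellCounts hκ).comp (Config.measurable_restrict hB.compl)
  have hind' : IndepFun (fun ψ : Config Γ => φ (Config.restrict ψ A))
      (fun ψ => cellCounts (fun x => s (idx x)) (Config.restrict ψ Bᶜ)) μ :=
    hind.symm.comp hφ (measurable_cellCounts hκ)
  have hprod := (indepFun_iff_map_prod_eq_prod_map_map hR.aemeasurable hW.aemeasurable).1 hind'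
  have := Measure.isProbabilityMeasure_map (μ := μ) hR.aemeasurable
  have := Measure.isProbabilityMeasure_map (μ := μ) hW.aemeasurable
  have hf : Measurable fun z : E × (ι → ℕ) => g z.1 z.2 := Measurable.of_discrete
  have h1 : ∫ ψ, g (φ (Config.restrict ψ A))
        (cellCounts (fun x => s (idx x)) (Config.restrict ψ Bᶜ)) ∂μ =
      ∫ z, g z.1 z.2 ∂((μ.map fun ψ : Config Γ => φ (Config.restrict ψ A)).prod
        (μ.map fun ψ => cellCounts (fun x => s (idx x)) (Config.restrict ψ Bᶜ))) := by
    rw [← hprod, integral_map (hR.prodMk hW).aemeasurable hf.aestronglyMeasurable]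
  rw [h1]
  by_cases hinteg : Integrable (fun z : E × (ι → ℕ) => g z.1 z.2)
      ((μ.map fun ψ : Config Γ => φ (Config.restrict ψ A)).prod
        (μ.map fun ψ => cellCounts (fun x => s (idx x)) (Config.restrict ψ Bᶜ)))
  swap
  · rw [integral_undef hinteg]; simp
  rw [integral_prod _ hinteg, ← Real.enorm_eq_ofReal_abs]
  refine (enorm_integral_le_lintegral_enorm _).trans ?_
  refine le_trans ?_ (lintegral_map_le (μ := μ) (fun e =>
    rMean a u (fun j => idx ⁻¹' {j}) (fun j => loc (s j)) μ B * K e)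
    (fun ψ => φ (Config.restrict ψ A)))
  refine lintegral_mono fun e => ?_
  rw [Real.enorm_eq_ofReal_abs]
  exact (hg e _).trans (mul_le_mul_left (smoothBound_map_le_rMean hidx hs hloc hB) _)

end ErrorTerms

variable {ι : Type*} [Fintype ι] [DecidableEq ι]

/-! ### The error caused by local dependence -/

section LocalError

variable {k : ℕ} {s : Fin k → ι} {Γ : Type*} [MeasurableSpace Γ] [MeasurableSingletonClass Γ]
  [MeasurableSpace ι] [DiscreteMeasurableSpace ι]
  {idx : Γ → Fin k} {loc : ι → Γ} {P μ : Measure (Config Γ)} [IsProbabilityMeasure P]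
  [IsProbabilityMeasure μ] {A B : Set Γ} {a u C : ℝ} {h : (ι → ℕ) → ℝ}

theorem ofReal_le_mul_of_le_toReal_mul {x K : ℝ} {S : ℝ≥0∞} (hS : S ≠ ∞)
    (h : x ≤ S.toReal * K) : ENNReal.ofReal x ≤ S * ENNReal.ofReal K := by
  refine (ENNReal.ofReal_le_ofReal h).trans (le_of_eq ?_)
  rw [ENNReal.ofReal_mul ENNReal.toReal_nonneg, ENNReal.ofReal_toReal hS]

theorem map_restrict_compl_eq (hAB : A ⊆ B) (hA : MeasurableSet A) (hB : MeasurableSet B)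
    (hlaw : μ.map (fun ξ => Config.restrict ξ Aᶜ) = P.map (fun ξ => Config.restrict ξ Aᶜ)) :
    μ.map (fun ξ => Config.restrict ξ Bᶜ) = P.map (fun ξ => Config.restrict ξ Bᶜ) := by
  have h1 : ∀ ρ : Measure (Config Γ), ρ.map (fun ξ => Config.restrict ξ Bᶜ) =
      (ρ.map (fun ξ => Config.restrict ξ Aᶜ)).map (fun ξ => Config.restrict ξ Bᶜ) := fun ρ => by
    rw [Measure.map_map (Config.measurable_restrict hB.compl) (Config.measurable_restrict hA.compl)]
    congr 1
    funext ξ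
    simp only [Function.comp_apply, Config.restrict_restrict ξ hB.compl,
      Set.inter_eq_left.2 (Set.compl_subset_compl.2 hAB)]
  rw [h1 μ, h1 P, hlaw]

theorem integral_comp_restrict_eq {S : Set Γ} (hS : MeasurableSet S)
    (hlaw : μ.map (fun ξ => Config.restrict ξ S) = P.map (fun ξ => Config.restrict ξ S))
    {g : Config Γ → ℝ} (hg : Measurable g) :
    ∫ ψ, g (Config.restrict ψ S) ∂μ = ∫ ψ, g (Config.restrict ψ S) ∂P := by
  rw [← integral_map (Config.measurable_restrict hS).aemeasurable hg.aestronglyMeasurable, hlaw,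
    integral_map (Config.measurable_restrict hS).aemeasurable hg.aestronglyMeasurable]

/-- The constant depends only on the law outside `B`, which a Palm law shares with Ξ. -/
theorem rMean_congr (hidx : Measurable idx) (hB : MeasurableSet B)
    (hlaw : μ.map (fun ξ => Config.restrict ξ Bᶜ) = P.map (fun ξ => Config.restrict ξ Bᶜ))
    (t : Fin k → Γ) :
    rMean a u (fun j => idx ⁻¹' {j}) t μ B = rMean a u (fun j => idx ⁻¹' {j}) t P B := by
  have hR : Measurable fun ξ : Config Γ => Config.restrict ξ Bᶜ :=
    Config.measurable_restrict hB.compl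
  have ha : Measurable fun ξ : Config Γ => Config.assemble (fun j => idx ⁻¹' {j}) t ξ :=
    (measurable_ofCounts t).comp (measurable_cellCounts hidx)
  have h1 : ∀ ρ : Measure (Config Γ), ρ {ψ | (Config.count ψ Bᶜ : ℝ) + 1 ≤ a / u} =
      ρ.map (fun ξ => Config.restrict ξ Bᶜ) {η | (Config.count η Set.univ : ℝ) + 1 ≤ a / u} := by
    intro ρ
    rw [Measure.map_apply hR]
    · congr 1
      ext ψ
      simp [Config.count_restrict]
    · exact (Config.measurable_count MeasurableSet.univ)
        (MeasurableSet.of_discrete (s := {n : ℕ | (n : ℝ) + 1 ≤ a / u}))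
  have h2 : ∀ ρ : Measure (Config Γ),
      (ρ.map fun ψ => Config.assemble (fun j => idx ⁻¹' {j}) t (Config.restrict ψ Bᶜ)) =
      (ρ.map (fun ξ => Config.restrict ξ Bᶜ)).map
        fun ξ => Config.assemble (fun j => idx ⁻¹' {j}) t ξ := fun ρ =>
    (Measure.map_map ha hR).symm
  rw [rMean, rMean, h1 μ, h1 P, h2 μ, h2 P, hlaw]

/-- The mean second difference far from a point is close to the unconditional one. -/
theorem ofReal_abs_reference_le (H : SteinBounds a h C) (ha : 0 < a) (hu : 0 < u)
    (hidx : Measurable idx) (hs : Function.Surjective s)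
    (hloc : Function.Injective loc) (hB : MeasurableSet B)
    (hlaw : μ.map (fun ξ => Config.restrict ξ Bᶜ) = P.map (fun ξ => Config.restrict ξ Bᶜ)) (o : ι) :
    ENNReal.ofReal |∫ ψ, sd h o o (cellCounts (fun x => s (idx x)) (Config.restrict ψ Bᶜ)) ∂μ -
        ∫ ψ, sd h o o (cellCounts (fun x => s (idx x)) ψ) ∂P| ≤
      ∫⁻ ψ, rCond a u (fun j => idx ⁻¹' {j}) (fun j => loc (s j)) P B ψ * ψ.1 B ∂P := by
  have hκ : Measurable fun x => s (idx x) := (Measurable.of_discrete (f := s)).comp hidx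
  have hcc := measurable_cellCounts hκ
  have hq := H.isSmoothable_sd o o
  have hinteg : ∀ f : Config Γ → (ι → ℕ), Measurable f →
      Integrable (fun ψ => sd h o o (f ψ)) P := fun f hf =>
    Integrable.of_bound ((Measurable.of_discrete (f := sd h o o)).comp hf).aestronglyMeasurable 2
      (Filter.Eventually.of_forall fun ψ => (hq _).1)
  rw [integral_comp_restrict_eq hB.compl hlaw
    (g := fun ψ => sd h o o (cellCounts (fun x => s (idx x)) ψ))
    ((Measurable.of_discrete (f := sd h o o)).comp hcc), abs_sub_comm,
    ← integral_sub (hinteg _ hcc) (hinteg (fun ψ => cellCounts (fun x => s (idx x))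
      (Config.restrict ψ Bᶜ)) (hcc.comp (Config.measurable_restrict hB.compl)))]
  have h1 := ofReal_abs_integral_le_rCond (μ := P) (a := a) (u := u) hidx hs hloc hB hcc
    (fun α w => sd h o o (α + w) - sd h o o w) (fun α => (tot α : ℝ≥0∞)) (fun α τ _ => by
      have := hq.abs_integral_add_le (τ := τ) ha hu 0 α
      simp only [zero_add] at this
      simpa using ofReal_le_mul_of_le_toReal_mul smoothBound_ne_top this)
  simp only [cellCounts_restrict_add_compl hκ _ hB, coe_tot_cellCounts_restrict hκ] at h1
  exact h1

theorem restrict_restrict_of_subset (ξ : Config Γ) {S T : Set Γ} (hS : MeasurableSet S)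
    (hST : S ⊆ T) : Config.restrict (Config.restrict ξ T) S = Config.restrict ξ S := by
  rw [Config.restrict_restrict ξ hS, Set.inter_eq_left.2 hST]

theorem cellCounts_eq_add_add {κ : Γ → ι} (hκ : Measurable κ) (hA : MeasurableSet A)
    (hB : MeasurableSet B) (hAB : A ⊆ B) (ξ : Config Γ) :
    cellCounts κ (Config.restrict ξ A) + cellCounts κ (Config.restrict ξ (B \ A)) +
      cellCounts κ (Config.restrict ξ Bᶜ) = cellCounts κ ξ := by
  rw [← cellCounts_restrict_union hκ ξ Set.disjoint_sdiff_right (hB.diff hA),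
    Set.union_sdiff_cancel hAB, cellCounts_restrict_add_compl hκ ξ hB]

theorem cellCounts_restrict_compl_eq_add {κ : Γ → ι} (hκ : Measurable κ)
    (hB : MeasurableSet B) (hAB : A ⊆ B) (ξ : Config Γ) :
    cellCounts κ (Config.restrict ξ (B \ A)) + cellCounts κ (Config.restrict ξ Bᶜ) =
      cellCounts κ (Config.restrict ξ Aᶜ) := by
  have hd : Disjoint (B \ A) Bᶜ := Set.disjoint_left.2 fun x hx hx' => hx' hx.1
  rw [← cellCounts_restrict_union hκ ξ hd hB.compl]
  congr 2
  ext x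
  simp only [Set.mem_union, Set.mem_sdiff, Set.mem_compl_iff]
  have := @hAB x
  tauto

/-- First differences: the error of removing the points in the neighbourhood `A`. -/
theorem ofReal_abs_first_difference_le (H : SteinBounds a h C) (ha : 0 < a) (hu : 0 < u)
    (hidx : Measurable idx) (hs : Function.Surjective s)
    (hloc : Function.Injective loc) (hA : MeasurableSet A) (hB : MeasurableSet B) (hAB : A ⊆ B)
    (hlaw : μ.map (fun ξ => Config.restrict ξ Aᶜ) = P.map (fun ξ => Config.restrict ξ Aᶜ))
    (hind : IndepFun (fun ξ => Config.restrict ξ Bᶜ) (fun ξ => Config.restrict ξ A) μ)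
    (hinteg : Integrable
      (fun ψ => (tot (cellCounts (fun x => s (idx x)) (Config.restrict ψ A)) : ℝ)) μ) (i o : ι) :
    ENNReal.ofReal |∫ ψ, (fd h i (cellCounts (fun x => s (idx x)) ψ) -
          fd h i (cellCounts (fun x => s (idx x)) (Config.restrict ψ Aᶜ))) ∂μ -
        (∫ ψ, (tot (cellCounts (fun x => s (idx x)) (Config.restrict ψ A)) : ℝ) ∂μ) *
          ∫ ψ, sd h o o (cellCounts (fun x => s (idx x)) ψ) ∂P| ≤
      ∫⁻ ψ, eps1 a u (fun j => idx ⁻¹' {j}) (fun j => loc (s j)) P μ A B ψ ∂μ := by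
  have hκ : Measurable fun x => s (idx x) := (Measurable.of_discrete (f := s)).comp hidx
  have hcc := measurable_cellCounts hκ
  have hccr : ∀ S : Set Γ, MeasurableSet S → Measurable fun ψ : Config Γ =>
      cellCounts (fun x => s (idx x)) (Config.restrict ψ S) := fun S hS =>
    hcc.comp (Config.measurable_restrict hS)
  set R := ∫ ψ, sd h o o (cellCounts (fun x => s (idx x)) ψ) ∂P with hR
  set cc := cellCounts (Γ := Γ) (fun x => s (idx x)) with hccdef
  have hifd : ∀ f : Config Γ → (ι → ℕ), Measurable f → Integrable (fun ψ => fd h i (f ψ)) μ :=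
    fun f hf => Integrable.of_bound
      ((Measurable.of_discrete (f := fd h i)).comp hf).aestronglyMeasurable C
      (Filter.Eventually.of_forall fun ψ => H.incr _ i)
  have hisd : Integrable (fun ψ => sd h o o (cc (Config.restrict ψ Bᶜ))) μ :=
    Integrable.of_bound ((Measurable.of_discrete (f := sd h o o)).comp
      (hccr _ hB.compl)).aestronglyMeasurable 2
      (Filter.Eventually.of_forall fun ψ => (H.isSmoothable_sd o o _).1)
  have hind' : IndepFun (fun ψ : Config Γ => (tot (cc (Config.restrict ψ A)) : ℝ))
      (fun ψ => sd h o o (cc (Config.restrict ψ Bᶜ))) μ :=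
    hind.symm.comp ((Measurable.of_discrete (f := fun v : ι → ℕ => (tot v : ℝ))).comp hcc)
      ((Measurable.of_discrete (f := sd h o o)).comp hcc)
  have hprod : ∫ ψ, (tot (cc (Config.restrict ψ A)) : ℝ) * sd h o o (cc (Config.restrict ψ Bᶜ)) ∂μ =
      (∫ ψ, (tot (cc (Config.restrict ψ A)) : ℝ) ∂μ) *
        ∫ ψ, sd h o o (cc (Config.restrict ψ Bᶜ)) ∂μ :=
    hind'.integral_fun_mul_eq_mul_integral hinteg.aestronglyMeasurable hisd.aestronglyMeasurable
  have hiprod : Integrable (fun ψ => (tot (cc (Config.restrict ψ A)) : ℝ) *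
      sd h o o (cc (Config.restrict ψ Bᶜ))) μ := hind'.integrable_mul hinteg hisd
  have h1 := ofReal_abs_integral_le_rCond (μ := μ) (a := a) (u := u) hidx hs hloc hB
    (φ := fun η => (cc (Config.restrict η A), cc (Config.restrict η (B \ A))))
    ((hccr A hA).prodMk (hccr _ (hB.diff hA)))
    (fun e w => (fd h i (e.1 + e.2 + w) - fd h i (e.2 + w)) - (fd h i (e.1 + w) - fd h i w))
    (fun e => (tot e.1 : ℝ≥0∞) * tot e.2) (fun e τ _ => by
      have := ofReal_le_mul_of_le_toReal_mul smoothBound_ne_top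
        (H.abs_integral_fd_mixed_le (τ := τ) ha hu i e.1 e.2)
      rwa [ENNReal.ofReal_mul (Nat.cast_nonneg _), ENNReal.ofReal_natCast,
        ENNReal.ofReal_natCast] at this)
  have h2 := ofReal_abs_integral_le_rMean (μ := μ) (a := a) (u := u) hidx hs hloc hA hB hind hcc
    (fun α w => fd h i (α + w) - fd h i w - tot α * sd h o o w)
    (fun α => ((tot α : ℝ≥0∞) + 1) * tot α / 2) (fun α τ _ => by
      have := ofReal_le_mul_of_le_toReal_mul smoothBound_ne_top
        (H.abs_integral_fd_sub_le (τ := τ) ha hu i o α)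
      rwa [ENNReal.ofReal_div_of_pos zero_lt_two, ENNReal.ofReal_mul (by positivity),
        ENNReal.ofReal_add (Nat.cast_nonneg _) zero_le_one, ENNReal.ofReal_natCast,
        ENNReal.ofReal_one, ENNReal.ofReal_ofNat] at this)
  have h3 := ofReal_abs_reference_le (loc := loc) H ha hu hidx hs hloc hB
    (map_restrict_compl_eq hAB hA hB hlaw) o
  simp only [← hccdef, restrict_restrict_of_subset _ hA hAB,
    restrict_restrict_of_subset _ (hB.diff hA) Set.sdiff_subset] at h1 h2 h3
  set T1 := ∫ ψ, ((fd h i (cc (Config.restrict ψ A) + cc (Config.restrict ψ (B \ A)) +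
      cc (Config.restrict ψ Bᶜ)) - fd h i (cc (Config.restrict ψ (B \ A)) +
      cc (Config.restrict ψ Bᶜ))) - (fd h i (cc (Config.restrict ψ A) +
      cc (Config.restrict ψ Bᶜ)) - fd h i (cc (Config.restrict ψ Bᶜ)))) ∂μ with hT1
  set T2 := ∫ ψ, (fd h i (cc (Config.restrict ψ A) + cc (Config.restrict ψ Bᶜ)) -
    fd h i (cc (Config.restrict ψ Bᶜ)) - tot (cc (Config.restrict ψ A)) *
      sd h o o (cc (Config.restrict ψ Bᶜ))) ∂μ with hT2
  have hA0 : 0 ≤ ∫ ψ, (tot (cc (Config.restrict ψ A)) : ℝ) ∂μ :=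
    integral_nonneg fun _ => Nat.cast_nonneg _
  -- `T1` detaches the points of `B \ A` and is smoothed conditionally on `B`; `T2` is the
  -- second-order expansion in the points of `A`, independent of those in `Bᶜ`. The last product
  -- comes from independence and is compared with `R`.
  have hdecomp : ∫ ψ, (fd h i (cc ψ) - fd h i (cc (Config.restrict ψ Aᶜ))) ∂μ -
        (∫ ψ, (tot (cc (Config.restrict ψ A)) : ℝ) ∂μ) * R =
      T1 + T2 + (∫ ψ, (tot (cc (Config.restrict ψ A)) : ℝ) ∂μ) *
        (∫ ψ, sd h o o (cc (Config.restrict ψ Bᶜ)) ∂μ - R) := by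
    have i1 := hifd _ (((hccr A hA).add (hccr _ (hB.diff hA))).add (hccr _ hB.compl))
    have i2 := hifd _ ((hccr _ (hB.diff hA)).add (hccr _ hB.compl))
    have i3 := hifd _ ((hccr A hA).add (hccr _ hB.compl))
    have i4 := hifd _ (hccr _ hB.compl)
    rw [mul_sub, ← hprod, ← add_sub_assoc]
    congr 1
    have j2 : T2 + ∫ ψ, (tot (cc (Config.restrict ψ A)) : ℝ) *
        sd h o o (cc (Config.restrict ψ Bᶜ)) ∂μ = _ :=
      (integral_add ((i3.sub i4).sub hiprod) hiprod).symm
    rw [add_assoc, j2, hT1]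
    refine Eq.trans ?_ (integral_add ((i1.sub i2).sub (i3.sub i4))
      (((i3.sub i4).sub hiprod).add hiprod))
    refine integral_congr_ae (Filter.Eventually.of_forall fun ψ => ?_)
    have e1 := cellCounts_eq_add_add hκ hA hB hAB ψ
    have e2 := cellCounts_restrict_compl_eq_add hκ hB hAB ψ
    simp only [← hccdef] at e1 e2
    simp only [Pi.sub_apply, Pi.add_apply, e1, e2]
    ring
  rw [hdecomp]
  have hAE : ENNReal.ofReal (∫ ψ, (tot (cc (Config.restrict ψ A)) : ℝ) ∂μ) = ∫⁻ ψ, ψ.1 A ∂μ := by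
    rw [ofReal_integral_eq_lintegral_ofReal hinteg
      (Filter.Eventually.of_forall fun _ => Nat.cast_nonneg _)]
    simp only [ENNReal.ofReal_natCast, hccdef, coe_tot_cellCounts_restrict hκ]
  simp only [hccdef, coe_tot_cellCounts_restrict hκ] at h1 h2
  calc ENNReal.ofReal |T1 + T2 + (∫ ψ, (tot (cc (Config.restrict ψ A)) : ℝ) ∂μ) *
        (∫ ψ, sd h o o (cc (Config.restrict ψ Bᶜ)) ∂μ - R)|
      ≤ ENNReal.ofReal (|T1| + |T2| + (∫ ψ, (tot (cc (Config.restrict ψ A)) : ℝ) ∂μ) *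
        |∫ ψ, sd h o o (cc (Config.restrict ψ Bᶜ)) ∂μ - R|) := by
        refine ENNReal.ofReal_le_ofReal ((abs_add_le _ _).trans ?_)
        rw [abs_mul, abs_of_nonneg hA0]
        gcongr
        exact abs_add_le _ _
    _ = ENNReal.ofReal |T1| + ENNReal.ofReal |T2| + (∫⁻ ψ, ψ.1 A ∂μ) *
        ENNReal.ofReal |∫ ψ, sd h o o (cc (Config.restrict ψ Bᶜ)) ∂μ - R| := by
        rw [ENNReal.ofReal_add (by positivity) (by positivity),
          ENNReal.ofReal_add (abs_nonneg _) (abs_nonneg _), ENNReal.ofReal_mul hA0, hAE]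
    _ ≤ _ := add_le_add (add_le_add h1 h2) (mul_le_mul_right h3 _)
    _ = _ := by rw [← lintegral_mul_const _ (Config.measurable_apply hA)]
    _ ≤ _ := add_le_add_left (le_lintegral_add _ _) _
    _ ≤ _ := le_lintegral_add _ _
    _ = _ := by
      refine lintegral_congr fun ψ => ?_
      rw [eps1, mul_assoc]

/-- Second differences: the error of replacing them by their unconditional mean. -/
theorem ofReal_abs_second_difference_le (H : SteinBounds a h C) (ha : 0 < a) (hu : 0 < u)
    (hidx : Measurable idx) (hs : Function.Surjective s)
    (hloc : Function.Injective loc) (hA : MeasurableSet A) (hB : MeasurableSet B) (hAB : A ⊆ B)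
    (hlaw : μ.map (fun ξ => Config.restrict ξ Aᶜ) = P.map (fun ξ => Config.restrict ξ Aᶜ))
    (hind : IndepFun (fun ξ => Config.restrict ξ Bᶜ) (fun ξ => Config.restrict ξ A) μ)
    (i j o : ι) :
    ENNReal.ofReal |∫ ψ, sd h i j (cellCounts (fun x => s (idx x)) ψ) ∂μ -
          ∫ ψ, sd h o o (cellCounts (fun x => s (idx x)) ψ) ∂P| ≤
      ∫⁻ ψ, rMean a u (fun j => idx ⁻¹' {j}) (fun j => loc (s j)) P B * ψ.1 A ∂μ +
      ∫⁻ ψ, eps2 a u (fun j => idx ⁻¹' {j}) (fun j => loc (s j)) P μ A B ψ ∂μ := by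
  have hκ : Measurable fun x => s (idx x) := (Measurable.of_discrete (f := s)).comp hidx
  have hcc := measurable_cellCounts hκ
  have hccr : ∀ S : Set Γ, MeasurableSet S → Measurable fun ψ : Config Γ =>
      cellCounts (fun x => s (idx x)) (Config.restrict ψ S) := fun S hS =>
    hcc.comp (Config.measurable_restrict hS)
  have hlawB := map_restrict_compl_eq hAB hA hB hlaw
  set R := ∫ ψ, sd h o o (cellCounts (fun x => s (idx x)) ψ) ∂P with hR
  set cc := cellCounts (Γ := Γ) (fun x => s (idx x)) with hccdef
  have hisd : ∀ (l m : ι) (f : Config Γ → (ι → ℕ)), Measurable f →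
      Integrable (fun ψ => sd h l m (f ψ)) μ :=
    fun l m f hf => Integrable.of_bound
      ((Measurable.of_discrete (f := sd h l m)).comp hf).aestronglyMeasurable 2
      (Filter.Eventually.of_forall fun ψ => (H.isSmoothable_sd l m _).1)
  have hq := H.isSmoothable_sd i j
  have h1 := ofReal_abs_integral_le_rCond (μ := μ) (a := a) (u := u) hidx hs hloc hB
    (φ := fun η => (cc (Config.restrict η A), cc (Config.restrict η (B \ A))))
    ((hccr A hA).prodMk (hccr _ (hB.diff hA)))
    (fun e w => sd h i j (e.1 + e.2 + w) - sd h i j (e.1 + w))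
    (fun e => (tot e.2 : ℝ≥0∞)) (fun e τ _ => by
      have := ofReal_le_mul_of_le_toReal_mul smoothBound_ne_top
        (hq.abs_integral_add_le (τ := τ) ha hu e.1 e.2)
      rwa [ENNReal.ofReal_natCast] at this)
  have h2 := ofReal_abs_integral_le_rMean (μ := μ) (a := a) (u := u) hidx hs hloc hA hB hind hcc
    (fun α w => sd h i j (α + w) - sd h i j w)
    (fun α => (tot α : ℝ≥0∞)) (fun α τ _ => by
      have := hq.abs_integral_add_le (τ := τ) ha hu 0 α
      simp only [zero_add] at this
      simpa using ofReal_le_mul_of_le_toReal_mul smoothBound_ne_top this)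
  have h3 := ofReal_abs_integral_le_rMean (μ := μ) (a := a) (u := u) hidx hs hloc hA hB hind hcc
    (fun _ w => sd h i j w - sd h o o w) (fun _ => 1) (fun α τ _ => by
      have := H.abs_integral_sd_sub_le (τ := τ) ha hu i j o
      simpa using ofReal_le_mul_of_le_toReal_mul smoothBound_ne_top (this.trans_eq (mul_one _).symm))
  have h4 := ofReal_abs_reference_le (loc := loc) H ha hu hidx hs hloc hB hlawB o
  -- In this term the constant of Ξ replaces that of the Palm process, the form in which $\bar
  -- r_y(\Xi)\,\Xi_y(A_y)$ enters the theorem.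
  rw [rMean_congr hidx hB hlawB] at h2
  simp only [← hccdef, restrict_restrict_of_subset _ hA hAB,
    restrict_restrict_of_subset _ (hB.diff hA) Set.sdiff_subset] at h1 h2 h3 h4
  set T1 := ∫ ψ, (sd h i j (cc (Config.restrict ψ A) + cc (Config.restrict ψ (B \ A)) +
      cc (Config.restrict ψ Bᶜ)) - sd h i j (cc (Config.restrict ψ A) +
      cc (Config.restrict ψ Bᶜ))) ∂μ with hT1
  set T2 := ∫ ψ, (sd h i j (cc (Config.restrict ψ A) + cc (Config.restrict ψ Bᶜ)) -
    sd h i j (cc (Config.restrict ψ Bᶜ))) ∂μ with hT2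
  set T3 := ∫ ψ, (sd h i j (cc (Config.restrict ψ Bᶜ)) - sd h o o (cc (Config.restrict ψ Bᶜ))) ∂μ
    with hT3
  set T4 := ∫ ψ, sd h o o (cc (Config.restrict ψ Bᶜ)) ∂μ with hT4
  -- Remove the points of `B \ A`, then those of `A`, then change the types `i` and `j` into `o`,
  -- and finally compare the mean outside `B` with that of all of Ξ.
  have hdecomp : ∫ ψ, sd h i j (cc ψ) ∂μ - R = T1 + T2 + T3 + (T4 - R) := by
    have i1 := hisd i j _ (((hccr A hA).add (hccr _ (hB.diff hA))).add (hccr _ hB.compl))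
    have i3 := hisd i j _ ((hccr A hA).add (hccr _ hB.compl))
    have i4 := hisd i j _ (hccr _ hB.compl)
    have i5 := hisd o o _ (hccr _ hB.compl)
    simp only [Pi.add_apply] at i1 i3
    rw [hT1, hT2, hT3, hT4, integral_sub i1 i3, integral_sub i3 i4, integral_sub i4 i5]
    have e1 := fun ψ => cellCounts_eq_add_add hκ hA hB hAB ψ
    simp only [← hccdef] at e1
    simp only [e1]
    ring
  rw [hdecomp]
  simp only [hccdef, coe_tot_cellCounts_restrict hκ] at h1 h2
  simp only [mul_one, lintegral_const, measure_univ] at h3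
  calc ENNReal.ofReal |T1 + T2 + T3 + (T4 - R)|
      ≤ ENNReal.ofReal (|T1| + |T2| + |T3| + |T4 - R|) := by
        refine ENNReal.ofReal_le_ofReal ((abs_add_le _ _).trans ?_)
        gcongr
        refine (abs_add_le _ _).trans ?_
        gcongr
        exact abs_add_le _ _
    _ = ENNReal.ofReal |T2| + (ENNReal.ofReal |T1| + ENNReal.ofReal |T3| +
        ENNReal.ofReal |T4 - R|) := by
        rw [ENNReal.ofReal_add (by positivity) (by positivity),
          ENNReal.ofReal_add (by positivity) (by positivity),
          ENNReal.ofReal_add (abs_nonneg _) (abs_nonneg _)]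
        ring
    _ ≤ _ := add_le_add h2 (add_le_add (add_le_add h1 h3) h4)
    _ ≤ _ := by
      refine add_le_add le_rfl ?_
      have c1 : ∀ c : ℝ≥0∞, c = ∫⁻ _, c ∂μ := fun c => by simp
      rw [c1 (rMean a u (fun j => idx ⁻¹' {j}) (fun j => loc (s j)) μ B),
        c1 (∫⁻ ψ, rCond a u (fun j => idx ⁻¹' {j}) (fun j => loc (s j)) P B ψ * ψ.1 B ∂P)]
      refine (add_le_add_left (le_lintegral_add _ _) _).trans ?_
      exact le_lintegral_add _ _

end LocalError

variable {ι : Type*} [Fintype ι] [DecidableEq ι]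

/-! ### The expectation of the generator -/

theorem ofReal_abs_neg_add_sum_le {p : ι → ℝ} (hp : ∀ i, 0 ≤ p i) (hp1 : ∑ i, p i = 1) {b D : ℝ}
    (hb : 0 ≤ b) {x : ι → ℝ} {e e' : ℝ≥0∞} (hD : ENNReal.ofReal |D| ≤ e)
    (hx : ∀ i, ENNReal.ofReal |x i| ≤ e') :
    ENNReal.ofReal |-D + b * ∑ i, p i * x i| ≤ e + ENNReal.ofReal b * e' := by
  have h1 : |-D + b * ∑ i, p i * x i| ≤ |D| + b * ∑ i, p i * |x i| := by
    refine (abs_add_le _ _).trans ?_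
    rw [abs_neg, abs_mul, abs_of_nonneg hb]
    gcongr
    refine (Finset.abs_sum_le_sum_abs _ _).trans (Finset.sum_le_sum fun i _ => ?_)
    rw [abs_mul, abs_of_nonneg (hp i)]
  refine (ENNReal.ofReal_le_ofReal h1).trans ?_
  have h2 : ∀ i ∈ Finset.univ, 0 ≤ p i * |x i| := fun i _ => mul_nonneg (hp i) (abs_nonneg _)
  rw [ENNReal.ofReal_add (abs_nonneg _) (mul_nonneg hb (Finset.sum_nonneg h2)),
    ENNReal.ofReal_mul hb, ENNReal.ofReal_sum_of_nonneg h2]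
  refine add_le_add hD (mul_le_mul_right ?_ _)
  calc ∑ i, ENNReal.ofReal (p i * |x i|) ≤ ∑ i, ENNReal.ofReal (p i) * e' :=
        Finset.sum_le_sum fun i _ => by
          rw [ENNReal.ofReal_mul (hp i)]
          exact mul_le_mul_right (hx i) _
    _ = e' := by
        rw [← Finset.sum_mul, ← ENNReal.ofReal_sum_of_nonneg fun i _ => hp i, hp1,
          ENNReal.ofReal_one, one_mul]

theorem death_eq_neg_palmSum (h : (ι → ℕ) → ℝ) (v : ι → ℕ) : death h v = -palmSum (fd h) v := by
  rw [death, palmSum, ← Finset.sum_neg_distrib]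
  refine Finset.sum_congr rfl fun i _ => ?_
  rcases Nat.eq_zero_or_pos (v i) with h0 | h0
  · simp [h0]
  · rw [fd, sub_single_add h0]; ring

/-- This turns the part `b * tot v` of the birth rate into a sum over points, so that it is covered
by the same Palm identity as the deaths. -/
theorem tot_mul_eq_palmSum (g : (ι → ℕ) → ℝ) (v : ι → ℕ) :
    tot v * g v = palmSum (fun i w => g (w + Pi.single i 1)) v := by
  rw [tot_cast, palmSum, Finset.sum_mul]
  refine Finset.sum_congr rfl fun i _ => ?_
  rcases Nat.eq_zero_or_pos (v i) with h0 | h0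
  · simp [h0]
  · rw [sub_single_add h0]

theorem palmSum_tot (v : ι → ℕ) :
    palmSum (fun _ w => (tot w : ℝ)) v = (tot v : ℝ) ^ 2 - tot v := by
  have : (tot v : ℝ) * (tot v - 1) = palmSum (fun i w => (tot (w + Pi.single i 1) : ℝ) - 1) v :=
    tot_mul_eq_palmSum (fun w => (tot w : ℝ) - 1) v
  simp only [tot_add_single, Nat.cast_add, Nat.cast_one, add_sub_cancel_right] at this
  rw [← this]; ring

/-- The integrand of the Palm form of the generator. -/
def palmIntegrand (p : ι → ℝ) (b : ℝ) (h : (ι → ℕ) → ℝ) (i : ι) (w : ι → ℕ) : ℝ :=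
  b * ∑ z, p z * fd h z (w + Pi.single i 1) - fd h i w

theorem gen_eq_palmSum (p : ι → ℝ) (a b : ℝ) (h : (ι → ℕ) → ℝ) (v : ι → ℕ) :
    gen p (fun k => a + b * k) h v = a * ∑ z, p z * fd h z v + palmSum (palmIntegrand p b h) v := by
  have h1 : palmSum (palmIntegrand p b h) v =
      tot v * (b * ∑ z, p z * fd h z v) - palmSum (fd h) v := by
    rw [tot_mul_eq_palmSum fun w => b * ∑ z, p z * fd h z w]
    simp only [palmSum, palmIntegrand, mul_sub, Finset.sum_sub_distrib]
  rw [h1, gen, death_eq_neg_palmSum]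
  simp only [birth, fd]
  ring

theorem abs_palmIntegrand_le {p : ι → ℝ} (hp : ∀ i, 0 ≤ p i) (hp1 : ∑ i, p i = 1) {b C : ℝ}
    (hb : 0 ≤ b) {h : (ι → ℕ) → ℝ} (hC : ∀ v i, |h (v + Pi.single i 1) - h v| ≤ C) (i : ι)
    (w : ι → ℕ) : |palmIntegrand p b h i w| ≤ b * C + C := by
  refine (abs_sub _ _).trans (add_le_add ?_ (hC w i))
  rw [abs_mul, abs_of_nonneg hb]
  refine mul_le_mul_of_nonneg_left ?_ hb
  refine (Finset.abs_sum_le_sum_abs _ _).trans ?_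
  calc ∑ z, |p z * fd h z (w + Pi.single i 1)| ≤ ∑ z, p z * C :=
        Finset.sum_le_sum fun z _ => by
          rw [abs_mul, abs_of_nonneg (hp z)]
          exact mul_le_mul_of_nonneg_left (hC _ _) (hp z)
    _ = C := by rw [← Finset.sum_mul, hp1, one_mul]

/-! ### The error at a fixed point of the space -/

section Pointwise

variable {k : ℕ} {s : Fin k → ι} {Γ : Type*} [MeasurableSpace Γ] [MeasurableSingletonClass Γ]
  [MeasurableSpace ι] [DiscreteMeasurableSpace ι]
  {idx : Γ → Fin k} {loc : ι → Γ} {P μ : Measure (Config Γ)} [IsProbabilityMeasure P]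
  [IsProbabilityMeasure μ] {A B : Set Γ} {a b u C : ℝ} {h : (ι → ℕ) → ℝ} {p : ι → ℝ}

theorem integrable_tot_restrict {κ : Γ → ι} (hκ : Measurable κ) {S : Set Γ} (hS : MeasurableSet S)
    (hinteg : Integrable (fun ψ => (tot (cellCounts κ ψ) : ℝ)) μ) :
    Integrable (fun ψ => (tot (cellCounts κ (Config.restrict ψ S)) : ℝ)) μ := by
  refine hinteg.mono' ((Measurable.of_discrete (f := fun v : ι → ℕ => (tot v : ℝ))).comp
    ((measurable_cellCounts hκ).comp (Config.measurable_restrict hS))).aestronglyMeasurable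
    (Filter.Eventually.of_forall fun ψ => ?_)
  rw [Real.norm_of_nonneg (Nat.cast_nonneg _), ← cellCounts_restrict_add_compl hκ ψ hS, tot_add]
  push_cast
  linarith [(Nat.cast_nonneg _ : (0 : ℝ) ≤ tot (cellCounts κ (Config.restrict ψ Sᶜ)))]

/-- First differences under the two laws, relative to the difference of the mean totals. -/
theorem ofReal_abs_first_difference_sub_le (H : SteinBounds a h C) (ha : 0 < a) (hu : 0 < u)
    (hidx : Measurable idx) (hs : Function.Surjective s)
    (hloc : Function.Injective loc) (hA : MeasurableSet A) (hB : MeasurableSet B) (hAB : A ⊆ B)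
    (hlaw : μ.map (fun ξ => Config.restrict ξ Aᶜ) = P.map (fun ξ => Config.restrict ξ Aᶜ))
    (hindP : IndepFun (fun ξ => Config.restrict ξ Bᶜ) (fun ξ => Config.restrict ξ A) P)
    (hind : IndepFun (fun ξ => Config.restrict ξ Bᶜ) (fun ξ => Config.restrict ξ A) μ)
    (hintP : Integrable (fun ψ => (tot (cellCounts (fun x => s (idx x)) ψ) : ℝ)) P)
    (hinteg : Integrable (fun ψ => (tot (cellCounts (fun x => s (idx x)) ψ) : ℝ)) μ) (i o : ι) :
    ENNReal.ofReal |∫ ψ, fd h i (cellCounts (fun x => s (idx x)) ψ) ∂μ -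
          ∫ ψ, fd h i (cellCounts (fun x => s (idx x)) ψ) ∂P -
        (∫ ψ, (tot (cellCounts (fun x => s (idx x)) ψ) : ℝ) ∂μ -
          ∫ ψ, (tot (cellCounts (fun x => s (idx x)) ψ) : ℝ) ∂P) *
          ∫ ψ, sd h o o (cellCounts (fun x => s (idx x)) ψ) ∂P| ≤
      ∫⁻ ψ, eps1 a u (fun j => idx ⁻¹' {j}) (fun j => loc (s j)) P μ A B ψ ∂μ +
      ∫⁻ ψ, eps1 a u (fun j => idx ⁻¹' {j}) (fun j => loc (s j)) P P A B ψ ∂P := by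
  have hκ : Measurable fun x => s (idx x) := (Measurable.of_discrete (f := s)).comp hidx
  have hcc := measurable_cellCounts hκ
  have h1 := ofReal_abs_first_difference_le (loc := loc) H ha hu hidx hs hloc hA hB hAB hlaw hind
    (integrable_tot_restrict hκ hA hinteg) i o
  have h2 := ofReal_abs_first_difference_le (loc := loc) H ha hu hidx hs hloc hA hB hAB rfl hindP
    (integrable_tot_restrict hκ hA hintP) i o
  refine le_trans ?_ (add_le_add h1 h2)
  rw [← ENNReal.ofReal_add (abs_nonneg _) (abs_nonneg _)]
  refine ENNReal.ofReal_le_ofReal (le_trans (le_of_eq ?_) (abs_sub _ _))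
  set cc := cellCounts (Γ := Γ) (fun x => s (idx x)) with hccdef
  have hifd : ∀ (ρ : Measure (Config Γ)) [IsProbabilityMeasure ρ] (f : Config Γ → (ι → ℕ)),
      Measurable f → Integrable (fun ψ => fd h i (f ψ)) ρ :=
    fun ρ _ f hf => Integrable.of_bound
      ((Measurable.of_discrete (f := fd h i)).comp hf).aestronglyMeasurable C
      (Filter.Eventually.of_forall fun ψ => H.incr _ i)
  have hr : Measurable fun ψ => cc (Config.restrict ψ Aᶜ) :=
    hcc.comp (Config.measurable_restrict hA.compl)
  have htot : ∀ (ρ : Measure (Config Γ)) [IsProbabilityMeasure ρ],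
      Integrable (fun ψ => (tot (cc ψ) : ℝ)) ρ →
      ∫ ψ, (tot (cc ψ) : ℝ) ∂ρ = ∫ ψ, (tot (cc (Config.restrict ψ A)) : ℝ) ∂ρ +
        ∫ ψ, (tot (cc (Config.restrict ψ Aᶜ)) : ℝ) ∂ρ := fun ρ _ hρ => by
    rw [← integral_add (integrable_tot_restrict hκ hA hρ)
      (integrable_tot_restrict hκ hA.compl hρ)]
    refine integral_congr_ae (Filter.Eventually.of_forall fun ψ => ?_)
    simp only [hccdef]
    rw [← Nat.cast_add, ← tot_add, cellCounts_restrict_add_compl hκ ψ hA]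
  -- Outside `A` both laws agree, so the contributions of `Aᶜ` cancel in the first differences and
  -- in the mean totals alike.
  have e1 := integral_comp_restrict_eq hA.compl hlaw (g := fun ψ => fd h i (cc ψ))
    ((Measurable.of_discrete (f := fd h i)).comp hcc)
  have e2 := integral_comp_restrict_eq hA.compl hlaw (g := fun ψ => (tot (cc ψ) : ℝ))
    ((Measurable.of_discrete (f := fun v : ι → ℕ => (tot v : ℝ))).comp hcc)
  rw [htot μ hinteg, htot P hintP, integral_sub (hifd μ _ hcc) (hifd μ _ hr),
    integral_sub (hifd P _ hcc) (hifd P _ hr), e1, e2]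
  congr 1
  ring

/-- The error at a given point. -/
theorem ofReal_abs_palm_error_le (H : SteinBounds a h C) (ha : 0 < a) (hu : 0 < u)
    (hp : ∀ i, 0 ≤ p i) (hp1 : ∑ i, p i = 1) (hb : 0 ≤ b)
    (hidx : Measurable idx) (hs : Function.Surjective s)
    (hloc : Function.Injective loc) (hA : MeasurableSet A) (hB : MeasurableSet B) (hAB : A ⊆ B)
    (hlaw : μ.map (fun ξ => Config.restrict ξ Aᶜ) = P.map (fun ξ => Config.restrict ξ Aᶜ))
    (hindP : IndepFun (fun ξ => Config.restrict ξ Bᶜ) (fun ξ => Config.restrict ξ A) P)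
    (hind : IndepFun (fun ξ => Config.restrict ξ Bᶜ) (fun ξ => Config.restrict ξ A) μ)
    (hintP : Integrable (fun ψ => (tot (cellCounts (fun x => s (idx x)) ψ) : ℝ)) P)
    (hinteg : Integrable (fun ψ => (tot (cellCounts (fun x => s (idx x)) ψ) : ℝ)) μ) (i o : ι)
    {m R : ℝ} (hm : m = ∫ ψ, (tot (cellCounts (fun x => s (idx x)) ψ) : ℝ) ∂μ -
          ∫ ψ, (tot (cellCounts (fun x => s (idx x)) ψ) : ℝ) ∂P)
    (hR : R = ∫ ψ, sd h o o (cellCounts (fun x => s (idx x)) ψ) ∂P) :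
    ENNReal.ofReal |∫ ψ, palmIntegrand p b h i (cellCounts (fun x => s (idx x)) ψ) ∂μ +
        ∫ ψ, fd h i (cellCounts (fun x => s (idx x)) ψ) ∂P -
        b * ∑ z, p z * ∫ ψ, fd h z (cellCounts (fun x => s (idx x)) ψ) ∂P +
        (m - b * (m + 1)) * R| ≤
      ENNReal.ofReal (1 + b) *
        (∫⁻ ψ, eps1 a u (fun j => idx ⁻¹' {j}) (fun j => loc (s j)) P μ A B ψ ∂μ +
          ∫⁻ ψ, eps1 a u (fun j => idx ⁻¹' {j}) (fun j => loc (s j)) P P A B ψ ∂P) +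
      ENNReal.ofReal b *
        ∫⁻ ψ, rMean a u (fun j => idx ⁻¹' {j}) (fun j => loc (s j)) P B * ψ.1 A ∂μ +
      ENNReal.ofReal b *
        ∫⁻ ψ, eps2 a u (fun j => idx ⁻¹' {j}) (fun j => loc (s j)) P μ A B ψ ∂μ := by
  have hκ : Measurable fun x => s (idx x) := (Measurable.of_discrete (f := s)).comp hidx
  have hcc := measurable_cellCounts hκ
  have h1 := fun z => ofReal_abs_first_difference_sub_le (loc := loc) H ha hu hidx hs hloc hA hB hAB
    hlaw hindP hind hintP hinteg z o
  have h2 := fun z => ofReal_abs_second_difference_le (loc := loc) H ha hu hidx hs hloc hA hB hAB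
    hlaw hind i z o
  rw [← hm, ← hR] at h1
  rw [← hR] at h2
  set cc := cellCounts (Γ := Γ) (fun x => s (idx x)) with hccdef
  set e1 := ∫⁻ ψ, eps1 a u (fun j => idx ⁻¹' {j}) (fun j => loc (s j)) P μ A B ψ ∂μ +
          ∫⁻ ψ, eps1 a u (fun j => idx ⁻¹' {j}) (fun j => loc (s j)) P P A B ψ ∂P
  have hifd : ∀ (z : ι) (f : Config Γ → (ι → ℕ)),
      Measurable f → Integrable (fun ψ => fd h z (f ψ)) μ :=
    fun z f hf => Integrable.of_bound
      ((Measurable.of_discrete (f := fd h z)).comp hf).aestronglyMeasurable C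
      (Filter.Eventually.of_forall fun ψ => H.incr _ z)
  have hcc1 : Measurable fun ψ => cc ψ + Pi.single i 1 := hcc.add measurable_const
  have hpalm : ∫ ψ, palmIntegrand p b h i (cc ψ) ∂μ =
      b * ∑ z, p z * (∫ ψ, sd h i z (cc ψ) ∂μ + ∫ ψ, fd h z (cc ψ) ∂μ) -
        ∫ ψ, fd h i (cc ψ) ∂μ := by
    simp only [palmIntegrand]
    rw [integral_sub ((integrable_finsetSum _ fun z _ => (hifd z _ hcc1).const_mul _).const_mul _)
      (hifd i _ hcc), integral_const_mul, integral_finsetSum _ fun z _ => (hifd z _ hcc1).const_mul _]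
    congr 2
    refine Finset.sum_congr rfl fun z _ => ?_
    rw [integral_const_mul]
    congr 1
    simp only [sd_eq]
    rw [integral_sub (hifd z _ hcc1) (hifd z _ hcc)]
    ring
  -- A first difference after adding a point of type `i` is a first plus a second difference. The
  -- weights of the first differences, 1 and `b`, give the factor `1 + b`; second differences have
  -- weight `b`, and `m + 1` collects one `R` from each kind.
  have hsplit : ∫ ψ, palmIntegrand p b h i (cc ψ) ∂μ + ∫ ψ, fd h i (cc ψ) ∂P -
        b * ∑ z, p z * ∫ ψ, fd h z (cc ψ) ∂P + (m - b * (m + 1)) * R =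
      -(∫ ψ, fd h i (cc ψ) ∂μ - ∫ ψ, fd h i (cc ψ) ∂P - m * R) +
        b * ∑ z, p z * ((∫ ψ, sd h i z (cc ψ) ∂μ - R) +
          (∫ ψ, fd h z (cc ψ) ∂μ - ∫ ψ, fd h z (cc ψ) ∂P - m * R)) := by
    have h3 : ∑ z, p z * ((∫ ψ, sd h i z (cc ψ) ∂μ - R) +
          (∫ ψ, fd h z (cc ψ) ∂μ - ∫ ψ, fd h z (cc ψ) ∂P - m * R)) =
        ∑ z, p z * (∫ ψ, sd h i z (cc ψ) ∂μ + ∫ ψ, fd h z (cc ψ) ∂μ) -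
          ∑ z, p z * ∫ ψ, fd h z (cc ψ) ∂P - (∑ z, p z) * ((m + 1) * R) := by
      rw [Finset.sum_mul, ← Finset.sum_sub_distrib, ← Finset.sum_sub_distrib]
      exact Finset.sum_congr rfl fun z _ => by ring
    rw [h3, hp1, hpalm]
    ring
  rw [hsplit]
  refine (ofReal_abs_neg_add_sum_le hp hp1 hb (h1 i) fun z =>
    (ENNReal.ofReal_le_ofReal (abs_add_le _ _)).trans
      ((ENNReal.ofReal_add_le).trans (add_le_add (h2 z) (h1 z)))).trans (le_of_eq ?_)
  rw [ENNReal.ofReal_add zero_le_one hb, ENNReal.ofReal_one]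
  ring

end Pointwise

variable {ι : Type*} [Fintype ι] [DecidableEq ι]

/-! ### Integration over the mean measure -/

section Expectation

variable {k : ℕ} {s : Fin k → ι} {Γ : Type*} [MetricSpace Γ] [CompactSpace Γ] [MeasurableSpace Γ]
  [BorelSpace Γ] [MeasurableSpace ι] [DiscreteMeasurableSpace ι]
  {idx : Γ → Fin k} {loc : ι → Γ} {P : Measure (Config Γ)} [IsProbabilityMeasure P]
  {Q : Kernel Γ (Config Γ)} [IsMarkovKernel Q]
  {A B : Γ → Set Γ} {a b u C : ℝ} {h : (ι → ℕ) → ℝ} {p : ι → ℝ}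

/-- The expectation of the generator as an integral over the mean measure. -/
theorem integral_gen_eq [IsFiniteMeasure (meanMeasure P)] {κ : Γ → ι} (hκ : Measurable κ)
    (hQ : IsReducedPalm P Q) (H : SteinBounds a h C) (hb : 0 ≤ b)
    (hp : ∀ i, 0 ≤ p i) (hp1 : ∑ i, p i = 1)
    (hpm : ∀ i, (meanMeasure P).real (κ ⁻¹' {i}) = (meanMeasure P).real Set.univ * p i)
    (ha : a = (1 - b) * (meanMeasure P).real Set.univ) :
    Integrable (fun y => ∫ ζ, palmIntegrand p b h (κ y) (cellCounts κ ζ) ∂(Q y) +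
        ∫ ξ, fd h (κ y) (cellCounts κ ξ) ∂P -
        b * ∑ z, p z * ∫ ξ, fd h z (cellCounts κ ξ) ∂P) (meanMeasure P) ∧
    ∫ ξ, gen p (fun k => a + b * k) h (cellCounts κ ξ) ∂P =
      ∫ y, (∫ ζ, palmIntegrand p b h (κ y) (cellCounts κ ζ) ∂(Q y) +
        ∫ ξ, fd h (κ y) (cellCounts κ ξ) ∂P -
        b * ∑ z, p z * ∫ ξ, fd h z (cellCounts κ ξ) ∂P) ∂(meanMeasure P) := by
  set e : ι → ℝ := fun z => ∫ ξ, fd h z (cellCounts κ ξ) ∂P with he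
  have hcc := measurable_cellCounts hκ
  have hpb := abs_palmIntegrand_le hp hp1 hb (h := h) H.incr
  have hpalm := integral_palm hκ hQ hpb
  have hifd : ∀ z, Integrable (fun ξ => fd h z (cellCounts κ ξ)) P := fun z =>
    Integrable.of_bound ((Measurable.of_discrete (f := fd h z)).comp hcc).aestronglyMeasurable C
      (Filter.Eventually.of_forall fun ψ => H.incr _ z)
  have hie : Integrable (fun y => e (κ y)) (meanMeasure P) :=
    Integrable.of_bound ((Measurable.of_discrete (f := e)).comp hκ).aestronglyMeasurable
      (∑ z, |e z|) (Filter.Eventually.of_forall fun y =>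
        Finset.single_le_sum (f := fun z => |e z|) (fun _ _ => abs_nonneg _) (Finset.mem_univ (κ y)))
  have hi2 : Integrable (fun y => ∫ ζ, palmIntegrand p b h (κ y) (cellCounts κ ζ) ∂(Q y) + e (κ y))
      (meanMeasure P) := hpalm.2.add hie
  refine ⟨hi2.sub (integrable_const _), ?_⟩
  simp only [gen_eq_palmSum]
  have hisum : Integrable (fun ξ => ∑ z, p z * fd h z (cellCounts κ ξ)) P :=
    integrable_finsetSum _ fun z _ => (hifd z).const_mul _
  have hcell := integral_cell (ν := meanMeasure P) hκ e
  -- Since `p` is the normalised mean measure of the cells, the mean measure integrates `e (κ y)` to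
  -- its total mass times `∑ z, p z * e z`; with `a` equal to `1 - b` times that mass, the
  -- immigration term is absorbed.
  simp only [hpm, mul_assoc, ← Finset.mul_sum] at hcell
  rw [integral_add (hisum.const_mul a) (integrable_of_abs_le_tot hκ (abs_palmSum_le hpb)),
    integral_const_mul, integral_finsetSum _ fun z _ => (hifd z).const_mul _, hpalm.1,
    integral_sub hi2 (integrable_const _), integral_add hpalm.2 hie, hcell, integral_const,
    smul_eq_mul, ha]
  simp only [integral_const_mul]
  change (1 - b) * _ * ∑ z, p z * e z + _ = _
  ring

/-- The mean totals under the Palm laws balance. -/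
theorem integral_palm_tot [IsFiniteMeasure (meanMeasure P)] {κ : Γ → ι} (hκ : Measurable κ)
    (hQ : IsReducedPalm P Q) (hsq : Integrable (fun ξ => (tot (cellCounts κ ξ) : ℝ) ^ 2) P) :
    (∀ᵐ y ∂(meanMeasure P), Integrable (fun ζ => (tot (cellCounts κ ζ) : ℝ)) (Q y)) ∧
    Integrable (fun y => ∫ ζ, (tot (cellCounts κ ζ) : ℝ) ∂(Q y)) (meanMeasure P) ∧
    ∫ y, ∫ ζ, (tot (cellCounts κ ζ) : ℝ) ∂(Q y) ∂(meanMeasure P) =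
      ∫ ξ, (tot (cellCounts κ ξ) : ℝ) ^ 2 ∂P - (meanMeasure P).real Set.univ := by
  have h1 := integral_palm_nonneg (q := fun _ w => (tot w : ℝ)) hκ hQ
    (fun _ _ => Nat.cast_nonneg _) (by
      simp only [palmSum_tot]
      exact hsq.sub (integrable_tot hκ))
  refine ⟨h1.2.2, h1.2.1, ?_⟩
  rw [← h1.1]
  simp only [palmSum_tot]
  rw [integral_sub hsq (integrable_tot hκ), integral_tot hκ]

/-- The Stein bound for the expectation of the generator. -/
theorem ofReal_abs_integral_gen_le [IsFiniteMeasure (meanMeasure P)] (H : SteinBounds a h C)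
    (ha : 0 < a) (hu : 0 < u) (hp : ∀ i, 0 ≤ p i) (hp1 : ∑ i, p i = 1) (hb : 0 ≤ b)
    (hidx : Measurable idx) (hs : Function.Surjective s) (hloc : Function.Injective loc)
    (hQ : IsReducedPalm P Q) (hdep : TypeILocalDependence P Q A B)
    (hpm : ∀ i, (meanMeasure P).real ((fun x => s (idx x)) ⁻¹' {i}) =
      (meanMeasure P).real Set.univ * p i)
    (haeq : a = (1 - b) * (meanMeasure P).real Set.univ)
    (hsq : Integrable (fun ξ => (tot (cellCounts (fun x => s (idx x)) ξ) : ℝ) ^ 2) P)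
    (hbeq : b * (∫ ξ, (tot (cellCounts (fun x => s (idx x)) ξ) : ℝ) ^ 2 ∂P -
        (meanMeasure P).real Set.univ ^ 2) =
      ∫ ξ, (tot (cellCounts (fun x => s (idx x)) ξ) : ℝ) ^ 2 ∂P -
        (meanMeasure P).real Set.univ ^ 2 - (meanMeasure P).real Set.univ) :
    ENNReal.ofReal |∫ ξ, gen p (fun k => a + b * k) h (cellCounts (fun x => s (idx x)) ξ) ∂P| ≤
      ∫⁻ y, (ENNReal.ofReal (1 + b) *
        (∫⁻ ζ, eps1 a u (fun j => idx ⁻¹' {j}) (fun j => loc (s j)) P (Q y) (A y) (B y) ζ ∂(Q y) +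
          ∫⁻ ξ, eps1 a u (fun j => idx ⁻¹' {j}) (fun j => loc (s j)) P P (A y) (B y) ξ ∂P) +
      ENNReal.ofReal b * (∫⁻ ζ,
        rMean a u (fun j => idx ⁻¹' {j}) (fun j => loc (s j)) P (B y) * ζ.1 (A y) ∂(Q y)) +
      ENNReal.ofReal b * (∫⁻ ζ, eps2 a u (fun j => idx ⁻¹' {j}) (fun j => loc (s j)) P (Q y)
        (A y) (B y) ζ ∂(Q y))) ∂(meanMeasure P) := by
  have hκ : Measurable fun x => s (idx x) := (Measurable.of_discrete (f := s)).comp hidx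
  obtain ⟨o⟩ : Nonempty ι := by
    by_contra hc
    rw [not_nonempty_iff] at hc
    simp at hp1
  obtain ⟨hi1, heq⟩ := integral_gen_eq hκ hQ H hb hp hp1 hpm haeq
  obtain ⟨hae, hi2, htot⟩ := integral_palm_tot hκ hQ hsq
  set R := ∫ ψ, sd h o o (cellCounts (fun x => s (idx x)) ψ) ∂P with hR
  set L := (meanMeasure P).real Set.univ with hL
  set m : Γ → ℝ := fun y => ∫ ψ, (tot (cellCounts (fun x => s (idx x)) ψ) : ℝ) ∂(Q y) -
          ∫ ψ, (tot (cellCounts (fun x => s (idx x)) ψ) : ℝ) ∂P with hm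
  have him : Integrable m (meanMeasure P) := hi2.sub (integrable_const _)
  have hmint : ∫ y, m y ∂(meanMeasure P) =
      ∫ ξ, (tot (cellCounts (fun x => s (idx x)) ξ) : ℝ) ^ 2 ∂P - L - L ^ 2 := by
    rw [hm, integral_sub hi2 (integrable_const _), htot, integral_const, integral_tot hκ,
      smul_eq_mul]
    ring
  have him1 : Integrable (fun y => m y + 1) (meanMeasure P) := him.add (integrable_const 1)
  have hi3 : Integrable (fun y => (m y - b * (m y + 1)) * R) (meanMeasure P) :=
    (him.sub (him1.const_mul b)).mul_const R
  -- The main terms cancel: `m` integrates to variance minus mean, `m + 1` to the variance, and `b`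
  -- is the ratio of the two.
  have hzero : ∫ y, (m y - b * (m y + 1)) * R ∂(meanMeasure P) = 0 := by
    rw [integral_mul_const, integral_sub him (him1.const_mul b),
      integral_const_mul, integral_add him (integrable_const 1), hmint, integral_const, smul_eq_mul]
    rw [show ∫ ξ, (tot (cellCounts (fun x => s (idx x)) ξ) : ℝ) ^ 2 ∂P - L - L ^ 2 -
      b * (∫ ξ, (tot (cellCounts (fun x => s (idx x)) ξ) : ℝ) ^ 2 ∂P - L - L ^ 2 + L * 1) = 0 by
      linarith, zero_mul]
  rw [heq, ← add_zero (∫ y, _ ∂(meanMeasure P)), ← hzero, ← integral_add hi1 hi3,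
    ← Real.enorm_eq_ofReal_abs]
  refine (enorm_integral_le_lintegral_enorm _).trans (lintegral_mono_ae ?_)
  filter_upwards [hae] with y hy
  rw [Real.enorm_eq_ofReal_abs]
  exact ofReal_abs_palm_error_le H ha hu hp hp1 hb hidx hs hloc (hdep.left.measurableSet y)
    (hdep.right.measurableSet y) (hdep.subset y) (hdep.law_eq y) (hdep.indep y)
    (hdep.indep_palm y) (integrable_tot hκ) hy (s (idx y)) o rfl hR

end Expectation

/-! ### Passage from configurations to cell counts -/

section Comparison

variable {Γ : Type*} [MetricSpace Γ] [CompactSpace Γ] [MeasurableSpace Γ] [BorelSpace Γ]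
  [MeasurableSpace ι] [DiscreteMeasurableSpace ι] {κ : Γ → ι} {loc : ι → Γ}

theorem isProbabilityMeasure_pbdp {Γ : Type*} [MeasurableSpace Γ] {ν : Measure Γ}
    [IsProbabilityMeasure ν] {a b : ℝ} (ha : 0 < a) (hb : 0 ≤ b) (hb1 : b < 1) :
    IsProbabilityMeasure (pbdp a b 0 ν) := by
  have := isProbabilityMeasure_pbd ha hb hb1 (le_refl (0 : ℝ))
  let k : Kernel ℕ (Config Γ) := Kernel.ofFunOfCountable
    (fun n => (Measure.pi fun _ : Fin n => ν).map Config.ofPoints)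
  have : IsMarkovKernel k := ⟨fun n => by
    exact Measure.isProbabilityMeasure_map (measurable_ofPoints n).aemeasurable⟩
  have hk : pbdp a b 0 ν = k ∘ₘ pbd a b 0 := rfl
  rw [hk]
  infer_instance

/-- Passing to cell counts costs at most twice the mesh. -/
theorem abs_integral_sub_le [Nonempty Γ] (hdist : ∀ x y : Γ, dist x y ≤ 1) (hκ : Measurable κ)
    {ε : ℝ} (hε : 0 ≤ ε) (hmesh : ∀ x, dist x (loc (κ x)) ≤ ε) {f : Config Γ → ℝ}
    (hf : ∀ ξ η, |f ξ - f η| ≤ d1 ξ η) (P P' : Measure (Config Γ)) [IsProbabilityMeasure P]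
    [IsProbabilityMeasure P'] {c : ℝ} {F : (ι → ℕ) → ℝ} (hF : ∀ v, F v = f (placeAt loc v) - c) :
    |∫ ξ, f ξ ∂P - ∫ ξ, f ξ ∂P'| ≤
      2 * ε + |∫ ξ, F (cellCounts κ ξ) ∂P - ∫ ξ, F (cellCounts κ ξ) ∂P'| := by
  have hfm := measurable_of_abs_sub_le_d1 hf
  have hfb : ∀ ξ, |f ξ| ≤ |f (placeAt loc 0)| + 1 := fun ξ => by
    have h1 := (hf ξ (placeAt loc 0)).trans (d1_le_one hdist _ _)
    have h2 := abs_sub_abs_le_abs_sub (f ξ) (f (placeAt loc 0))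
    linarith
  have hi : ∀ (ρ : Measure (Config Γ)) [IsProbabilityMeasure ρ], Integrable f ρ := fun ρ _ =>
    Integrable.of_bound hfm.aestronglyMeasurable _ (Filter.Eventually.of_forall hfb)
  have hi2 : ∀ (ρ : Measure (Config Γ)) [IsProbabilityMeasure ρ],
      Integrable (fun ξ => f (placeAt loc (cellCounts κ ξ))) ρ := fun ρ _ =>
    Integrable.of_bound ((Measurable.of_discrete (f := fun v : ι → ℕ => f (placeAt loc v))).comp
      (measurable_cellCounts hκ)).aestronglyMeasurable _ (Filter.Eventually.of_forall fun ξ => hfb _)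
  have hFi : ∀ (ρ : Measure (Config Γ)) [IsProbabilityMeasure ρ],
      ∫ ξ, F (cellCounts κ ξ) ∂ρ = ∫ ξ, f (placeAt loc (cellCounts κ ξ)) ∂ρ - c := fun ρ _ => by
    simp only [hF]
    rw [integral_sub (hi2 ρ) (integrable_const c)]
    simp
  have hd : ∀ (ρ : Measure (Config Γ)) [IsProbabilityMeasure ρ],
      |∫ ξ, f ξ ∂ρ - ∫ ξ, f (placeAt loc (cellCounts κ ξ)) ∂ρ| ≤ ε := fun ρ _ => by
    rw [← integral_sub (hi ρ) (hi2 ρ), ← Real.norm_eq_abs]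
    refine (norm_integral_le_of_norm_le_const (C := ε) (Filter.Eventually.of_forall fun ξ => ?_)).trans
      (by simp)
    exact (hf _ _).trans (d1_placeAt_cellCounts_le hκ hε hmesh ξ)
  have h1 := abs_le.1 (hd P)
  have h2 := abs_le.1 (hd P')
  rw [hFi P, hFi P', sub_sub_sub_cancel_right]
  have h3 := le_abs_self (∫ ξ, f (placeAt loc (cellCounts κ ξ)) ∂P -
    ∫ ξ, f (placeAt loc (cellCounts κ ξ)) ∂P')
  have h4 := neg_abs_le (∫ ξ, f (placeAt loc (cellCounts κ ξ)) ∂P -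
    ∫ ξ, f (placeAt loc (cellCounts κ ξ)) ∂P')
  exact abs_le.2 ⟨by linarith [h1.1, h2.2], by linarith [h1.2, h2.1]⟩

end Comparison

end BirthDeath

end

/-! ### The theorem -/

theorem theorem3p1 {Γ Ω : Type*} [MetricSpace Γ] [CompactSpace Γ] [MeasurableSpace Γ]
    [BorelSpace Γ] (hdist : ∀ x y : Γ, dist x y ≤ 1)
    [MeasurableSpace Ω] (Pr : Measure Ω) [IsProbabilityMeasure Pr]
    -- the point process, its law and its mean measure
    (Ξ : Ω → Config Γ) (hΞ : Measurable Ξ)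
    (P : Measure (Config Γ)) [IsProbabilityMeasure P] (hP : P = Pr.map Ξ)
    (lam : Measure Γ) (hlam : lam = meanMeasure P)
    (hlam_fin : lam Set.univ ≠ ∞) (hlam_pos : lam ≠ 0)
    -- reduced Palm processes and local dependence
    (Q : Kernel Γ (Config Γ)) [IsMarkovKernel Q] (hQ : IsReducedPalm P Q)
    (A B : Γ → Set Γ) (hloc : TypeILocalDependence P Q A B)
    -- the total number of points
    (N : Ω → ℝ) (hN : ∀ ω, N ω = ((Ξ ω).1 Set.univ).toReal)
    (hN2 : MemLp N 2 Pr) (hvar : ∫ ω, N ω ∂Pr ≤ variance N Pr)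
    -- the parameters of the approximating process
    (b a : ℝ) (hb : b = (variance N Pr - ∫ ω, N ω ∂Pr) / variance N Pr)
    (ha : a = (1 - b) * (lam Set.univ).toReal)
    (ν : Measure Γ) (hν : ν = (lam Set.univ)⁻¹ • lam)
    -- the partition, its centres and the constant of the error terms
    {k : ℕ} (G : Fin k → Set Γ) (t : Fin k → Γ) (hG : IsCentredPartition G t)
    (u : ℝ) (hu : 0 < u) :
    d2 P (pbdp a b 0 ν) ≤ 2 * mesh G t +
      ∫⁻ y, (ENNReal.ofReal (1 + b) *
              ((∫⁻ ζ, eps1 a u G t P (Q y) (A y) (B y) ζ ∂(Q y)) +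
                (∫⁻ ξ, eps1 a u G t P P (A y) (B y) ξ ∂P)) +
            ENNReal.ofReal b * (∫⁻ ζ, rMean a u G t P (B y) * ζ.1 (A y) ∂(Q y)) +
            ENNReal.ofReal b * (∫⁻ ζ, eps2 a u G t P (Q y) (A y) (B y) ζ ∂(Q y))) ∂lam := by
  classical
  subst hP hlam hν
  set P := Pr.map Ξ with hPdef
  have hfin : IsFiniteMeasure (meanMeasure P) := ⟨hlam_fin.lt_top⟩
  have hΓ : Nonempty Γ := by
    by_contra hc
    rw [not_nonempty_iff] at hc
    exact hlam_pos (Measure.eq_zero_of_isEmpty _)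
  have hL0 : meanMeasure P Set.univ ≠ 0 := fun h0 => hlam_pos (Measure.measure_univ_eq_zero.1 h0)
  have hL : 0 < (meanMeasure P).real Set.univ := ENNReal.toReal_pos hL0 hlam_fin
  -- the cells and their centres
  obtain ⟨idx, rfl⟩ : ∃ idx : Γ → Fin k, G = fun j => idx ⁻¹' {j} := by
    have hmem : ∀ x, ∃ j, x ∈ G j := fun x => by
      have : x ∈ ⋃ i, G i := by rw [hG.cover]; trivial
      simpa using this
    choose idx hidx using hmem
    refine ⟨idx, funext fun j => Set.ext fun x => ⟨fun hx => ?_, ?_⟩⟩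
    · by_contra hne
      exact Set.disjoint_left.1 (hG.disjoint hne) (hidx x) hx
    · rintro rfl
      exact hidx x
  have hidx : Measurable idx := measurable_to_countable' hG.measurableSet
  -- Different cells may share a centre, and then assembled configurations cannot tell them apart.
  -- The types are therefore the distinct centres, and cells with a common centre are merged.
  let s : Fin k → Set.range t := fun j => ⟨t j, j, rfl⟩
  have hs : Function.Surjective s := by
    rintro ⟨_, j, rfl⟩
    exact ⟨j, rfl⟩
  have : Fintype (Set.range t) := Fintype.ofFinite _
  let κ : Γ → Set.range t := fun x => s (idx x)
  have hκ : Measurable κ := (Measurable.of_discrete (f := s)).comp hidx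
  have hmesh1 : mesh (fun j => idx ⁻¹' {j}) t ≤ 1 := by
    refine iSup_le fun i => iSup₂_le fun x _ => ?_
    rw [edist_dist, ← ENNReal.ofReal_one]
    exact ENNReal.ofReal_le_ofReal (hdist _ _)
  have hmeshfin : mesh (fun j => idx ⁻¹' {j}) t ≠ ∞ := (hmesh1.trans_lt ENNReal.one_lt_top).ne
  have hmesh : ∀ x, dist x (t (idx x)) ≤ (mesh (fun j => idx ⁻¹' {j}) t).toReal := fun x => by
    rw [dist_edist]
    refine ENNReal.toReal_mono hmeshfin ?_
    exact le_iSup_of_le (idx x) (le_iSup₂_of_le x rfl le_rfl)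
  -- moments of the total number of points
  have hNt : ∀ ω, N ω = (BirthDeath.tot (BirthDeath.cellCounts κ (Ξ ω)) : ℝ) := fun ω => by
    rw [hN, ← BirthDeath.coe_tot_cellCounts hκ, ENNReal.toReal_natCast]
  have hmt : ∀ g : ℕ → ℝ, Measurable fun ξ : Config Γ =>
      g (BirthDeath.tot (BirthDeath.cellCounts κ ξ)) := fun g =>
    (Measurable.of_discrete (f := fun v : Set.range t → ℕ => g (BirthDeath.tot v))).comp
      (BirthDeath.measurable_cellCounts hκ)
  have hsq : Integrable (fun ξ => (BirthDeath.tot (BirthDeath.cellCounts κ ξ) : ℝ) ^ 2) P := by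
    rw [hPdef, integrable_map_measure (hmt fun n => (n : ℝ) ^ 2).aestronglyMeasurable
      hΞ.aemeasurable]
    refine hN2.integrable_sq.congr (Filter.Eventually.of_forall fun ω => ?_)
    simp only [hNt, Function.comp_apply]
  have hEN : ∫ ω, N ω ∂Pr = (meanMeasure P).real Set.univ := by
    rw [← BirthDeath.integral_tot hκ, hPdef, integral_map hΞ.aemeasurable
      (hmt fun n => (n : ℝ)).aestronglyMeasurable]
    exact integral_congr_ae (Filter.Eventually.of_forall hNt)
  have hEN2 : ∫ ω, N ω ^ 2 ∂Pr =
      ∫ ξ, (BirthDeath.tot (BirthDeath.cellCounts κ ξ) : ℝ) ^ 2 ∂P := by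
    rw [hPdef, integral_map hΞ.aemeasurable (hmt fun n => (n : ℝ) ^ 2).aestronglyMeasurable]
    exact integral_congr_ae (Filter.Eventually.of_forall fun ω => by simp only [hNt])
  have hV : variance N Pr = ∫ ξ, (BirthDeath.tot (BirthDeath.cellCounts κ ξ) : ℝ) ^ 2 ∂P -
      (meanMeasure P).real Set.univ ^ 2 := by
    rw [variance_eq_sub hN2, ← hEN, ← hEN2]
    rfl
  rw [hEN] at hvar hb
  have hVpos : 0 < variance N Pr := hL.trans_le hvar
  have hb0 : 0 ≤ b := by rw [hb]; exact div_nonneg (by linarith) hVpos.le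
  have hb1 : b < 1 := by rw [hb, div_lt_one hVpos]; linarith
  have ha0 : 0 < a := by rw [ha]; exact mul_pos (by linarith) hL
  have hbeq : b * variance N Pr = variance N Pr - (meanMeasure P).real Set.univ := by
    rw [hb, div_mul_cancel₀ _ hVpos.ne']
  rw [hV] at hbeq
  -- the law of a point
  set ν : Measure Γ := (meanMeasure P Set.univ)⁻¹ • meanMeasure P with hν
  have hνp : IsProbabilityMeasure ν := ⟨by
    rw [hν, Measure.smul_apply, smul_eq_mul, ENNReal.inv_mul_cancel hL0 hlam_fin]⟩
  have hνr : ∀ S, (meanMeasure P).real S = (meanMeasure P).real Set.univ * ν.real S := fun S => by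
    rw [hν, measureReal_ennreal_smul_apply, ENNReal.toReal_inv, ← measureReal_def,
      mul_inv_cancel_left₀ hL.ne']
  have hp1 : ∑ i, ν.real (κ ⁻¹' {i}) = 1 := by
    simpa using (BirthDeath.integral_cell (ν := ν) hκ fun _ => 1).symm
  have hpi := BirthDeath.isProbabilityMeasure_pbdp (ν := ν) ha0 hb0 hb1
  refine iSup_le fun f => ?_
  -- the Stein solution of the normalised test function
  have hosc : ∀ v w : Set.range t → ℕ, f.1 (BirthDeath.placeAt Subtype.val v) - 1 ≤
      f.1 (BirthDeath.placeAt Subtype.val w) := fun v w => by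
    have := (abs_le.1 ((f.2 (BirthDeath.placeAt Subtype.val v)
      (BirthDeath.placeAt Subtype.val w)).trans (BirthDeath.d1_le_one hdist _ _))).2
    linarith
  have hbdd : BddBelow (Set.range fun w : Set.range t → ℕ =>
      f.1 (BirthDeath.placeAt Subtype.val w)) :=
    ⟨f.1 (BirthDeath.placeAt Subtype.val (0 : Set.range t → ℕ)) - 1, by
      rintro _ ⟨w, rfl⟩
      exact hosc 0 w⟩
  -- As `d1 ≤ 1`, the oscillation of the test function is at most 1; subtracting its infimum brings
  -- it into `[0, 1]` without changing differences of means.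
  set m₀ : ℝ := ⨅ w : Set.range t → ℕ, f.1 (BirthDeath.placeAt Subtype.val w) with hm₀
  let F : (Set.range t → ℕ) → ℝ := fun v => f.1 (BirthDeath.placeAt Subtype.val v) - m₀
  have hF0 : ∀ v, 0 ≤ F v := fun v => sub_nonneg.2 (ciInf_le hbdd v)
  have hF1 : ∀ v, F v ≤ 1 := fun v => by
    have := le_ciInf (hosc v)
    simp only [F]
    linarith
  have hFs : ∀ v i j, |F (v + Pi.single i 1) - F (v + Pi.single j 1)| ≤
      1 / ((BirthDeath.tot v : ℝ) + 1) := fun v i j => by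
    simp only [F, sub_sub_sub_cancel_right]
    exact (f.2 _ _).trans (BirthDeath.d1_placeAt_swap_le hdist v i j)
  obtain ⟨h, c, C, hgen, H⟩ := BirthDeath.exists_stein_solution
    (p := fun i => ν.real (κ ⁻¹' {i})) (fun i => measureReal_nonneg) hp1 ha0 hb0 hb1 hF0 hF1 hFs
  have hpb := BirthDeath.integral_pbdp_eq hκ ha0 hb0 hb1 hF0 hF1 H.incr hgen
  have hcmp := BirthDeath.abs_integral_sub_le hdist hκ ENNReal.toReal_nonneg hmesh f.2 P
    (pbdp a b 0 ν) (F := F) (c := m₀) fun v => rfl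
  have hFi : Integrable (fun ξ => F (BirthDeath.cellCounts κ ξ)) P :=
    Integrable.of_bound ((Measurable.of_discrete (f := F)).comp
      (BirthDeath.measurable_cellCounts hκ)).aestronglyMeasurable 1
      (Filter.Eventually.of_forall fun ξ => by
        rw [Real.norm_of_nonneg (hF0 _)]; exact hF1 _)
  have hgenP : ∫ ξ, BirthDeath.gen (fun i => ν.real (κ ⁻¹' {i})) (fun k => a + b * k) h
      (BirthDeath.cellCounts κ ξ) ∂P = ∫ ξ, F (BirthDeath.cellCounts κ ξ) ∂P - c := by
    simp only [hgen]
    rw [integral_sub hFi (integrable_const c)]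
    simp
  rw [hpb, ← hgenP] at hcmp
  refine (ENNReal.ofReal_le_ofReal hcmp).trans ?_
  rw [ENNReal.ofReal_add (by positivity) (abs_nonneg _), ENNReal.ofReal_mul zero_le_two,
    ENNReal.ofReal_toReal hmeshfin, ENNReal.ofReal_ofNat]
  refine add_le_add le_rfl ?_
  exact BirthDeath.ofReal_abs_integral_gen_le (loc := Subtype.val) H ha0 hu
    (fun i => measureReal_nonneg) hp1 hb0 hidx hs Subtype.val_injective hQ hloc
    (fun i => hνr _) ha hsq hbeq
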